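/- **Setting.** Let $k\ge 1$ and let $\Lambda$ be a finite, strongly connected $k$-graph with at least one vertex. That is, $\Lambda$ is a countable small category with degree functor $d:\Lambda\to\mathbb N^k$ having the factorization property (if $d(\lambda)=m+n$ then $\lambda=\mu\nu$ for unique $\mu,\nu$ with $d(\mu)=m$, $d(\nu)=n$); there are finitely many morphisms of each degree; and for all vertices $v,w\in\Lambda^0$ there is a morphism with range $v$ and source $w$. Let $A_i(v,w)$ be the number of morphisms of degree $e_i$ with range $v$ and source $w$, and let $\rho_i$ be the spectral radius of $A_i$. Assume that every vertex receives at least two edges of each colour, i.e. $\sum_{w}A_i(v,w)\ge 2$ for all $v\in\Lambda^0$ and $1\le i\le k$, and that $A=A_1\cdots A_k$ is irreducible. For $n\in\mathbb N^k$ put $\rho(\Lambda)^{n}=\rho_1^{n_1}\cdots\rho_k^{n_k}$. Let $\Lambda^\infty$ be the space of infinite paths (degree-preserving functors $x:\Omega_k\to\Lambda$, where $\Omega_k$ has object set $\mathbb N^k$ and exactly one morphism $(m,n)$, of range $m$, source $n$ and degree $n-m$, for each $m\le n$), with the topology generated by the cylinder sets $[\lambda]=\{x: x(0,d(\lambda))=\lambda\}$,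 $\lambda\in\Lambda$. Let $\mathcal B_\Lambda$ be the stationary $k$-Bratteli diagram of $\Lambda$: each level $n\ge 0$ is a copy of $\Lambda^0$, and the edges from level $n+1$ to level $n$ are the morphisms of degree $e_i$ with $i\equiv n+1 \pmod k$. Let $X=X_{\mathcal B_\Lambda}$ be its space of infinite paths and $F\mathcal B_\Lambda$ its set of finite paths with range in level $0$ (including the vertices, as paths of length $0$). For $\gamma\in F\mathcal B_\Lambda$ let $[\gamma]\subseteq X$ be the set of infinite paths with initial segment $\gamma$; these sets generate the topology of $X$. Cutting an infinite path into edges of colours $1,\dots,k,1,\dots,k,\dots$ defines a map $\Lambda^\infty\to X$. For $\delta\in(0,1)$ and a path $\eta\in F\mathcal B_\Lambda$ of length $qk+t$, $0\le t<k$, let $$w_\delta(\eta)=\big(\rho_1^{q+1}\cdots\rho_t^{q+1}\rho_{t+1}^{q}\cdots\rho_k^{q}\big)^{-1/\delta}\,x^\Lambda_{s(\eta)},$$ where $x^\Lambda\in(0,\infty)^{\Lambda^0}$ is the Perron–Frobenius eigenvector: $\sum_v x^\Lambda_v=1$ and $A_ix^\Lambda=\rho_ix^\Lambda$ for all $i$.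 For $x,y\in X$ let $d_\delta(x,y)$ be $0$ if $x=y$, $1$ if $x,y$ have different ranges, and otherwise $w_\delta$ of the longest common initial segment of $x$ and $y$. A *choice function* is a map $\tau=(\tau_+,\tau_-):F\mathcal B_\Lambda\to X\times X$ with $\tau_\pm(\gamma)\in[\gamma]$ and $d_\delta(\tau_+(\gamma),\tau_-(\gamma))=\operatorname{diam}[\gamma]$. On $\ell^2(F\mathcal B_\Lambda,\mathbb C^2)$ put $$\pi_\tau(f)=\bigoplus_{\gamma}\begin{pmatrix} f(\tau_+(\gamma))&0\\0&f(\tau_-(\gamma))\end{pmatrix},\qquad D=\bigoplus_\gamma \frac1{\operatorname{diam}[\gamma]}\begin{pmatrix}0&1\\1&0\end{pmatrix}.$$ For a positive operator $T$ let $\mathcal T(T)=\lim_{s\searrow1}(s-1)\operatorname{Tr}(T^s)$, whenever this limit exists and is finite. **Theorem.** The Perron–Frobenius eigenvector $x^\Lambda$ exists and is unique; the map $\Lambda^\infty\to X$ is a homeomorphism, by which we identify the two spaces; and there is a unique Borel measure $M$ on $\Lambda^\infty$ (the an Huef–Laca–Raeburn–Sims measure) with $$M([\lambda])=\rho(\Lambda)^{-d(\lambda)}\,x^\Lambda_{s(\lambda)}\qquad\text{for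 all }\lambda\in\Lambda;$$ it is a probability measure. For every $\delta\in(0,1)$, choice functions exist, and there is a finite nonzero Borel measure $\mu_\delta$ on $X$ such that, for every choice function $\tau$, $\mu_\delta$ is the unique finite Borel measure with $$\mu_\delta([\gamma])=\mathcal T\big(\pi_\tau(\chi_{[\gamma]})|D|^{-\delta}\big)\qquad\text{for all }\gamma\in F\mathcal B_\Lambda$$ (in particular the operators are positive and these limits exist and are finite). The normalization $\nu_\delta=\mu_\delta/\mu_\delta(X)$ agrees with $M$ on all Borel sets: $$\nu_\delta(O)=\frac{\mu_\delta(O)}{\mu_\delta(X)}=M(O)\qquad\text{for every Borel set }O\subseteq X.$$ Moreover, for every choice function $\tau$ and every clopen $O\subseteq X$ one has $\mu_\delta(O)=\mathcal T(\pi_\tau(\chi_O)|D|^{-\delta})$ and $\mu_\delta(X)=\mathcal T(|D|^{-\delta})$, so that $\nu_\delta(O)=\mathcal T(\pi_\tau(\chi_O)|D|^{-\delta})/\mathcal T(|D|^{-\delta})$. In particular $\nu_\delta$ is a probability measure that does not depend on $\delta$. -/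

import Mathlib

open MeasureTheory Filter Topology
open scoped ENNReal

universe u

/-! ### Bratteli diagrams, their path spaces and choice functions -/

/-- A Bratteli diagram.  `E n` is the set of edges from level `n + 1` to level `n`
(edges point towards level `0`): `s e` is the source of `e`, `r e` its range. -/
structure BratteliDiagram where
  V : ℕ → Type u
  E : ℕ → Type u
  finite_V : ∀ n, Finite (V n)
  finite_E : ∀ n, Finite (E n)
  r : ∀ {n}, E n → V n
  s : ∀ {n}, E n → V (n + 1)

namespace BratteliDiagram

variable (B : BratteliDiagram.{u})

/-- The finite paths of length `n` with range in level `0` and with source `v` in level `n`. -/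
inductive Path : (n : ℕ) → B.V n → Type u
  | nil (v : B.V 0) : Path 0 v
  | snoc {n : ℕ} {v : B.V n} (γ : Path n v) (e : B.E n) (h : B.r e = v) : Path (n + 1) (B.s e)

/-- All finite paths with range in level `0`; `γ.1` is the length and `γ.2.1` the source. -/
abbrev FinPath : Type u := Σ n : ℕ, Σ v : B.V n, B.Path n v

/-- The space of infinite paths. -/
@[ext] structure PathSpace where
  edge : ∀ n, B.E n
  compat : ∀ n, B.s (edge n) = B.r (edge (n + 1))

variable {B}

/-- The cylinder set of a finite path. -/
def Path.cylinder : ∀ {n : ℕ} {v : B.V n}, B.Path n v → Set B.PathSpace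
  | _, _, .nil v => {x | B.r (x.edge 0) = v}
  | _, _, .snoc γ e _ => {x | x ∈ γ.cylinder ∧ x.edge _ = e}

/-- The cylinder set `[γ]` of a finite path `γ`. -/
def FinPath.cylinder (γ : B.FinPath) : Set B.PathSpace := γ.2.2.cylinder

/-- The topology generated by the cylinder sets. -/
instance : TopologicalSpace B.PathSpace :=
  TopologicalSpace.generateFrom (Set.range (FinPath.cylinder (B := B)))

instance : MeasurableSpace B.PathSpace := borel _

instance : BorelSpace B.PathSpace := ⟨rfl⟩

/-- The `n`-th vertex of an infinite path. -/
def PathSpace.vtx (x : B.PathSpace) : ∀ n, B.V n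
  | 0 => B.r (x.edge 0)
  | n + 1 => B.s (x.edge n)

theorem PathSpace.r_edge (x : B.PathSpace) : ∀ n, B.r (x.edge n) = x.vtx n
  | 0 => rfl
  | n + 1 => (x.compat n).symm

/-- The initial segment of length `n` of an infinite path. -/
def PathSpace.takeAux (x : B.PathSpace) : ∀ n, B.Path n (x.vtx n)
  | 0 => .nil _
  | n + 1 => .snoc (x.takeAux n) (x.edge n) (x.r_edge n)

/-- The initial segment of length `n` of an infinite path. -/
def PathSpace.take (x : B.PathSpace) (n : ℕ) : B.FinPath := ⟨n, x.vtx n, x.takeAux n⟩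

/-- The longest common initial segment `x ∧ y` of two distinct infinite paths that have the same
range. -/
noncomputable def PathSpace.meet (x y : B.PathSpace) : B.FinPath :=
  x.take (sSup {n : ℕ | x.take n = y.take n})

open Classical in
/-- The ultrametric `d_w` of a weight `w`: `d_w(x, x) = 0`, `d_w(x, y) = 1` if `x` and `y` have no
common initial segment (not even a common range), and `d_w(x, y) = w(x ∧ y)` otherwise. -/
noncomputable def pathDist (w : B.FinPath → ℝ) (x y : B.PathSpace) : ℝ :=
  if x = y then 0
  else if B.r (x.edge 0) ≠ B.r (y.edge 0) then 1
  else w (x.meet y)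

/-- The diameter of the cylinder set `[γ]` for `d_w`. -/
noncomputable def cylDiam (w : B.FinPath → ℝ) (γ : B.FinPath) : ℝ :=
  sSup {t : ℝ | ∃ x ∈ γ.cylinder, ∃ y ∈ γ.cylinder, t = pathDist w x y}

/-- A choice function: it assigns to every finite path `γ` a pair of points of `[γ]` whose distance
is the diameter of `[γ]`. -/
structure ChoiceFunction (w : B.FinPath → ℝ) where
  pos : B.FinPath → B.PathSpace
  neg : B.FinPath → B.PathSpace
  pos_mem : ∀ γ, pos γ ∈ γ.cylinder
  neg_mem : ∀ γ, neg γ ∈ γ.cylinder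
  dist_eq : ∀ γ, pathDist w (pos γ) (neg γ) = cylDiam w γ

end BratteliDiagram

/-! ### Direct sums of operators on `ℓ²(ι, ℂ²)`, trace and Dixmier trace -/

/-- The Hilbert space `ℓ²(ι, ℂ²)`. -/
def L2C2 (ι : Type u) : Type u := lp (fun _ : ι => EuclideanSpace ℂ (Fin 2)) 2

section Operators

variable {ι : Type u}

noncomputable instance : NormedAddCommGroup (L2C2 ι) :=
  inferInstanceAs (NormedAddCommGroup (lp (fun _ : ι => EuclideanSpace ℂ (Fin 2)) 2))

noncomputable instance : InnerProductSpace ℂ (L2C2 ι) :=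
  inferInstanceAs (InnerProductSpace ℂ (lp (fun _ : ι => EuclideanSpace ℂ (Fin 2)) 2))

instance : CompleteSpace (L2C2 ι) :=
  inferInstanceAs (CompleteSpace (lp (fun _ : ι => EuclideanSpace ℂ (Fin 2)) 2))

/-- The coordinate `ψ(i)` of `ψ ∈ ℓ²(ι, ℂ²)`. -/
def L2C2.coord (ψ : L2C2 ι) (i : ι) : EuclideanSpace ℂ (Fin 2) := ψ.1 i

/-- The element of `ℓ²(ι, ℂ²)` with given square-summable coordinates. -/
def L2C2.mk (f : ι → EuclideanSpace ℂ (Fin 2)) (hf : Memℓp f 2) : L2C2 ι := ⟨f, hf⟩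

theorem L2C2.memℓp (ψ : L2C2 ι) : Memℓp ψ.coord 2 := ψ.2

@[ext] theorem L2C2.ext {ψ φ : L2C2 ι} (h : ∀ i, ψ.coord i = φ.coord i) : ψ = φ :=
  Subtype.ext (funext h)

@[simp] theorem L2C2.coord_mk (f : ι → EuclideanSpace ℂ (Fin 2)) (hf : Memℓp f 2) (i : ι) :
    (L2C2.mk f hf).coord i = f i := rfl

@[simp] theorem L2C2.coord_zero (i : ι) : (0 : L2C2 ι).coord i = 0 := rfl

@[simp] theorem L2C2.coord_add (ψ φ : L2C2 ι) (i : ι) :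
    (ψ + φ).coord i = ψ.coord i + φ.coord i := rfl

@[simp] theorem L2C2.coord_smul (c : ℂ) (ψ : L2C2 ι) (i : ι) :
    (c • ψ).coord i = c • ψ.coord i := rfl

/-- The operator of a `2 × 2` matrix on the Hilbert space `ℂ²`. -/
noncomputable def matOp (a : Matrix (Fin 2) (Fin 2) ℂ) :
    EuclideanSpace ℂ (Fin 2) →L[ℂ] EuclideanSpace ℂ (Fin 2) :=
  Matrix.toEuclideanCLM (n := Fin 2) (𝕜 := ℂ) a

theorem memℓp_blockDiag {a : ι → Matrix (Fin 2) (Fin 2) ℂ} {C : ℝ}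
    (hC : ∀ i, ‖matOp (a i)‖ ≤ C) (ψ : L2C2 ι) :
    Memℓp (fun i => matOp (a i) (ψ.coord i)) 2 := by
  have h : Memℓp ((C : ℂ) • ψ.coord) 2 := ψ.memℓp.const_smul (C : ℂ)
  refine (memℓp_gen_iff (by norm_num)).2 ?_
  refine Summable.of_nonneg_of_le (fun i => by positivity) (fun i => ?_)
    ((memℓp_gen_iff (by norm_num)).1 h)
  have h0 : 0 ≤ C := (norm_nonneg _).trans (hC i)
  have h1 : ‖matOp (a i) (ψ.coord i)‖ ≤ ‖((C : ℂ) • ψ.coord) i‖ := by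
    rw [Pi.smul_apply, norm_smul, Complex.norm_real, Real.norm_of_nonneg h0]
    exact (ContinuousLinearMap.le_opNorm _ _).trans
      (mul_le_mul_of_nonneg_right (hC i) (norm_nonneg _))
  exact Real.rpow_le_rpow (norm_nonneg _) h1 (by norm_num)

open Classical in
/-- The bounded operator `⨁ᵢ aᵢ` on `ℓ²(ι, ℂ²)` of a uniformly bounded family of `2 × 2` matrices
(and `0` if the family is not uniformly bounded). -/
noncomputable def blockDiag (a : ι → Matrix (Fin 2) (Fin 2) ℂ) : L2C2 ι →L[ℂ] L2C2 ι :=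
  if h : ∃ C : ℝ, ∀ i, ‖matOp (a i)‖ ≤ C then
    LinearMap.mkContinuous
      { toFun := fun ψ => L2C2.mk (fun i => matOp (a i) (ψ.coord i))
          (memℓp_blockDiag h.choose_spec ψ)
        map_add' := fun ψ φ => by ext1 i; simp
        map_smul' := fun c ψ => by ext1 i; simp }
      (max h.choose 0)
      (fun ψ => by
        have h0 : (0 : ℝ) ≤ max h.choose 0 := le_max_right _ _
        refine lp.norm_le_of_forall_sum_le (E := fun _ : ι => EuclideanSpace ℂ (Fin 2)) (p := 2)
          (by norm_num) (by positivity) (fun t => ?_)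
        have hψ := lp.sum_rpow_le_norm_rpow (E := fun _ : ι => EuclideanSpace ℂ (Fin 2)) (p := 2)
          (by norm_num) ψ t
        rw [Real.mul_rpow h0 (norm_nonneg _)]
        refine le_trans ?_ (mul_le_mul_of_nonneg_left hψ (by positivity))
        rw [Finset.mul_sum]
        refine Finset.sum_le_sum (fun i _ => ?_)
        rw [← Real.mul_rpow h0 (norm_nonneg _)]
        refine Real.rpow_le_rpow (norm_nonneg _) ?_ (by norm_num)
        exact (ContinuousLinearMap.le_opNorm _ _).trans
          (mul_le_mul_of_nonneg_right ((h.choose_spec i).trans (le_max_left _ _))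
            (norm_nonneg _)))
  else 0

theorem coord_blockDiag {a : ι → Matrix (Fin 2) (Fin 2) ℂ} {C : ℝ}
    (h : ∀ i, ‖matOp (a i)‖ ≤ C) (ψ : L2C2 ι) (i : ι) :
    (blockDiag a ψ).coord i = matOp (a i) (ψ.coord i) := by
  have h' : ∃ C : ℝ, ∀ i, ‖matOp (a i)‖ ≤ C := ⟨C, h⟩
  simp only [blockDiag, dif_pos h']
  rfl

open Classical in
/-- The vector `δ_i ⊗ e_j` of the standard orthonormal basis of `ℓ²(ι, ℂ²)`. -/
noncomputable def stdVec (i : ι) (j : Fin 2) : L2C2 ι :=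
  lp.single (E := fun _ : ι => EuclideanSpace ℂ (Fin 2)) 2 i (EuclideanSpace.single j (1 : ℂ))

/-- The trace of a positive operator on `ℓ²(ι, ℂ²)`, with values in `[0, ∞]`. -/
noncomputable def posTrace (T : L2C2 ι →L[ℂ] L2C2 ι) : ℝ≥0∞ :=
  ∑' i : ι, ∑ j : Fin 2, ENNReal.ofReal (inner ℂ (stdVec i j) (T (stdVec i j))).re

/-- `T` is a positive operator whose Dixmier trace `𝒯(T) = lim_{s ↘ 1} (s - 1) Tr(T ^ s)` exists
and is equal to `c`; here `T ^ s` is given by the continuous functional calculus. -/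
def HasDixmierTrace (T : L2C2 ι →L[ℂ] L2C2 ι) (c : ℝ≥0∞) : Prop :=
  0 ≤ T ∧ Tendsto (fun s : ℝ => ENNReal.ofReal (s - 1) * posTrace (T ^ s)) (𝓝[>] 1) (𝓝 c)

end Operators

/-! ### The Pearson-Bellissard spectral triple of a weighted Bratteli diagram -/

namespace BratteliDiagram

variable {B : BratteliDiagram.{u}}

/-- The representation `π_τ(f) = ⨁_γ diag(f(τ₊(γ)), f(τ₋(γ)))` of bounded functions `f`. -/
noncomputable def ChoiceFunction.rep {w : B.FinPath → ℝ} (τ : ChoiceFunction w)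
    (f : B.PathSpace → ℂ) : L2C2 B.FinPath →L[ℂ] L2C2 B.FinPath :=
  blockDiag fun γ => !![f (τ.pos γ), 0; 0, f (τ.neg γ)]

/-- The `γ`-block `diam[γ]⁻¹ (0 1; 1 0)` of the Dirac operator. -/
noncomputable def diracBlock (w : B.FinPath → ℝ) (γ : B.FinPath) : Matrix (Fin 2) (Fin 2) ℂ :=
  ((cylDiam w γ)⁻¹ : ℂ) • !![0, 1; 1, 0]

/-- The Dirac operator `D = ⨁_γ diam[γ]⁻¹ (0 1; 1 0)`, an unbounded operator with domain
`{ψ : Dψ ∈ ℓ²}`. -/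
noncomputable def dirac (w : B.FinPath → ℝ) : L2C2 B.FinPath →ₗ.[ℂ] L2C2 B.FinPath where
  domain :=
    { carrier := {ψ | Memℓp (fun γ => matOp (diracBlock w γ) (ψ.coord γ)) 2}
      add_mem' := fun {ψ φ} hψ hφ => by
        have := Memℓp.add hψ hφ
        change Memℓp (fun γ => matOp (diracBlock w γ) ((ψ + φ).coord γ)) 2
        simp only [L2C2.coord_add, map_add]
        exact this
      zero_mem' := by
        change Memℓp (fun γ => matOp (diracBlock w γ) ((0 : L2C2 B.FinPath).coord γ)) 2
        simp only [L2C2.coord_zero, map_zero]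
        exact zero_memℓp
      smul_mem' := fun c ψ hψ => by
        have := Memℓp.const_smul hψ c
        change Memℓp (fun γ => matOp (diracBlock w γ) ((c • ψ).coord γ)) 2
        simp only [L2C2.coord_smul, map_smul]
        exact this }
  toFun :=
    { toFun := fun ψ => L2C2.mk (fun γ => matOp (diracBlock w γ) (ψ.1.coord γ)) ψ.2
      map_add' := fun ψ φ => by
        ext1 γ
        simp only [L2C2.coord_mk, L2C2.coord_add, Submodule.coe_add, map_add]
      map_smul' := fun c ψ => by
        ext1 γ
        simp only [L2C2.coord_mk, L2C2.coord_smul, Submodule.coe_smul, map_smul,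
          RingHom.id_apply] }

/-- The inverse `D⁻¹ = ⨁_γ diam[γ] (0 1; 1 0)` of the Dirac operator, a bounded operator. -/
noncomputable def diracInv (w : B.FinPath → ℝ) : L2C2 B.FinPath →L[ℂ] L2C2 B.FinPath :=
  blockDiag fun γ => (cylDiam w γ : ℂ) • !![0, 1; 1, 0]

/-- `diracInv w` is the two-sided inverse of the Dirac operator. -/
theorem diracInv_spec (w : B.FinPath → ℝ) {C : ℝ}
    (hC : ∀ γ, cylDiam w γ ≤ C) (hpos : ∀ γ, 0 < cylDiam w γ) :
    (∀ ψ, ∃ h : diracInv w ψ ∈ (dirac w).domain, dirac w ⟨diracInv w ψ, h⟩ = ψ) ∧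
      ∀ ψ : (dirac w).domain, diracInv w (dirac w ψ) = ψ := by
  have hb : ∀ γ, ‖matOp ((cylDiam w γ : ℂ) • !![0, 1; 1, 0])‖ ≤ C * ‖matOp !![0, 1; 1, 0]‖ := by
    intro γ
    rw [matOp, map_smul, norm_smul, Complex.norm_real, Real.norm_of_nonneg (hpos γ).le]
    exact mul_le_mul_of_nonneg_right (hC γ) (norm_nonneg _)
  have hmul : ∀ a b : Matrix (Fin 2) (Fin 2) ℂ, a * b = 1 → ∀ v, matOp a (matOp b v) = v := by
    intro a b hab v
    have : matOp a * matOp b = 1 := by rw [matOp, matOp, ← map_mul, hab, map_one]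
    exact congrArg (fun T => T v) this
  have h1 : ∀ γ, diracBlock w γ * ((cylDiam w γ : ℂ) • !![0, 1; 1, 0]) = 1 := by
    intro γ
    have h0 : (cylDiam w γ : ℂ) ≠ 0 := Complex.ofReal_ne_zero.2 (hpos γ).ne'
    ext i j
    fin_cases i <;> fin_cases j <;> simp [diracBlock, Matrix.mul_apply, h0]
  have h2 : ∀ γ, ((cylDiam w γ : ℂ) • !![0, 1; 1, 0]) * diracBlock w γ = 1 := by
    intro γ
    have h0 : (cylDiam w γ : ℂ) ≠ 0 := Complex.ofReal_ne_zero.2 (hpos γ).ne'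
    ext i j
    fin_cases i <;> fin_cases j <;> simp [diracBlock, Matrix.mul_apply, h0]
  have h3 : ∀ (ψ : L2C2 B.FinPath) γ,
      matOp (diracBlock w γ) ((diracInv w ψ).coord γ) = ψ.coord γ := by
    intro ψ γ
    rw [diracInv, coord_blockDiag hb]
    exact hmul _ _ (h1 γ) _
  refine ⟨fun ψ => ⟨?_, ?_⟩, fun ψ => ?_⟩
  · change Memℓp (fun γ => matOp (diracBlock w γ) ((diracInv w ψ).coord γ)) 2
    simp only [h3]
    exact ψ.memℓp
  · ext1 γ
    exact h3 ψ γ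
  · ext1 γ
    rw [diracInv, coord_blockDiag hb]
    exact hmul _ _ (h2 γ) _

/-- The operator `|D|^{-t} = (|D|⁻¹) ^ t` for `t > 0`, where `|D|⁻¹ = |D⁻¹|`; absolute value and
power are given by the continuous functional calculus. -/
noncomputable def absDiracPow (w : B.FinPath → ℝ) (t : ℝ) :
    L2C2 B.FinPath →L[ℂ] L2C2 B.FinPath :=
  CFC.abs (diracInv w) ^ t

/-- The multiplier `χ_O`. -/
noncomputable def chi (O : Set B.PathSpace) : B.PathSpace → ℂ := O.indicator 1

end BratteliDiagram

/-! ### Higher-rank graphs -/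

/-- A `k`-graph: a countable small category, in arrows-only form, with a degree functor to `ℕ^k`
that has the factorization property.  `comp f g` is the composite `f g`, which is meaningful only
if `s f = r g`. -/
structure KGraph (k : ℕ) where
  Vert : Type u
  Mor : Type u
  countable_mor : Countable Mor
  r : Mor → Vert
  s : Mor → Vert
  one : Vert → Mor
  comp : Mor → Mor → Mor
  r_one : ∀ v, r (one v) = v
  s_one : ∀ v, s (one v) = v
  r_comp : ∀ f g, s f = r g → r (comp f g) = r f
  s_comp : ∀ f g, s f = r g → s (comp f g) = s g
  one_comp : ∀ f, comp (one (r f)) f = f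
  comp_one : ∀ f, comp f (one (s f)) = f
  assoc : ∀ f g h, s f = r g → s g = r h → comp (comp f g) h = comp f (comp g h)
  d : Mor → Fin k → ℕ
  d_one : ∀ v, d (one v) = 0
  d_comp : ∀ f g, s f = r g → d (comp f g) = d f + d g
  factorization : ∀ (l : Mor) (m n : Fin k → ℕ), d l = m + n →
    ∃! p : Mor × Mor, s p.1 = r p.2 ∧ d p.1 = m ∧ d p.2 = n ∧ comp p.1 p.2 = l

namespace KGraph

variable {k : ℕ} (Λ : KGraph.{u} k)

/-- `Λ` is finite: for every `n` there are only finitely many morphisms of degree `n`. -/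
class IsFinite : Prop where
  finite_deg : ∀ n : Fin k → ℕ, {l : Λ.Mor | Λ.d l = n}.Finite

instance [Λ.IsFinite] : Finite Λ.Vert := by
  have : Finite {l : Λ.Mor | Λ.d l = 0} := (IsFinite.finite_deg (Λ := Λ) 0).to_subtype
  refine Finite.of_injective
    (fun v : Λ.Vert => (⟨Λ.one v, Λ.d_one v⟩ : {l : Λ.Mor | Λ.d l = 0})) (fun v w h => ?_)
  have h' : Λ.one v = Λ.one w := congrArg Subtype.val h
  rw [← Λ.r_one v, h', Λ.r_one]

noncomputable instance [Λ.IsFinite] : Fintype Λ.Vert := Fintype.ofFinite _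

noncomputable instance : DecidableEq Λ.Vert := Classical.decEq _

/-- `Λ` is strongly connected: `v Λ w` is nonempty for all vertices `v`, `w`. -/
def StronglyConnected : Prop := ∀ v w : Λ.Vert, ∃ l : Λ.Mor, Λ.r l = v ∧ Λ.s l = w

/-- The `i`-th adjacency matrix: `A_i(v, w)` is the number of morphisms of degree `e_i` with range
`v` and source `w`. -/
noncomputable def adj (i : Fin k) : Matrix Λ.Vert Λ.Vert ℕ := fun v w =>
  Nat.card {l : Λ.Mor // Λ.d l = Pi.single i 1 ∧ Λ.r l = v ∧ Λ.s l = w}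

section Finite

variable [Λ.IsFinite]

/-- The product `A = A_1 ⋯ A_k`. -/
noncomputable def adjProd : Matrix Λ.Vert Λ.Vert ℕ := (List.ofFn Λ.adj).prod

/-- The spectral radius `ρ_i` of `A_i`. -/
noncomputable def rho (i : Fin k) : ℝ :=
  (spectralRadius ℂ ((Λ.adj i).map (Nat.cast : ℕ → ℂ))).toReal

/-- `ρ(Λ)^n = ρ_1^{n_1} ⋯ ρ_k^{n_k}`. -/
noncomputable def rhoPow (n : Fin k → ℕ) : ℝ := ∏ i, Λ.rho i ^ n i

/-- `x` is a positive vector of sum `1` with `A_i x = ρ_i x` for all `i`. -/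
structure IsPerronFrobenius (x : Λ.Vert → ℝ) : Prop where
  pos : ∀ v, 0 < x v
  sum_eq_one : ∑ v, x v = 1
  eigen : ∀ i, ((Λ.adj i).map (Nat.cast : ℕ → ℝ)).mulVec x = Λ.rho i • x

open Classical in
/-- The Perron-Frobenius eigenvector `x^Λ` (and `0` if there is none). -/
noncomputable def pf : Λ.Vert → ℝ :=
  if h : ∃ x, Λ.IsPerronFrobenius x then h.choose else 0

end Finite

/-- An infinite path: a degree-preserving functor from `Ω_k` to `Λ`, where `Ω_k` has the object set
`ℕ^k` and exactly one morphism `(m, n)`, of range `m`, source `n` and degree `n - m`, for each pair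
`m ≤ n`. -/
@[ext] structure InfPath where
  obj : (Fin k → ℕ) → Λ.Vert
  map : ∀ m n : Fin k → ℕ, m ≤ n → Λ.Mor
  r_map : ∀ m n h, Λ.r (map m n h) = obj m
  s_map : ∀ m n h, Λ.s (map m n h) = obj n
  d_map : ∀ m n h, Λ.d (map m n h) = n - m
  map_self : ∀ m, map m m le_rfl = Λ.one (obj m)
  map_comp : ∀ l m n (h : l ≤ m) (h' : m ≤ n),
    map l n (h.trans h') = Λ.comp (map l m h) (map m n h')

/-- The cylinder set `[l] = {x : x(0, d(l)) = l}`. -/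
def cylinder (l : Λ.Mor) : Set Λ.InfPath := {x | x.map 0 (Λ.d l) (fun _ => Nat.zero_le _) = l}

/-- The topology generated by the cylinder sets. -/
instance : TopologicalSpace Λ.InfPath :=
  TopologicalSpace.generateFrom (Set.range Λ.cylinder)

instance : MeasurableSpace Λ.InfPath := borel _

instance : BorelSpace Λ.InfPath := ⟨rfl⟩

/-- The defining property of the an Huef-Laca-Raeburn-Sims measure on `Λ^∞`:
`M([l]) = ρ(Λ)^{-d(l)} x^Λ_{s(l)}` for all `l`. -/
def IsAHLRSMeasure [Λ.IsFinite] (M : Measure Λ.InfPath) : Prop :=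
  ∀ l : Λ.Mor, M (Λ.cylinder l) = ENNReal.ofReal ((Λ.rhoPow (Λ.d l))⁻¹ * Λ.pf (Λ.s l))

section Bratteli

variable [NeZero k]

/-- The colour of the edges from level `n + 1` to level `n`: colours repeat cyclically. -/
def color (k : ℕ) [NeZero k] (n : ℕ) : Fin k := Fin.ofNat k n

/-- The degree of a path of length `n = q k + t`, `0 ≤ t < k`, whose edges have the colours
`1, …, k, 1, …, k, …`: it is `(q + 1, …, q + 1, q, …, q)` with `t` entries `q + 1`. -/
def rainbowDeg (k n : ℕ) : Fin k → ℕ := fun i => n / k + if (i : ℕ) < n % k then 1 else 0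


theorem rainbowDeg_succ (n : ℕ) :
    rainbowDeg k (n + 1) = rainbowDeg k n + Pi.single (color k n) 1 := by
  have hk : 0 < k := Nat.pos_of_ne_zero (NeZero.ne k)
  have hlt : n % k < k := Nat.mod_lt n hk
  funext i
  have hi : (i : ℕ) < k := i.2
  have hs : (Pi.single (color k n) 1 : Fin k → ℕ) i = if (i : ℕ) = n % k then 1 else 0 := by
    rw [Pi.single_apply]
    exact if_congr (Fin.ext_iff (a := i) (b := color k n)) rfl rfl
  rw [Pi.add_apply, hs]
  simp only [rainbowDeg]
  have hn : n + 1 = k * (n / k) + (n % k + 1) := by rw [← add_assoc, Nat.div_add_mod]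
  rcases Nat.lt_or_ge (n % k + 1) k with h | h
  · have h1 : (n + 1) / k = n / k := by
      rw [hn, Nat.mul_add_div hk, Nat.div_eq_of_lt h, add_zero]
    have h2 : (n + 1) % k = n % k + 1 := by
      rw [hn, Nat.mul_add_mod, Nat.mod_eq_of_lt h]
    rw [h1, h2]
    split_ifs <;> omega
  · have h' : n % k + 1 = k := le_antisymm hlt h
    have h1 : (n + 1) / k = n / k + 1 := by
      rw [hn, h', Nat.mul_add_div hk, Nat.div_self hk]
    have h2 : (n + 1) % k = 0 := by
      rw [hn, h', Nat.mul_add_mod, Nat.mod_self]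
    rw [h1, h2]
    split_ifs <;> omega

/-- The stationary `k`-Bratteli diagram of `Λ`: every level is a copy of the vertex set of `Λ`, and
the edges from level `n + 1` to level `n` are the morphisms of degree `e_i` where `i` is the colour
of level `n`; there are `A_i(p, q)` such edges of range `p` and source `q`. -/
def bratteli [Λ.IsFinite] : BratteliDiagram.{u} where
  V _ := Λ.Vert
  E n := {l : Λ.Mor // Λ.d l = Pi.single (color k n) 1}
  finite_V _ := inferInstance
  finite_E n := (IsFinite.finite_deg (Λ := Λ) (Pi.single (color k n) 1)).to_subtype
  r e := Λ.r e.1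
  s e := Λ.s e.1

/-- The identification of `Λ^∞` with the infinite path space of the Bratteli diagram: an infinite
path is cut into edges of the colours `1, …, k, 1, …, k, …`. -/
def toBratteli [Λ.IsFinite] (x : Λ.InfPath) : Λ.bratteli.PathSpace where
  edge n := ⟨x.map (rainbowDeg k n) (rainbowDeg k (n + 1))
    (by rw [rainbowDeg_succ]; exact le_self_add), by
      rw [x.d_map, rainbowDeg_succ, add_tsub_cancel_left]⟩
  compat n := (x.s_map _ _ _).trans (x.r_map _ _ _).symm

/-- The weight `w_δ(η) = (ρ_1^{q+1} ⋯ ρ_t^{q+1} ρ_{t+1}^q ⋯ ρ_k^q)^{-1/δ} x^Λ_{s(η)}` of a path of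
length `q k + t`. -/
noncomputable def weight [Λ.IsFinite] (δ : ℝ) (η : Λ.bratteli.FinPath) : ℝ :=
  Λ.rhoPow (rainbowDeg k η.1) ^ (-(1 / δ)) * Λ.pf η.2.1

/-- The Borel measure `μ` is the Dixmier trace measure of the spectral triple of the choice
function `τ`: it is finite and `μ([γ]) = 𝒯(π_τ(χ_{[γ]}) |D|^{-δ})` for every finite path `γ`. -/
structure IsDixmierMeasure [Λ.IsFinite] (δ : ℝ)
    (τ : BratteliDiagram.ChoiceFunction (Λ.weight δ)) (μ : Measure Λ.bratteli.PathSpace) :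
    Prop where
  finite : IsFiniteMeasure μ
  cylinder : ∀ γ : Λ.bratteli.FinPath, HasDixmierTrace
    (τ.rep (BratteliDiagram.chi γ.cylinder) * BratteliDiagram.absDiracPow (Λ.weight δ) δ)
    (μ γ.cylinder)

end Bratteli

end KGraph

/-! ### Perron-Frobenius theory -/

namespace Matrix

variable {n : Type*} [Fintype n]

/-! The diameter of `[γ]` is the weight of `γ` (`cylDiam_eq`): the weight decreases along extensions
because `δ < 1`, and since every vertex receives two edges, some two paths in `[γ]` part right after
`γ`. Both `π_τ(χ_O)` and `|D|^{-δ}` are diagonal in the standard basis, so the trace of the `s`-th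
power is a sum of `w(γ)^{δs}`, one term for each of the points `τ_±(γ)` that lies in `O`
(`posTrace_rep_mul_absDiracPow`). A clopen `O` depends on the first `N` edges only. Hence, apart
from the finitely many paths shorter than `N`, which `(s - 1)` kills in the limit, each `γ` counts
twice or not at all, and the choice function drops out.

Since `w^{δs} = ρ^{-s} x^{δs}`, the sum over the extensions of `g` by `q` edges is a combination of
entries of normalized path-counting matrices with Abel weights `ρ^{-ε}`, where `ε = s - 1`
(`sum_weight_rpow`). The Dixmier trace is therefore an Abel mean of nonnegative matrices `M_q` that
fix `x` and satisfy `M_{q+k} = M_q B`, where `B` is `A` divided by its Perron eigenvalue. As `B` may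
be periodic, its powers need not converge. But the fixed space of `B` is spanned by `x` and is
complementary to the range of `1 - B`, and the Abel means of coboundaries `u - Bu` tend to zero. The
limit is a rank one matrix `c_v x_u` with `c` depending on `B` alone (`Matrix.exists_tendsto_abel`).
Thus the trace of a cylinder is a positive constant times `ρ^{-d} x_s`, which is the value of `M`.

The measure `M` exists because the eigenvector equation makes these values consistent under
extension, so that a compactness argument applies (`exists_probabilityMeasure`). It lives on both
path spaces because the degrees of the diagram's finite paths are cofinal in `ℕ^k`
(`exists_infPath`). Cylinders form a π-system, which gives all uniqueness statements about measures.
-/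

theorem mulVec_pos_of_pos {P : Matrix n n ℝ} (hP : ∀ i j, 0 < P i j) {x : n → ℝ}
    (hx : ∀ i, 0 ≤ x i) (hx0 : x ≠ 0) (i : n) : 0 < P.mulVec x i := by
  obtain ⟨j, hj⟩ := Function.ne_iff.1 hx0
  exact Finset.sum_pos' (fun j _ => mul_nonneg (hP i j).le (hx j))
    ⟨j, Finset.mem_univ j, mul_pos (hP i j) (lt_of_le_of_ne (hx j) (Ne.symm hj))⟩

variable [DecidableEq n]

/-- A periodic matrix has no entrywise positive power, but a sum of powers is positive. This sum
commutes with `A`, so it makes inequalities strict without disturbing eigenvector equations. -/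
theorem IsIrreducible.exists_sum_pow_pos {A : Matrix n n ℝ} (hA : A.IsIrreducible) :
    ∃ N : ℕ, ∀ i j, 0 < (∑ m ∈ Finset.range N, A ^ m) i j := by
  have h := (isIrreducible_iff_exists_pow_pos hA.nonneg).1 hA
  choose f _ hf using h
  refine ⟨(Finset.univ.sup fun p : n × n => f p.1 p.2) + 1, fun i j => ?_⟩
  rw [Matrix.sum_apply]
  refine Finset.sum_pos' (fun m _ => pow_apply_nonneg hA.nonneg m i j) ⟨f i j, ?_, hf i j⟩
  exact Finset.mem_range_succ_iff.2
    (Finset.le_sup (f := fun p : n × n => f p.1 p.2) (Finset.mem_univ (i, j)))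

theorem pow_mulVec_of_eigen {A : Matrix n n ℝ} {x : n → ℝ} {r : ℝ} (h : A.mulVec x = r • x)
    (m : ℕ) : (A ^ m).mulVec x = r ^ m • x := by
  induction m with
  | zero => simp
  | succ m ih => rw [pow_succ, ← mulVec_mulVec, h, mulVec_smul, ih, smul_smul, pow_succ']

theorem sum_pow_mulVec_of_eigen {A : Matrix n n ℝ} {x : n → ℝ} {r : ℝ} (h : A.mulVec x = r • x)
    (N : ℕ) : (∑ m ∈ Finset.range N, A ^ m).mulVec x = (∑ m ∈ Finset.range N, r ^ m) • x := by
  rw [sum_mulVec, Finset.sum_smul]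
  exact Finset.sum_congr rfl fun m _ => pow_mulVec_of_eigen h m

/-- An irreducible matrix has a positive eigenvector. -/
theorem IsIrreducible.exists_pos_eigenvector [Nonempty n] {A : Matrix n n ℝ}
    (hA : A.IsIrreducible) :
    ∃ (r : ℝ) (x : n → ℝ), (∀ i, 0 < x i) ∧ ∑ i, x i = 1 ∧ A.mulVec x = r • x := by
  obtain ⟨N, hN⟩ := hA.exists_sum_pow_pos
  set P := ∑ m ∈ Finset.range N, A ^ m with hP
  have hcomm : Commute A P := Commute.sum_right _ _ _ fun m _ => (Commute.refl A).pow_right m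
  -- Summing the coordinates of `t x ≤ A x` over a point of the simplex bounds `t` by the sum of all
  -- entries.
  set T : ℝ := ∑ i, ∑ j, A i j
  have hT : ∀ t (x : n → ℝ), x ∈ stdSimplex ℝ n → (∀ i, t * x i ≤ A.mulVec x i) → t ≤ T := by
    intro t x hx h
    calc t = ∑ i, t * x i := by rw [← Finset.mul_sum, hx.2, mul_one]
      _ ≤ ∑ i, A.mulVec x i := Finset.sum_le_sum fun i _ => h i
      _ ≤ T := by
        refine Finset.sum_le_sum fun i _ => Finset.sum_le_sum fun j _ => ?_
        have hj : x j ≤ 1 := by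
          rw [← hx.2]; exact Finset.single_le_sum (fun i _ => hx.1 i) (Finset.mem_univ j)
        exact mul_le_of_le_one_right (hA.nonneg i j) hj
  -- Collatz–Wielandt: the eigenvalue is the largest `t` with `t x ≤ A x` for some `x` in the
  -- simplex. Maximizing over pairs avoids the ratios `(A x)_i / x_i`, which are not defined where
  -- `x_i = 0`.
  set K : Set (ℝ × (n → ℝ)) :=
    (Set.Icc 0 T ×ˢ stdSimplex ℝ n) ∩ {p | ∀ i, p.1 * p.2 i ≤ A.mulVec p.2 i}
  have hK : IsCompact K := by
    refine (isCompact_Icc.prod (isCompact_stdSimplex ℝ n)).inter_right ?_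
    simp only [Set.ofPred_forall, mulVec, dotProduct]
    exact isClosed_iInter fun i => isClosed_le (by fun_prop) (by fun_prop)
  have hmemK : ∀ t (x : n → ℝ), 0 ≤ t → x ∈ stdSimplex ℝ n →
      (∀ i, t * x i ≤ A.mulVec x i) → (t, x) ∈ K := fun t x ht hx h => ⟨⟨⟨ht, hT t x hx h⟩, hx⟩, h⟩
  have hne : K.Nonempty := by
    obtain ⟨x, hx⟩ : (stdSimplex ℝ n).Nonempty :=
      ⟨_, single_mem_stdSimplex ℝ (Classical.arbitrary n)⟩
    refine ⟨(0, x), hmemK 0 x le_rfl hx fun i => ?_⟩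
    rw [zero_mul]
    exact Finset.sum_nonneg fun j _ => mul_nonneg (hA.nonneg i j) (hx.1 j)
  obtain ⟨⟨r, x⟩, hrx, hmax⟩ := hK.exists_isMaxOn hne continuous_fst.continuousOn
  have hr0 : 0 ≤ r := hrx.1.1.1
  have hx : x ∈ stdSimplex ℝ n := hrx.1.2
  have hle : ∀ i, r * x i ≤ A.mulVec x i := hrx.2
  have hx0 : x ≠ 0 := by
    rintro rfl
    simpa using hx.2
  have heig : A.mulVec x = r • x := by
    -- Otherwise applying `P` makes `A x - r x` positive in every coordinate, and then `r` can be
    -- raised by `e`.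
    by_contra hcon
    have hy : ∀ i, 0 < P.mulVec x i := mulVec_pos_of_pos hN hx.1 hx0
    have hd : ∀ i, 0 < P.mulVec (A.mulVec x - r • x) i :=
      mulVec_pos_of_pos hN (fun i => by simpa using hle i) (sub_ne_zero.2 hcon)
    set y := P.mulVec x with hydef
    have hd' : ∀ i, r * y i < A.mulVec y i := by
      intro i
      have := hd i
      rw [mulVec_sub, mulVec_smul, mulVec_mulVec, ← hcomm.eq, ← mulVec_mulVec] at this
      exact sub_pos.1 this
    obtain ⟨i₀, -, hi₀⟩ := Finset.exists_min_image Finset.univ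
      (fun i => (A.mulVec y i - r * y i) / y i) Finset.univ_nonempty
    set e := (A.mulVec y i₀ - r * y i₀) / y i₀
    have he : 0 < e := div_pos (sub_pos.2 (hd' i₀)) (hy i₀)
    have hy1 : ∀ i, (r + e) * y i ≤ A.mulVec y i := by
      intro i
      have := (le_div_iff₀ (hy i)).1 (hi₀ i (Finset.mem_univ i))
      linarith
    set S := ∑ i, y i
    have hS : 0 < S := Finset.sum_pos (fun i _ => hy i) Finset.univ_nonempty
    have hz : (r + e, S⁻¹ • y) ∈ K := by
      refine hmemK _ _ (by linarith) ⟨fun i => ?_, ?_⟩ fun i => ?_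
      · exact mul_nonneg (inv_nonneg.2 hS.le) (hy i).le
      · simp only [Pi.smul_apply, smul_eq_mul, ← Finset.mul_sum]
        exact inv_mul_cancel₀ hS.ne'
      · rw [mulVec_smul, Pi.smul_apply, Pi.smul_apply, smul_eq_mul, smul_eq_mul, mul_left_comm]
        exact mul_le_mul_of_nonneg_left (hy1 i) (inv_nonneg.2 hS.le)
    have := hmax hz
    simp only [Set.mem_ofPred_eq] at this
    linarith
  refine ⟨r, x, fun i => ?_, hx.2, heig⟩
  -- `P x` is positive and is a multiple of `x`, so no coordinate of `x` vanishes.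
  have h1 := mulVec_pos_of_pos hN hx.1 hx0 i
  rw [hP, sum_pow_mulVec_of_eigen heig, Pi.smul_apply, smul_eq_mul] at h1
  exact lt_of_le_of_ne (hx.1 i) fun h => by simp [← h] at h1

/-- The eigenspace of a positive eigenvector of an irreducible matrix is one-dimensional. -/
theorem IsIrreducible.eq_smul_of_eigen [Nonempty n] {A : Matrix n n ℝ} (hA : A.IsIrreducible)
    {r : ℝ} {x y : n → ℝ} (hx : ∀ i, 0 < x i) (hAx : A.mulVec x = r • x)
    (hAy : A.mulVec y = r • y) : ∃ c : ℝ, y = c • x := by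
  obtain ⟨N, hN⟩ := hA.exists_sum_pow_pos
  -- The smallest ratio gives the largest multiple of `x` below `y`. The difference `z` is
  -- nonnegative with a zero at `i₀`, while `P z`, a multiple of `z`, would be positive there if `z
  -- ≠ 0`.
  obtain ⟨i₀, -, hi₀⟩ := Finset.exists_min_image Finset.univ (fun i => y i / x i)
    Finset.univ_nonempty
  refine ⟨y i₀ / x i₀, sub_eq_zero.1 ?_⟩
  by_contra hz
  set z := y - (y i₀ / x i₀) • x with hzdef
  have hz0 : ∀ i, 0 ≤ z i := by
    intro i
    have := (le_div_iff₀ (hx i)).1 (hi₀ i (Finset.mem_univ i))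
    simpa [hzdef] using this
  have hzi : z i₀ = 0 := by
    simp [hzdef, div_mul_cancel₀ _ (hx i₀).ne']
  have hAz : A.mulVec z = r • z := by
    rw [hzdef, mulVec_sub, mulVec_smul, hAx, hAy, smul_sub, smul_comm]
  have := mulVec_pos_of_pos hN hz0 hz i₀
  rw [sum_pow_mulVec_of_eigen hAz, Pi.smul_apply, hzi, smul_zero] at this
  exact lt_irrefl _ this

/-- The eigenvalue of a positive eigenvector of a nonnegative matrix is the spectral radius. -/
theorem spectralRadius_eq_of_pos_eigenvector [Nonempty n] {A : Matrix n n ℕ} {r : ℝ} {x : n → ℝ}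
    (hx : ∀ i, 0 < x i) (hAx : (A.map (Nat.cast : ℕ → ℝ)).mulVec x = r • x) :
    (spectralRadius ℂ (A.map (Nat.cast : ℕ → ℂ))).toReal = r := by
  have hrow : ∀ i, ∑ j, (A i j : ℝ) * x j = r * x i := fun i => by
    have := congrFun hAx i
    simpa [mulVec, dotProduct] using this
  have hr : 0 ≤ r := by
    have i := Classical.arbitrary n
    have h : 0 ≤ r * x i := by
      rw [← hrow i]
      exact Finset.sum_nonneg fun j _ => mul_nonneg (Nat.cast_nonneg _) (hx j).le
    exact nonneg_of_mul_nonneg_left h (hx i)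
  have hspec : ∀ μ : ℂ, μ ∈ spectrum ℂ (A.map (Nat.cast : ℕ → ℂ)) ↔
      ∃ v : n → ℂ, v ≠ 0 ∧ (A.map (Nat.cast : ℕ → ℂ)).mulVec v = μ • v := by
    intro μ
    rw [← Matrix.spectrum_toLin', ← Module.End.hasEigenvalue_iff_mem_spectrum]
    constructor
    · intro h
      obtain ⟨v, hv⟩ := h.exists_hasEigenvector
      exact ⟨v, hv.2, by simpa using hv.apply_eq_smul⟩
    · rintro ⟨v, hv, h⟩
      exact Module.End.hasEigenvalue_of_hasEigenvector (x := v)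
        ⟨Module.End.mem_eigenspace_iff.2 (by simpa using h), hv⟩
  have hval : spectralRadius ℂ (A.map (Nat.cast : ℕ → ℂ)) = (r.toNNReal : ℝ≥0∞) := by
    apply le_antisymm
    · refine iSup₂_le fun μ hμ => ?_
      obtain ⟨v, hv, h⟩ := (hspec μ).1 hμ
      -- `c` is the least constant with `|v| ≤ c x`. Equality at `i₀` turns the eigenvalue equation
      -- in that row into `|μ| ≤ r`.
      obtain ⟨i₀, -, hi₀⟩ := Finset.exists_max_image Finset.univ (fun i => ‖v i‖ / x i)
        Finset.univ_nonempty
      set c := ‖v i₀‖ / x i₀ with hc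
      have hvc : ∀ i, ‖v i‖ ≤ c * x i := fun i =>
        (div_le_iff₀ (hx i)).1 (hi₀ i (Finset.mem_univ i))
      have hvi : ‖v i₀‖ = c * x i₀ := by rw [hc, div_mul_cancel₀ _ (hx i₀).ne']
      have hcpos : 0 < c := by
        obtain ⟨j, hj⟩ := Function.ne_iff.1 hv
        have h1 : 0 < ‖v j‖ := norm_pos_iff.2 hj
        by_contra hc0
        have := hvc j
        nlinarith [hx j]
      have h1 : ‖μ‖ * (c * x i₀) ≤ r * (c * x i₀) := by
        calc ‖μ‖ * (c * x i₀) = ‖(μ • v) i₀‖ := by rw [← hvi, Pi.smul_apply, norm_smul]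
          _ = ‖∑ j, (A i₀ j : ℂ) * v j‖ := by
            rw [← h]; simp [mulVec, dotProduct]
          _ ≤ ∑ j, (A i₀ j : ℝ) * (c * x j) := by
            refine (norm_sum_le _ _).trans (Finset.sum_le_sum fun j _ => ?_)
            rw [norm_mul, Complex.norm_natCast]
            exact mul_le_mul_of_nonneg_left (hvc j) (Nat.cast_nonneg _)
          _ = c * ∑ j, (A i₀ j : ℝ) * x j := by
            rw [Finset.mul_sum]; exact Finset.sum_congr rfl fun j _ => by ring
          _ = r * (c * x i₀) := by rw [hrow]; ring
      have h2 : ‖μ‖ ≤ r := le_of_mul_le_mul_right h1 (mul_pos hcpos (hx i₀))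
      rw [ENNReal.coe_le_coe, ← NNReal.coe_le_coe, Real.coe_toNNReal _ hr]
      exact h2
    · have hmem : (r : ℂ) ∈ spectrum ℂ (A.map (Nat.cast : ℕ → ℂ)) := by
        refine (hspec r).2 ⟨fun i => (x i : ℂ), ?_, ?_⟩
        · intro h
          have := congrFun h (Classical.arbitrary n)
          simp [(hx _).ne'] at this
        · ext i
          simp only [mulVec, dotProduct, map_apply, Pi.smul_apply, smul_eq_mul]
          exact_mod_cast hrow i
      refine le_trans (le_of_eq ?_) (le_iSup₂ (f := fun (k : ℂ)
        (_ : k ∈ spectrum ℂ (A.map (Nat.cast : ℕ → ℂ))) => (‖k‖₊ : ℝ≥0∞)) (r : ℂ) hmem)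
      rw [ENNReal.coe_inj, ← NNReal.coe_inj, Real.coe_toNNReal _ hr]
      simp [abs_of_nonneg hr]
  rw [hval, ENNReal.coe_toReal, Real.coe_toNNReal _ hr]

end Matrix

/-! ### Abel means -/

section Abel

variable {k : ℕ} {R : ℝ} {a : ℕ → ℝ}

theorem rpow_neg_add_period (hR : 1 < R) (ha : ∀ q, 0 < a q) (hper : ∀ q, a (q + k) = R * a q)
    (ε : ℝ) (q : ℕ) : a (q + k) ^ (-ε) = R ^ (-ε) * a q ^ (-ε) := by
  rw [hper, Real.mul_rpow (by linarith) (ha q).le]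

variable [NeZero k]

/-- Writing `q = p k + t` gives a geometric series of ratio `R^{-ε}` times the sum over one period.
-/
theorem hasSum_rpow_neg (hR : 1 < R) (ha : ∀ q, 0 < a q) (hper : ∀ q, a (q + k) = R * a q)
    {ε : ℝ} (hε : 0 < ε) :
    HasSum (fun q => a q ^ (-ε)) ((1 - R ^ (-ε))⁻¹ * ∑ t : Fin k, a t ^ (-ε)) := by
  have hR0 : 0 < R := by linarith
  have hr0 : 0 ≤ R ^ (-ε) := Real.rpow_nonneg hR0.le _
  have hr1 : R ^ (-ε) < 1 := Real.rpow_lt_one_of_one_lt_of_neg hR (by linarith)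
  have hgeo := hasSum_geometric_of_lt_one hr0 hr1
  have hfin : HasSum (fun t : Fin k => a t ^ (-ε)) (∑ t : Fin k, a t ^ (-ε)) := hasSum_fintype _
  have hprod := hgeo.mul hfin (hgeo.summable.mul_of_nonneg hfin.summable
    (fun p => pow_nonneg hr0 p) (fun t => Real.rpow_nonneg (ha t).le _))
  refine (Equiv.hasSum_iff (Nat.divModEquiv k).symm).1 (hprod.congr_fun ?_)
  rintro ⟨p, t⟩
  simp only [Function.comp, Nat.divModEquiv_symm_apply]
  induction p with
  | zero => simp
  | succ p ih =>
    rw [show (p + 1) * k + (t : ℕ) = p * k + t + k by ring, rpow_neg_add_period hR ha hper, ih,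
      pow_succ']
    ring

/-- As `ε → 0`, `1 - R^{-ε}` behaves like `ε log R`, and each of the `k` terms of a period tends to
`1`. -/
theorem tendsto_mul_tsum_rpow_neg (hR : 1 < R) (ha : ∀ q, 0 < a q)
    (hper : ∀ q, a (q + k) = R * a q) :
    Tendsto (fun ε : ℝ => ε * ∑' q, a q ^ (-ε)) (𝓝[>] 0) (𝓝 (k / Real.log R)) := by
  have hR0 : 0 < R := by linarith
  have hlog : 0 < Real.log R := Real.log_pos hR
  have h1 : Tendsto (fun ε : ℝ => ε⁻¹ * (1 - R ^ (-ε))) (𝓝[>] 0) (𝓝 (Real.log R)) := by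
    have hd : HasDerivAt (fun ε : ℝ => -R ^ (-ε)) (Real.log R) 0 := by
      have := ((hasDerivAt_neg (0 : ℝ)).const_rpow hR0).fun_neg
      simpa using this
    have := (hasDerivAt_iff_tendsto_slope_zero.1 hd).mono_left
      (nhdsWithin_mono 0 (fun y (hy : 0 < y) => hy.ne'))
    refine this.congr fun ε => ?_
    rw [zero_add, neg_zero, Real.rpow_zero, smul_eq_mul]
    ring
  have h2 : Tendsto (fun ε : ℝ => ∑ t : Fin k, a t ^ (-ε)) (𝓝[>] 0) (𝓝 k) := by
    have : Continuous fun ε : ℝ => ∑ t : Fin k, a t ^ (-ε) :=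
      continuous_finsetSum _ fun t _ => continuous_const.rpow continuous_neg
        fun ε => Or.inl (ha t).ne'
    have h := this.tendsto 0
    simp only [neg_zero, Real.rpow_zero, Finset.sum_const, Finset.card_univ, Fintype.card_fin,
      nsmul_eq_mul, mul_one] at h
    exact h.mono_left nhdsWithin_le_nhds
  have h3 := (h1.inv₀ hlog.ne').mul h2
  rw [div_eq_inv_mul]
  refine h3.congr' ?_
  filter_upwards [self_mem_nhdsWithin] with ε hε
  rw [(hasSum_rpow_neg hR ha hper hε).tsum_eq, mul_inv, inv_inv, mul_assoc]

/-- A shift by `k` changes the weights only by the factor `R^ε`, so the sum telescopes up to `R^ε -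
1` times an `O(1/ε)` series, plus `k` boundary terms that stay bounded. After multiplication by `ε`
both vanish in the limit. -/
theorem tendsto_abel_coboundary (hR : 1 < R) (ha : ∀ q, 0 < a q)
    (hper : ∀ q, a (q + k) = R * a q) {b : ℕ → ℝ} {K : ℝ} (hb : ∀ q, |b q| ≤ K) :
    Tendsto (fun ε : ℝ => ε * ∑' q, a q ^ (-ε) * (b q - b (q + k))) (𝓝[>] 0) (𝓝 0) := by
  have hR0 : 0 < R := by linarith
  have hcont : ∀ y : ℝ, 0 < y → Continuous fun ε : ℝ => y ^ ε := fun y hy =>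
    continuous_const.rpow continuous_id fun _ => Or.inl hy.ne'
  have hbound : Tendsto (fun ε : ℝ => (R ^ ε - 1) * (K * (ε * ∑' q, a q ^ (-ε))) +
      R ^ ε * (K * (ε * ∑ t ∈ Finset.range k, a t ^ (-ε)))) (𝓝[>] 0) (𝓝 0) := by
    have h1 : Tendsto (fun ε : ℝ => R ^ ε) (𝓝[>] 0) (𝓝 1) := by
      have := (hcont R hR0).tendsto 0
      rw [Real.rpow_zero] at this
      exact this.mono_left nhdsWithin_le_nhds
    have h2 : Tendsto (fun ε : ℝ => ε * ∑ t ∈ Finset.range k, a t ^ (-ε)) (𝓝[>] 0) (𝓝 0) := by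
      have : Continuous fun ε : ℝ => ε * ∑ t ∈ Finset.range k, a t ^ (-ε) :=
        continuous_id.mul (continuous_finsetSum _ fun t _ => (hcont _ (ha t)).comp continuous_neg)
      have := this.tendsto 0
      rw [zero_mul] at this
      exact this.mono_left nhdsWithin_le_nhds
    have := ((h1.sub_const 1).mul ((tendsto_mul_tsum_rpow_neg hR ha hper).const_mul K)).add
      (h1.mul (h2.const_mul K))
    simpa using this
  refine squeeze_zero_norm' ?_ hbound
  filter_upwards [self_mem_nhdsWithin] with ε (hε : 0 < ε)
  have hs := (hasSum_rpow_neg hR ha hper hε).summable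
  have hf0 : ∀ q, 0 ≤ a q ^ (-ε) := fun q => Real.rpow_nonneg (ha q).le _
  have hs1 : Summable fun q => a q ^ (-ε) * b q := by
    refine Summable.of_norm_bounded (hs.mul_left K) fun q => ?_
    rw [norm_mul, Real.norm_of_nonneg (hf0 q), mul_comm]
    exact mul_le_mul_of_nonneg_right (hb q) (hf0 q)
  have hshift : ∀ q, a q ^ (-ε) * b (q + k) = R ^ ε * (a (q + k) ^ (-ε) * b (q + k)) := by
    intro q
    rw [rpow_neg_add_period hR ha hper, ← mul_assoc, ← mul_assoc, ← Real.rpow_add hR0]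
    simp
  have hs2 : Summable fun q => a q ^ (-ε) * b (q + k) := by
    simp_rw [hshift]
    exact ((summable_nat_add_iff k).2 hs1).mul_left _
  have hsplit := hs1.sum_add_tsum_nat_add k
  have hS2 : ∑' q, a q ^ (-ε) * b (q + k) =
      R ^ ε * (∑' q, a q ^ (-ε) * b q - ∑ t ∈ Finset.range k, a t ^ (-ε) * b t) := by
    simp_rw [hshift]
    rw [tsum_mul_left, ← hsplit]
    ring
  have hkey : ∑' q, a q ^ (-ε) * (b q - b (q + k)) = -((R ^ ε - 1) * ∑' q, a q ^ (-ε) * b q) +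
      R ^ ε * ∑ t ∈ Finset.range k, a t ^ (-ε) * b t := by
    simp_rw [mul_sub]
    rw [hs1.tsum_sub hs2, hS2]
    ring
  have hB1 : |∑' q, a q ^ (-ε) * b q| ≤ K * ∑' q, a q ^ (-ε) := by
    rw [← tsum_mul_left, ← Real.norm_eq_abs]
    refine tsum_of_norm_bounded (hs.mul_left K).hasSum fun q => ?_
    rw [norm_mul, Real.norm_of_nonneg (hf0 q), mul_comm]
    exact mul_le_mul_of_nonneg_right (hb q) (hf0 q)
  have hB2 : |∑ t ∈ Finset.range k, a t ^ (-ε) * b t| ≤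
      K * ∑ t ∈ Finset.range k, a t ^ (-ε) := by
    rw [Finset.mul_sum]
    refine (Finset.abs_sum_le_sum_abs _ _).trans (Finset.sum_le_sum fun q _ => ?_)
    rw [abs_mul, abs_of_nonneg (hf0 q), mul_comm]
    exact mul_le_mul_of_nonneg_right (hb q) (hf0 q)
  have hRε : 0 ≤ R ^ ε - 1 := sub_nonneg.2 (Real.one_le_rpow hR.le hε.le)
  have hRε' : 0 ≤ R ^ ε := Real.rpow_nonneg hR0.le _
  rw [hkey, Real.norm_eq_abs, abs_mul, abs_of_pos hε]
  calc ε * |-((R ^ ε - 1) * ∑' q, a q ^ (-ε) * b q) +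
        R ^ ε * ∑ t ∈ Finset.range k, a t ^ (-ε) * b t|
      ≤ ε * ((R ^ ε - 1) * (K * ∑' q, a q ^ (-ε)) +
        R ^ ε * (K * ∑ t ∈ Finset.range k, a t ^ (-ε))) := by
        refine mul_le_mul_of_nonneg_left ((abs_add_le _ _).trans ?_) hε.le
        rw [abs_neg, abs_mul, abs_mul, abs_of_nonneg hRε, abs_of_nonneg hRε']
        exact add_le_add (mul_le_mul_of_nonneg_left hB1 hRε) (mul_le_mul_of_nonneg_left hB2 hRε')
    _ = _ := by ring

end Abel

/-! ### Abel means of nonnegative matrices with a positive fixed vector -/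

namespace Matrix

variable {n : Type*} [Fintype n]

/-- A nonnegative matrix that fixes `x` is a contraction for the weighted norm `max |u_i| / x_i`.
This bounds all products uniformly. -/
theorem abs_mulVec_le {M : Matrix n n ℝ} (hM : ∀ i j, 0 ≤ M i j) {x u : n → ℝ}
    (hMx : M.mulVec x = x) {K : ℝ} (hu : ∀ i, |u i| ≤ K * x i) (i : n) :
    |M.mulVec u i| ≤ K * x i := by
  calc |M.mulVec u i| ≤ ∑ j, M i j * (K * x j) := by
        refine (Finset.abs_sum_le_sum_abs _ _).trans (Finset.sum_le_sum fun j _ => ?_)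
        rw [abs_mul, abs_of_nonneg (hM i j)]
        exact mul_le_mul_of_nonneg_left (hu j) (hM i j)
    _ = K * M.mulVec x i := by
        simp only [mulVec, dotProduct, Finset.mul_sum]
        exact Finset.sum_congr rfl fun j _ => by ring
    _ = K * x i := by rw [hMx]

theorem exists_abs_le_mul {x : n → ℝ} (hx : ∀ i, 0 < x i) (u : n → ℝ) :
    ∃ K, ∀ i, |u i| ≤ K * x i := by
  refine ⟨∑ j, |u j| / x j, fun i => ?_⟩
  rw [← div_le_iff₀ (hx i)]
  exact Finset.single_le_sum (f := fun j => |u j| / x j)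
    (fun j _ => div_nonneg (abs_nonneg _) (hx j).le) (Finset.mem_univ i)

/-- Abel means of a sequence of nonnegative matrices that fix a positive vector `x` converge on
`c x + (u - B u)` to a multiple of `c x`. -/
theorem tendsto_abel_mulVec {k : ℕ} [NeZero k] {R : ℝ} (hR : 1 < R) {a : ℕ → ℝ}
    (ha : ∀ q, 0 < a q) (hper : ∀ q, a (q + k) = R * a q) {x : n → ℝ} (hx : ∀ i, 0 < x i)
    {B : Matrix n n ℝ} {M : ℕ → Matrix n n ℝ} (hM : ∀ q i j, 0 ≤ M q i j)
    (hMx : ∀ q, (M q).mulVec x = x) (hMB : ∀ q, M (q + k) = M q * B) (c : ℝ) (u : n → ℝ) (i : n) :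
    Tendsto (fun ε : ℝ => ε * ∑' q, a q ^ (-ε) * (M q).mulVec (c • x + (u - B.mulVec u)) i)
      (𝓝[>] 0) (𝓝 (c * (k / Real.log R) * x i)) := by
  obtain ⟨K, hK⟩ := exists_abs_le_mul hx u
  have hb : ∀ q, |(M q).mulVec u i| ≤ K * x i := fun q => abs_mulVec_le (hM q) (hMx q) hK i
  have h1 := ((tendsto_mul_tsum_rpow_neg hR ha hper).const_mul (c * x i)).add
    (tendsto_abel_coboundary hR ha hper hb)
  rw [add_zero, mul_right_comm] at h1
  refine h1.congr' ?_
  filter_upwards [self_mem_nhdsWithin] with ε (hε : 0 < ε)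
  have hs := (hasSum_rpow_neg hR ha hper hε).summable
  have hf0 : ∀ q, 0 ≤ a q ^ (-ε) := fun q => Real.rpow_nonneg (ha q).le _
  have hs1 : Summable fun q => a q ^ (-ε) * ((M q).mulVec u i - (M (q + k)).mulVec u i) := by
    refine Summable.of_norm_bounded (hs.mul_left (K * x i + K * x i)) fun q => ?_
    rw [norm_mul, Real.norm_of_nonneg (hf0 q), mul_comm]
    exact mul_le_mul_of_nonneg_right
      ((abs_sub _ _).trans (add_le_add (hb q) (hb (q + k)))) (hf0 q)
  -- By `M q * B = M (q + k)`, the part `u - B u` becomes the coboundary of the bounded sequence `(M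
  -- q u)_i`.
  have hterm : ∀ q, a q ^ (-ε) * (M q).mulVec (c • x + (u - B.mulVec u)) i =
      (c * x i) * a q ^ (-ε) + a q ^ (-ε) * ((M q).mulVec u i - (M (q + k)).mulVec u i) := by
    intro q
    rw [mulVec_add, mulVec_sub, mulVec_smul, hMx, mulVec_mulVec, ← hMB]
    simp only [Pi.add_apply, Pi.sub_apply, Pi.smul_apply, smul_eq_mul]
    ring
  simp_rw [hterm]
  rw [(hs.mul_left _).tsum_add hs1, tsum_mul_left]
  ring

variable [DecidableEq n]

theorem pow_mulVec_fixed {B : Matrix n n ℝ} {x : n → ℝ} (h : B.mulVec x = x) (m : ℕ) :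
    (B ^ m).mulVec x = x := by
  simpa using pow_mulVec_of_eigen (r := 1) (by simpa using h) m

/-- If the fixed space of a nonnegative matrix `B` is spanned by a positive vector `x`, then it is
complementary to the range of `1 - B`. -/
theorem exists_eq_smul_add_sub_mulVec [Nonempty n] {B : Matrix n n ℝ} (hB : ∀ i j, 0 ≤ B i j)
    {x : n → ℝ} (hx : ∀ i, 0 < x i) (hBx : B.mulVec x = x)
    (hker : ∀ y, B.mulVec y = y → ∃ c : ℝ, y = c • x) (z : n → ℝ) :
    ∃ (c : ℝ) (u : n → ℝ), z = c • x + (u - B.mulVec u) := by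
  let φ : ℝ × (n → ℝ) →ₗ[ℝ] (n → ℝ) :=
    LinearMap.coprod (LinearMap.toSpanSingleton ℝ _ x) (LinearMap.id - B.mulVecLin)
  have hφ : ∀ c u, φ (c, u) = c • x + (u - B.mulVec u) := fun c u => by simp [φ]
  have hkerφ : LinearMap.ker φ ≤ Submodule.span ℝ {((0 : ℝ), x)} := by
    rintro ⟨c, u⟩ h
    have h0 : c • x + (u - B.mulVec u) = 0 := by rw [← hφ]; exact h
    have hBu : B.mulVec u = u + c • x := by
      rw [← sub_eq_zero, ← neg_eq_zero, ← h0]; abel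
    -- `B u = u + c x` makes `B^m u` grow linearly unless `c = 0`, whereas the powers of `B` are
    -- bounded in the weighted norm.
    have hpow : ∀ m : ℕ, (B ^ m).mulVec u = u + (m * c) • x := by
      intro m
      induction m with
      | zero => simp
      | succ m ih =>
        rw [pow_succ', ← mulVec_mulVec, ih, mulVec_add, mulVec_smul, hBx, hBu, add_assoc,
          ← add_smul]
        congr 2
        push_cast
        ring
    obtain ⟨K, hK⟩ := exists_abs_le_mul hx u
    have hi := Classical.arbitrary n
    have hbd : ∀ m : ℕ, m * |c| ≤ 2 * K := by
      intro m
      have h1 := abs_mulVec_le (pow_apply_nonneg hB m) (pow_mulVec_fixed hBx m) hK hi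
      have h2 : (m * c) * x hi = (B ^ m).mulVec u hi - u hi := by rw [hpow]; simp
      have h3 : m * |c| * x hi ≤ 2 * K * x hi := by
        calc m * |c| * x hi = |(m * c) * x hi| := by
              rw [abs_mul, abs_mul, Nat.abs_cast, abs_of_pos (hx hi)]
          _ ≤ K * x hi + K * x hi := by
              rw [h2]; exact (abs_sub _ _).trans (add_le_add h1 (hK hi))
          _ = _ := by ring
      exact le_of_mul_le_mul_right h3 (hx hi)
    have hc : c = 0 := by
      by_contra hc
      obtain ⟨m, hm⟩ := exists_nat_gt (2 * K / |c|)
      rw [div_lt_iff₀ (abs_pos.2 hc)] at hm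
      exact absurd (hbd m) (not_le.2 hm)
    subst hc
    obtain ⟨d, hd⟩ := hker u (by simpa using hBu)
    exact Submodule.mem_span_singleton.2 ⟨d, by rw [hd]; ext <;> simp⟩
  -- The domain has one dimension more than the target and the kernel is at most a line, so
  -- rank-nullity gives surjectivity.
  have hsurj : Function.Surjective φ := by
    rw [← LinearMap.range_eq_top]
    apply Submodule.eq_top_of_finrank_eq
    have h1 := LinearMap.finrank_range_add_finrank_ker φ
    have h2 : Module.finrank ℝ (LinearMap.ker φ) ≤ 1 :=
      (Submodule.finrank_mono hkerφ).trans ((finrank_span_le_card ({((0 : ℝ), x)} : Set _)).trans (by simp))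
    have h3 : Module.finrank ℝ (ℝ × (n → ℝ)) = 1 + Module.finrank ℝ (n → ℝ) := by
      rw [Module.finrank_prod, Module.finrank_self]
    have h4 := Submodule.finrank_le (LinearMap.range φ)
    omega
  obtain ⟨⟨c, u⟩, h⟩ := hsurj z
  exact ⟨c, u, by rw [← h, hφ]⟩

/-- The Abel means of matrices that are periodic modulo `B` converge to a rank one matrix which
depends only on `B`. -/
theorem exists_tendsto_abel [Nonempty n] (k : ℕ) [NeZero k] {R : ℝ} (hR : 1 < R)
    {B : Matrix n n ℝ} (hB : ∀ i j, 0 ≤ B i j)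
    {x : n → ℝ} (hx : ∀ i, 0 < x i) (hBx : B.mulVec x = x)
    (hker : ∀ y, B.mulVec y = y → ∃ c : ℝ, y = c • x) :
    ∃ c : n → ℝ, (∀ v, 0 ≤ c v) ∧ (∃ v, 0 < c v) ∧
      ∀ (a : ℕ → ℝ) (M : ℕ → Matrix n n ℝ), (∀ q, 0 < a q) → (∀ q, a (q + k) = R * a q) →
        (∀ q i j, 0 ≤ M q i j) → (∀ q, (M q).mulVec x = x) → (∀ q, M (q + k) = M q * B) →
        ∀ i v, Tendsto (fun ε : ℝ => ε * ∑' q, a q ^ (-ε) * M q i v) (𝓝[>] 0)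
          (𝓝 (c v * x i)) := by
  have hk : (0 : ℝ) < k / Real.log R :=
    div_pos (Nat.cast_pos.2 (Nat.pos_of_ne_zero (NeZero.ne k))) (Real.log_pos hR)
  -- The decomposition of the basis vectors involves only `B` and `x`; this is why the limit does
  -- not depend on `a` or `M`.
  choose c u hcu using fun v : n => exists_eq_smul_add_sub_mulVec hB hx hBx hker (Pi.single v 1)
  have key : ∀ (a : ℕ → ℝ) (M : ℕ → Matrix n n ℝ), (∀ q, 0 < a q) → (∀ q, a (q + k) = R * a q) →
      (∀ q i j, 0 ≤ M q i j) → (∀ q, (M q).mulVec x = x) → (∀ q, M (q + k) = M q * B) →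
      ∀ i v, Tendsto (fun ε : ℝ => ε * ∑' q, a q ^ (-ε) * M q i v) (𝓝[>] 0)
        (𝓝 (c v * (k / Real.log R) * x i)) := by
    intro a M ha hper hM hMx hMB i v
    have := tendsto_abel_mulVec hR ha hper hx hM hMx hMB (c v) (u v) i
    simpa [← hcu v] using this
  have hdiv : ∀ q, (q + k) / k = q / k + 1 := fun q =>
    Nat.add_div_right q (Nat.pos_of_ne_zero (NeZero.ne k))
  have hR0 : 0 < R := by linarith
  have ha : ∀ q : ℕ, 0 < R ^ (q / k) := fun q => pow_pos hR0 _
  have hper : ∀ q : ℕ, R ^ ((q + k) / k) = R * R ^ (q / k) := fun q => by rw [hdiv, pow_succ']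
  -- `R^(q/k)` and `B^(q/k)`, with integer division, form one admissible family, on which the sign
  -- of `c` and its nonvanishing are tested.
  have hB' : ∀ (q : ℕ) i j, 0 ≤ (B ^ (q / k)) i j := fun q => pow_apply_nonneg hB _
  have hlim := key (fun q => R ^ (q / k)) (fun q => B ^ (q / k)) ha hper hB'
    (fun q => pow_mulVec_fixed hBx _) (fun q => by rw [hdiv, pow_succ])
  have hc0 : ∀ v, 0 ≤ c v := by
    intro v
    have i := Classical.arbitrary n
    -- `max ε 0` agrees with `ε` on the filter and makes the expression nonnegative for every real
    -- `ε`.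
    have h := ge_of_tendsto' (b := 0) (f := fun ε : ℝ =>
      max ε 0 * ∑' q : ℕ, (R ^ (q / k)) ^ (-ε) * (B ^ (q / k)) i v)
      ((hlim i v).congr' ?_) fun ε => ?_
    · rw [mul_assoc] at h
      exact nonneg_of_mul_nonneg_left h (mul_pos hk (hx i))
    · filter_upwards [self_mem_nhdsWithin] with ε (hε : 0 < ε)
      rw [max_eq_left hε.le]
    · exact mul_nonneg (le_max_right _ _) (tsum_nonneg fun q =>
        mul_nonneg (Real.rpow_nonneg (ha q).le _) (hB' q i v))
  refine ⟨fun v => c v * (k / Real.log R), fun v => mul_nonneg (hc0 v) hk.le, ?_, key⟩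
  by_contra hcon
  push Not at hcon
  have hc : ∀ v, c v = 0 := fun v =>
    le_antisymm (nonpos_of_mul_nonpos_left (hcon v) hk) (hc0 v)
  -- If all `c v` vanished, `x` would be a coboundary and its Abel mean would tend to `0`. As a
  -- fixed vector it has the limit `(k / log R) x`.
  have hx' : x = (0 : ℝ) • x + ((∑ v, x v • u v) - B.mulVec (∑ v, x v • u v)) := by
    have h1 : x = ∑ v, x v • Pi.single v (1 : ℝ) := by
      ext i; simp [Finset.sum_apply, Pi.single_apply]
    conv_lhs => rw [h1]
    simp_rw [hcu, hc]
    simp [mulVec_sum, mulVec_smul, smul_sub, Finset.sum_sub_distrib]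
  have i := Classical.arbitrary n
  have h1 := tendsto_abel_mulVec hR ha hper hx hB' (fun q => pow_mulVec_fixed hBx _)
    (fun q => by rw [hdiv, pow_succ]) 0 (∑ v, x v • u v) i
  have h2 := tendsto_abel_mulVec hR ha hper hx hB' (fun q => pow_mulVec_fixed hBx _)
    (fun q => by rw [hdiv, pow_succ]) 1 0 i
  rw [← hx'] at h1
  have h3 : (1 : ℝ) • x + (0 - B.mulVec 0) = x := by simp
  rw [h3] at h2
  have := tendsto_nhds_unique h1 h2
  rw [zero_mul, zero_mul, one_mul] at this
  exact (mul_pos hk (hx i)).ne this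

end Matrix

/-! ### Diagonal operators on `ℓ²(ι, ℂ²)` and their traces -/

section Eigenvectors

variable {H : Type*} [NormedAddCommGroup H] [InnerProductSpace ℂ H] [CompleteSpace H]

/-- The continuous functional calculus acts on an eigenvector through the eigenvalue. -/
theorem cfc_apply_eigenvector {T : H →L[ℂ] H} (hT : IsSelfAdjoint T) {f : ℝ → ℝ}
    (hf : Continuous f) {v : H} {c : ℝ} (hv : T v = (c : ℂ) • v) :
    cfc f T v = (f c : ℂ) • v := by
  rcases eq_or_ne v 0 with rfl | hv0
  · simp
  have hc : c ∈ spectrum ℝ T := by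
    rw [← spectrum.algebraMap_mem_iff ℂ, Complex.coe_algebraMap, spectrum.mem_iff]
    intro hu
    obtain ⟨S, hS⟩ := hu.exists_left_inv
    apply hv0
    have h1 : (algebraMap ℂ (H →L[ℂ] H) c - T) v = 0 := by
      simp [Algebra.algebraMap_eq_smul_one, hv]
    have h2 := congrArg (fun S : H →L[ℂ] H => S v) hS
    simpa [h1] using h2.symm
  rw [cfc_apply f T hT hf.continuousOn]
  generalize hg : (⟨_, hf.continuousOn.domRestrict⟩ : C(spectrum ℝ T, ℝ)) = g
  -- Stone–Weierstrass: the functions `g` that act on `v` as `g(c)` include the constants and the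
  -- identity, and are closed under sums, products and limits.
  have key : ∀ g : C(spectrum ℝ T, ℝ), cfcHom hT g v = (g ⟨c, hc⟩ : ℂ) • v := by
    intro g
    induction g using ContinuousMap.induction_on_of_compact with
    | const r =>
      have : ContinuousMap.const (spectrum ℝ T) r = algebraMap ℝ C(spectrum ℝ T, ℝ) r := rfl
      rw [this, AlgHomClass.commutes]
      simp [Algebra.algebraMap_eq_smul_one]
    | id =>
      have : (ContinuousMap.restrict (spectrum ℝ T) (ContinuousMap.id ℝ)) =
        (⟨fun x => x, by fun_prop⟩ : C(spectrum ℝ T, ℝ)) := rfl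
      rw [cfcHom_id hT, hv]
      simp
    | star_id =>
      rw [show star (ContinuousMap.restrict (spectrum ℝ T) (ContinuousMap.id ℝ)) =
        ContinuousMap.restrict (spectrum ℝ T) (ContinuousMap.id ℝ) by ext; simp,
        cfcHom_id hT, hv]
      simp
    | add f g hf hg => simp [hf, hg, add_smul]
    | mul f g hf hg =>
      rw [map_mul, mul_apply_eq_comp, hg, map_smul, hf, smul_smul, ContinuousMap.mul_apply,
        Complex.ofReal_mul, mul_comm]
    | frequently f hf =>
      have h1 : Continuous fun g : C(spectrum ℝ T, ℝ) => cfcHom hT g v :=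
        (ContinuousLinearMap.apply ℂ H v).continuous.comp (cfcHom_continuous hT)
      have h2 : Continuous fun g : C(spectrum ℝ T, ℝ) => (g ⟨c, hc⟩ : ℂ) • v :=
        (Complex.continuous_ofReal.comp (continuous_eval_const (⟨c, hc⟩ : spectrum ℝ T))).smul
          continuous_const
      exact (isClosed_eq h1 h2).mem_of_frequently_of_tendsto hf tendsto_id
  rw [key, ← hg]
  rfl

theorem rpow_apply_eigenvector {T : H →L[ℂ] H} (hT : 0 ≤ T) {v : H} {c : ℝ}
    (hv : T v = (c : ℂ) • v) {s : ℝ} (hs : 0 < s) : (T ^ s) v = ((c ^ s : ℝ) : ℂ) • v := by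
  rw [CFC.rpow_eq_cfc_real hT]
  exact cfc_apply_eigenvector hT.isSelfAdjoint (Real.continuous_rpow_const hs.le) hv

theorem abs_apply_eigenvector {T : H →L[ℂ] H} {v : H} {c : ℝ} (hc : 0 ≤ c)
    (hv : (star T * T) v = ((c ^ 2 : ℝ) : ℂ) • v) : CFC.abs T v = (c : ℂ) • v := by
  rw [CFC.abs, CFC.sqrt_eq_rpow, rpow_apply_eigenvector (star_mul_self_nonneg T) hv (by norm_num),
    ← Real.sqrt_eq_rpow, Real.sqrt_sq hc]

end Eigenvectors

section Operators

variable {ι : Type u}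

theorem L2C2.inner_eq_tsum (ψ φ : L2C2 ι) :
    inner ℂ ψ φ = ∑' i, inner ℂ (ψ.coord i) (φ.coord i) :=
  lp.inner_eq_tsum (𝕜 := ℂ) (G := fun _ : ι => EuclideanSpace ℂ (Fin 2)) ψ φ

open Classical in
theorem coord_stdVec (i : ι) (j : Fin 2) (i' : ι) :
    (stdVec i j).coord i' = if i' = i then EuclideanSpace.single j (1 : ℂ) else 0 := by
  have := lp.single_apply (E := fun _ : ι => EuclideanSpace ℂ (Fin 2)) 2 i
    (EuclideanSpace.single j (1 : ℂ)) i'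
  refine this.trans ?_
  by_cases h : i' = i
  · subst h; simp
  · simp [h]

theorem inner_stdVec_self (i : ι) (j : Fin 2) : inner ℂ (stdVec i j) (stdVec i j) = (1 : ℂ) := by
  classical
  rw [L2C2.inner_eq_tsum, tsum_eq_single i]
  · simp [coord_stdVec]
  · intro i' h
    simp [coord_stdVec, h]

/-- A bounded operator is determined by its values on the standard orthonormal basis. -/
theorem L2C2.clm_ext {S T : L2C2 ι →L[ℂ] L2C2 ι} (h : ∀ i j, S (stdVec i j) = T (stdVec i j)) :
    S = T := by
  classical
  ext1 ψ
  have hsum : HasSum (fun i => ∑ j : Fin 2, (ψ.coord i) j • stdVec i j) ψ := by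
    have := lp.hasSum_single (E := fun _ : ι => EuclideanSpace ℂ (Fin 2)) (p := 2)
      (by norm_num) ψ
    refine HasSum.congr_fun this fun i => ?_
    ext1 i'
    rw [show (∑ j : Fin 2, (ψ.coord i) j • stdVec i j : L2C2 ι) =
      (ψ.coord i) 0 • stdVec i 0 + (ψ.coord i) 1 • stdVec i 1 from Fin.sum_univ_two _]
    rw [coord_add, coord_smul, coord_smul, coord_stdVec, coord_stdVec]
    refine Eq.trans ?_ (lp.single_apply (E := fun _ : ι => EuclideanSpace ℂ (Fin 2)) 2 i
      (ψ.coord i) i').symm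
    by_cases h : i' = i
    · subst h
      ext l
      fin_cases l <;> simp
    · simp [h]
  refine (S.hasSum hsum).unique ((T.hasSum hsum).congr_fun fun i => ?_)
  simp [h]

theorem isSelfAdjoint_blockDiag {a : ι → Matrix (Fin 2) (Fin 2) ℂ} {C : ℝ}
    (hC : ∀ i, ‖matOp (a i)‖ ≤ C) (ha : ∀ i, (a i).IsHermitian) :
    IsSelfAdjoint (blockDiag a) := by
  rw [ContinuousLinearMap.isSelfAdjoint_iff_isSymmetric]
  intro ψ φ
  simp only [ContinuousLinearMap.coe_coe]
  rw [L2C2.inner_eq_tsum, L2C2.inner_eq_tsum]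
  refine tsum_congr fun i => ?_
  rw [coord_blockDiag hC, coord_blockDiag hC]
  have h1 : IsSelfAdjoint (matOp (a i)) := by
    rw [IsSelfAdjoint, matOp, ← map_star]
    exact congrArg _ (ha i)
  exact (ContinuousLinearMap.isSelfAdjoint_iff_isSymmetric.1 h1) _ _

theorem matOp_single (a : Matrix (Fin 2) (Fin 2) ℂ) (j : Fin 2) :
    matOp a (EuclideanSpace.single j 1) = ∑ l, a l j • EuclideanSpace.single l (1 : ℂ) := by
  ext l
  rw [matOp, Matrix.ofLp_toEuclideanCLM, PiLp.ofLp_single, Matrix.mulVec_single,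
    Fin.sum_univ_two]
  fin_cases l <;> simp

theorem blockDiag_stdVec {a : ι → Matrix (Fin 2) (Fin 2) ℂ} {C : ℝ}
    (ha : ∀ i, ‖matOp (a i)‖ ≤ C) (i : ι) (j : Fin 2) :
    blockDiag a (stdVec i j) = ∑ l, a i l j • stdVec i l := by
  classical
  ext1 i'
  rw [coord_blockDiag ha, Fin.sum_univ_two, L2C2.coord_add, L2C2.coord_smul, L2C2.coord_smul,
    coord_stdVec, coord_stdVec, coord_stdVec]
  by_cases h : i' = i
  · subst h
    simp [matOp_single, Fin.sum_univ_two]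
  · simp [h]

theorem exists_norm_matOp_smul_le (b : Matrix (Fin 2) (Fin 2) ℂ) {d : ι → ℝ} {C : ℝ}
    (h0 : ∀ i, 0 ≤ d i) (hC : ∀ i, d i ≤ C) :
    ∀ i, ‖matOp ((d i : ℂ) • b)‖ ≤ C * ‖matOp b‖ := by
  intro i
  rw [matOp, map_smul, norm_smul, Complex.norm_real, Real.norm_of_nonneg (h0 i)]
  exact mul_le_mul_of_nonneg_right (hC i) (norm_nonneg _)

theorem norm_matOp_diag_le {p q : ℂ} (hp : ‖p‖ ≤ 1) (hq : ‖q‖ ≤ 1) :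
    ‖matOp !![p, 0; 0, q]‖ ≤ ‖matOp !![1, 0; 0, 0]‖ + ‖matOp !![0, 0; 0, 1]‖ := by
  have h : (!![p, 0; 0, q] : Matrix (Fin 2) (Fin 2) ℂ) =
      p • !![1, 0; 0, 0] + q • !![0, 0; 0, 1] := by
    ext i j; fin_cases i <;> fin_cases j <;> simp
  rw [h, matOp, map_add, map_smul, map_smul]
  refine (norm_add_le _ _).trans (add_le_add ?_ ?_)
  · rw [norm_smul]; exact mul_le_of_le_one_left (norm_nonneg _) hp
  · rw [norm_smul]; exact mul_le_of_le_one_left (norm_nonneg _) hq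

theorem posTrace_rpow_of_diag {T : L2C2 ι →L[ℂ] L2C2 ι} (hT : 0 ≤ T) {t : ι → Fin 2 → ℝ}
    (h : ∀ i j, T (stdVec i j) = (t i j : ℂ) • stdVec i j) {s : ℝ} (hs : 0 < s) :
    posTrace (T ^ s) = ∑' i, ∑ j, ENNReal.ofReal (t i j ^ s) := by
  refine tsum_congr fun i => Finset.sum_congr rfl fun j _ => ?_
  rw [rpow_apply_eigenvector hT (h i j) hs, inner_smul_right, inner_stdVec_self, mul_one,
    Complex.ofReal_re]

end Operators

/-! ### Traces of the operators of the spectral triple -/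

namespace BratteliDiagram

variable {B : BratteliDiagram.{u}} {w : B.FinPath → ℝ} {C : ℝ}

theorem norm_chi_le (O : Set B.PathSpace) (x : B.PathSpace) : ‖chi O x‖ ≤ 1 := by
  classical
  by_cases h : x ∈ O <;> simp [chi, h]

theorem norm_rep_chi_le (τ : ChoiceFunction w) (O : Set B.PathSpace) (γ : B.FinPath) :
    ‖matOp !![chi O (τ.pos γ), 0; 0, chi O (τ.neg γ)]‖ ≤
      ‖matOp !![1, 0; 0, 0]‖ + ‖matOp !![0, 0; 0, 1]‖ :=
  norm_matOp_diag_le (norm_chi_le O _) (norm_chi_le O _)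

theorem isSelfAdjoint_rep_chi (τ : ChoiceFunction w) (O : Set B.PathSpace) :
    IsSelfAdjoint (τ.rep (chi O)) := by
  classical
  refine isSelfAdjoint_blockDiag (norm_rep_chi_le τ O) fun γ => ?_
  ext i j
  fin_cases i <;> fin_cases j <;>
    simp [Matrix.conjTranspose_apply, chi, Set.indicator_apply]

open Classical in
/-- The point `τ₊(γ)` for `j = 0` and `τ₋(γ)` for `j = 1`. -/
noncomputable def ChoiceFunction.pt (τ : ChoiceFunction w) (γ : B.FinPath) (j : Fin 2) :
    B.PathSpace := if j = 0 then τ.pos γ else τ.neg γ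

theorem rep_chi_stdVec (τ : ChoiceFunction w) (O : Set B.PathSpace) (γ : B.FinPath) (j : Fin 2) :
    τ.rep (chi O) (stdVec γ j) = chi O (τ.pt γ j) • stdVec γ j := by
  rw [ChoiceFunction.rep, blockDiag_stdVec (norm_rep_chi_le τ O), Fin.sum_univ_two]
  fin_cases j <;> simp [ChoiceFunction.pt]

/-- The flip squares to the identity, so `D⁻²` is diagonal although `D⁻¹` is not; its square root
`|D|⁻¹` is then diagonal as well. -/
theorem diracInv_sq_stdVec (h0 : ∀ γ, 0 ≤ cylDiam w γ) (hC : ∀ γ, cylDiam w γ ≤ C)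
    (γ : B.FinPath) (j : Fin 2) :
    (star (diracInv w) * diracInv w) (stdVec γ j) =
      ((cylDiam w γ ^ 2 : ℝ) : ℂ) • stdVec γ j := by
  have hb := exists_norm_matOp_smul_le !![0, 1; 1, 0] h0 hC
  have hsa : star (diracInv w) = diracInv w := by
    refine isSelfAdjoint_blockDiag hb fun γ => ?_
    ext i j
    fin_cases i <;> fin_cases j <;> simp [Matrix.conjTranspose_apply]
  rw [hsa, mul_apply_eq_comp, diracInv, blockDiag_stdVec hb, Fin.sum_univ_two,
    map_add, map_smul, map_smul, blockDiag_stdVec hb, blockDiag_stdVec hb, sq, Complex.ofReal_mul]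
  fin_cases j <;> simp [smul_smul, -Complex.coe_smul, -Complex.real_smul]

theorem absDiracPow_nonneg (w : B.FinPath → ℝ) (t : ℝ) : 0 ≤ absDiracPow w t := CFC.rpow_nonneg

theorem absDiracPow_stdVec (h0 : ∀ γ, 0 ≤ cylDiam w γ) (hC : ∀ γ, cylDiam w γ ≤ C) {t : ℝ}
    (ht : 0 < t) (γ : B.FinPath) (j : Fin 2) :
    absDiracPow w t (stdVec γ j) = ((cylDiam w γ ^ t : ℝ) : ℂ) • stdVec γ j := by
  have h := abs_apply_eigenvector (h0 γ) (diracInv_sq_stdVec h0 hC γ j)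
  rw [absDiracPow]
  have hn : 0 ≤ CFC.abs (diracInv w) := CFC.abs_nonneg (diracInv w)
  have h2 := rpow_apply_eigenvector hn h ht
  exact h2

/-- Both factors are diagonal and the first is a projection, so the product is a compression `p T p`
of a positive operator. -/
theorem rep_mul_absDiracPow_nonneg (h0 : ∀ γ, 0 ≤ cylDiam w γ) (hC : ∀ γ, cylDiam w γ ≤ C)
    (τ : ChoiceFunction w) (O : Set B.PathSpace) {t : ℝ} (ht : 0 < t) :
    0 ≤ τ.rep (chi O) * absDiracPow w t := by
  classical
  have h : τ.rep (chi O) * absDiracPow w t =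
      star (τ.rep (chi O)) * absDiracPow w t * τ.rep (chi O) := by
    refine L2C2.clm_ext fun γ j => ?_
    rw [(isSelfAdjoint_rep_chi τ O).star_eq]
    simp only [mul_apply_eq_comp, rep_chi_stdVec, absDiracPow_stdVec h0 hC ht,
      map_smul, smul_smul]
    congr 1
    by_cases h : τ.pt γ j ∈ O <;> simp [chi, h]
  rw [h]
  exact star_left_conjugate_nonneg (absDiracPow_nonneg w t) _

-- The choice function enters the trace only through the question which of the points `τ_±(γ)` lie
-- in `O`. The eigenvalues at the other points are `0`, and they stay `0` since `s > 0`.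
open Classical in
theorem posTrace_rep_mul_absDiracPow (h0 : ∀ γ, 0 ≤ cylDiam w γ) (hC : ∀ γ, cylDiam w γ ≤ C)
    (τ : ChoiceFunction w) (O : Set B.PathSpace) {t s : ℝ} (ht : 0 < t) (hs : 0 < s) :
    posTrace ((τ.rep (chi O) * absDiracPow w t) ^ s) =
      ∑' γ, ((if τ.pos γ ∈ O then ENNReal.ofReal (cylDiam w γ ^ (t * s)) else 0) +
        if τ.neg γ ∈ O then ENNReal.ofReal (cylDiam w γ ^ (t * s)) else 0) := by
  rw [posTrace_rpow_of_diag (rep_mul_absDiracPow_nonneg h0 hC τ O ht)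
    (t := fun γ j => if τ.pt γ j ∈ O then cylDiam w γ ^ t else 0) _ hs]
  · refine tsum_congr fun γ => ?_
    have h : ∀ j, ENNReal.ofReal ((if τ.pt γ j ∈ O then cylDiam w γ ^ t else 0) ^ s) =
        if τ.pt γ j ∈ O then ENNReal.ofReal (cylDiam w γ ^ (t * s)) else 0 := by
      intro j
      split_ifs
      · rw [Real.rpow_mul (h0 γ)]
      · rw [Real.zero_rpow hs.ne', ENNReal.ofReal_zero]
    rw [Fin.sum_univ_two, h, h]
    simp [ChoiceFunction.pt]
  · intro γ j
    rw [mul_apply_eq_comp, absDiracPow_stdVec h0 hC ht, map_smul, rep_chi_stdVec,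
      smul_smul]
    congr 1
    by_cases h : τ.pt γ j ∈ O <;> simp [chi, h]

theorem rep_chi_univ (τ : ChoiceFunction w) : τ.rep (chi Set.univ) = 1 :=
  L2C2.clm_ext fun γ j => by
    rw [rep_chi_stdVec, chi, Set.indicator_of_mem (Set.mem_univ _), Pi.one_apply, one_smul]
    rfl

end BratteliDiagram

/-! ### The path space of a Bratteli diagram -/

namespace BratteliDiagram

variable {B : BratteliDiagram.{u}}

variable (B) in
/-- The finite paths of length `n` with range in level `0`. -/
abbrev PathN (n : ℕ) : Type u := Σ v : B.V n, B.Path n v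

/-- Extend a finite path by an edge. -/
def PathN.snoc {n : ℕ} (g : B.PathN n) (e : {e : B.E n // B.r e = g.1}) : B.PathN (n + 1) :=
  ⟨B.s e.1, .snoc g.2 e.1 e.2⟩

/-- Remove the last edge of a finite path. -/
def PathN.init {n : ℕ} : B.PathN (n + 1) → B.PathN n
  | ⟨_, .snoc γ _ _⟩ => ⟨_, γ⟩

/-- The last edge of a finite path. -/
def PathN.last {n : ℕ} : (g : B.PathN (n + 1)) → {e : B.E n // B.r e = g.init.1}
  | ⟨_, .snoc _ e h⟩ => ⟨e, h⟩

/-- A path of positive length is a shorter path together with a last edge. -/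
def pathSuccEquiv (n : ℕ) :
    B.PathN (n + 1) ≃ Σ g : B.PathN n, {e : B.E n // B.r e = g.1} where
  toFun g := ⟨g.init, g.last⟩
  invFun p := p.1.snoc p.2
  left_inv := by rintro ⟨_, _, _⟩; rfl
  right_inv _ := rfl

/-- A path of length zero is a vertex. -/
def pathZeroEquiv : B.PathN 0 ≃ B.V 0 where
  toFun g := g.1
  invFun v := ⟨v, .nil v⟩
  left_inv := by rintro ⟨_, ⟨⟩⟩; rfl
  right_inv _ := rfl

instance (n : ℕ) : Finite (B.V n) := B.finite_V n

instance (n : ℕ) : Finite (B.E n) := B.finite_E n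

instance finite_pathN (n : ℕ) : Finite (B.PathN n) := by
  induction n with
  | zero => exact Finite.of_equiv _ pathZeroEquiv.symm
  | succ n ih => exact Finite.of_equiv _ (pathSuccEquiv n).symm

noncomputable instance (n : ℕ) : Fintype (B.PathN n) := Fintype.ofFinite _

noncomputable instance (n : ℕ) (v : B.V n) : Fintype {e : B.E n // B.r e = v} :=
  Fintype.ofFinite _

theorem sum_pathN_succ {α : Type*} [AddCommMonoid α] {n : ℕ} (F : B.PathN (n + 1) → α) :
    ∑ g, F g = ∑ g : B.PathN n, ∑ e, F (g.snoc e) := by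
  rw [← (pathSuccEquiv n).symm.sum_comp, Fintype.sum_sigma]
  rfl

theorem sum_indicator_preimage_init {α : Type*} [AddCommMonoid α] {n : ℕ} (S : Set (B.PathN n))
    (F : B.PathN (n + 1) → α) :
    ∑ g, (PathN.init ⁻¹' S).indicator F g = ∑ g, S.indicator (fun g => ∑ e, F (g.snoc e)) g := by
  classical
  rw [sum_pathN_succ]
  refine Finset.sum_congr rfl fun g _ => ?_
  have h : ∀ e, (PathN.init ⁻¹' S).indicator F (g.snoc e) =
      if g ∈ S then F (g.snoc e) else 0 := fun e => Set.indicator_apply _ _ _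
  simp_rw [h, Set.indicator_apply]
  split_ifs <;> simp

/-- The initial segment of length `n` of an infinite path. -/
def PathSpace.takeN (x : B.PathSpace) (n : ℕ) : B.PathN n := ⟨x.vtx n, x.takeAux n⟩

theorem PathSpace.takeN_succ (x : B.PathSpace) (n : ℕ) :
    x.takeN (n + 1) = (x.takeN n).snoc ⟨x.edge n, x.r_edge n⟩ := rfl

theorem snoc_eq_snoc_iff {n : ℕ} {g g' : B.PathN n} {e : {e : B.E n // B.r e = g.1}}
    {e' : {e : B.E n // B.r e = g'.1}} :
    g.snoc e = g'.snoc e' ↔ g = g' ∧ e.1 = e'.1 := by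
  constructor
  · intro h
    exact ⟨congrArg PathN.init h, congrArg (fun g : B.PathN (n + 1) => g.last.1) h⟩
  · rintro ⟨rfl, h⟩
    rw [Subtype.ext h]

theorem PathSpace.takeN_succ_eq_iff {x y : B.PathSpace} {n : ℕ} :
    x.takeN (n + 1) = y.takeN (n + 1) ↔ x.takeN n = y.takeN n ∧ x.edge n = y.edge n := by
  rw [takeN_succ, takeN_succ]
  exact snoc_eq_snoc_iff

theorem PathSpace.takeN_zero_eq_iff {x y : B.PathSpace} :
    x.takeN 0 = y.takeN 0 ↔ B.r (x.edge 0) = B.r (y.edge 0) :=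
  (pathZeroEquiv.apply_eq_iff_eq (x := x.takeN 0) (y := y.takeN 0)).symm

theorem PathSpace.takeN_eq_mono {x y : B.PathSpace} {m n : ℕ} (hmn : m ≤ n)
    (h : x.takeN n = y.takeN n) : x.takeN m = y.takeN m := by
  induction hmn with
  | refl => exact h
  | step _ ih => exact ih (congrArg PathN.init h)

theorem PathSpace.eq_of_takeN_eq {x y : B.PathSpace} (h : ∀ n, x.takeN n = y.takeN n) : x = y :=
  PathSpace.ext (funext fun n => (takeN_succ_eq_iff.1 (h (n + 1))).2)

theorem PathSpace.take_eq_iff {x y : B.PathSpace} {n : ℕ} :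
    x.take n = y.take n ↔ x.takeN n = y.takeN n :=
  ⟨fun h => eq_of_heq (Sigma.mk.inj h).2, fun h => congrArg (Sigma.mk n) h⟩

/-- Replaces the recursive definition of cylinders by fibres of `takeN`, the form used throughout.
-/
theorem mem_cylinder_iff_takeN {n : ℕ} (g : B.PathN n) (x : B.PathSpace) :
    x ∈ g.2.cylinder ↔ x.takeN n = g := by
  induction n with
  | zero =>
    obtain ⟨v, ⟨⟩⟩ := g
    exact pathZeroEquiv.apply_eq_iff_eq (x := x.takeN 0) (y := ⟨v, .nil v⟩)
  | succ n ih =>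
    obtain ⟨_, γ⟩ := g
    cases γ with
    | @snoc _ v γ e h =>
      rw [PathSpace.takeN_succ]
      have h2 := snoc_eq_snoc_iff (g := x.takeN n) (g' := (⟨v, γ⟩ : B.PathN n))
        (e := ⟨x.edge n, x.r_edge n⟩) (e' := ⟨e, h⟩)
      exact Iff.trans (and_congr (ih ⟨v, γ⟩) Iff.rfl) h2.symm

theorem FinPath.cylinder_mk {n : ℕ} (g : B.PathN n) :
    FinPath.cylinder (⟨n, g⟩ : B.FinPath) = {x | x.takeN n = g} :=
  Set.ext fun x => mem_cylinder_iff_takeN g x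

theorem FinPath.mem_cylinder_iff (γ : B.FinPath) (x : B.PathSpace) :
    x ∈ γ.cylinder ↔ x.takeN γ.1 = γ.2 := mem_cylinder_iff_takeN γ.2 x

theorem isTopologicalBasis_cylinder :
    TopologicalSpace.IsTopologicalBasis (Set.range (FinPath.cylinder (B := B))) where
  exists_subset_inter := by
    rintro _ ⟨γ, rfl⟩ _ ⟨γ', rfl⟩ x ⟨hx, hx'⟩
    rw [FinPath.mem_cylinder_iff] at hx hx'
    refine ⟨_, ⟨x.take (max γ.1 γ'.1), rfl⟩, (FinPath.mem_cylinder_iff _ _).2 rfl, fun y hy => ?_⟩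
    rw [FinPath.mem_cylinder_iff] at hy
    constructor
    · rw [FinPath.mem_cylinder_iff, ← hx]
      exact PathSpace.takeN_eq_mono (le_max_left _ _) hy
    · rw [FinPath.mem_cylinder_iff, ← hx']
      exact PathSpace.takeN_eq_mono (le_max_right _ _) hy
  sUnion_eq := Set.eq_univ_of_forall fun x =>
    ⟨_, ⟨x.take 0, rfl⟩, (FinPath.mem_cylinder_iff _ _).2 rfl⟩
  eq_generateFrom := rfl

theorem PathSpace.nhds_hasBasis (x : B.PathSpace) :
    (𝓝 x).HasBasis (fun _ : ℕ => True) fun n => {y | y.takeN n = x.takeN n} := by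
  refine ⟨fun U => ?_⟩
  rw [isTopologicalBasis_cylinder.mem_nhds_iff]
  constructor
  · rintro ⟨_, ⟨γ, rfl⟩, hx, hU⟩
    rw [FinPath.mem_cylinder_iff] at hx
    exact ⟨γ.1, trivial, fun y hy => hU ((FinPath.mem_cylinder_iff _ _).2 (hx ▸ hy))⟩
  · rintro ⟨n, -, hU⟩
    exact ⟨_, ⟨x.take n, rfl⟩, (FinPath.mem_cylinder_iff _ _).2 rfl, fun y hy =>
      hU ((FinPath.mem_cylinder_iff _ _).1 hy)⟩

theorem PathSpace.isClopen_takeN_preimage {n : ℕ} (S : Set (B.PathN n)) :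
    IsClopen {x : B.PathSpace | x.takeN n ∈ S} := by
  have hopen : ∀ S : Set (B.PathN n), IsOpen {x : B.PathSpace | x.takeN n ∈ S} := fun S =>
    isOpen_iff_mem_nhds.2 fun x hx => x.nhds_hasBasis.mem_iff.2
      ⟨n, trivial, fun y (hy : y.takeN n = x.takeN n) => by
        change y.takeN n ∈ S; rw [hy]; exact hx⟩
  exact ⟨⟨hopen Sᶜ⟩, hopen S⟩

theorem FinPath.isClopen_cylinder (γ : B.FinPath) : IsClopen γ.cylinder := by
  obtain ⟨n, g⟩ := γ
  rw [FinPath.cylinder_mk]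
  exact PathSpace.isClopen_takeN_preimage {g}

instance : T2Space B.PathSpace := ⟨fun x y hxy => by
  obtain ⟨n, hn⟩ : ∃ n, x.takeN n ≠ y.takeN n := by
    by_contra! h
    exact hxy (PathSpace.eq_of_takeN_eq h)
  exact ⟨{z | z.takeN n ∈ ({x.takeN n} : Set _)}, {z | z.takeN n ∈ ({x.takeN n}ᶜ : Set _)},
    (PathSpace.isClopen_takeN_preimage _).2, (PathSpace.isClopen_takeN_preimage _).2,
    rfl, Ne.symm hn, Set.disjoint_left.2 fun z hz hz' => hz' hz⟩⟩

instance : SecondCountableTopology B.PathSpace :=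
  ⟨⟨_, Set.countable_range _, rfl⟩⟩

/-- Along an ultrafilter the `n`-th edge is eventually constant because there are finitely many; the
constant edges form the limit path. -/
instance : CompactSpace B.PathSpace := ⟨by
  rw [isCompact_iff_ultrafilter_le_nhds]
  intro U _
  have h : ∀ n, ∃ e : B.E n, ∀ᶠ x in (U : Filter B.PathSpace), x.edge n = e := by
    intro n
    obtain ⟨e, he⟩ := (U.map fun x : B.PathSpace => x.edge n).eq_pure_of_finite
    refine ⟨e, ?_⟩
    have : ({e} : Set (B.E n)) ∈ U.map fun x : B.PathSpace => x.edge n := by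
      rw [he]; exact rfl
    exact this
  choose e he using h
  let y : B.PathSpace := ⟨e, fun n => by
    obtain ⟨x, hx, hx'⟩ := ((he n).and (he (n + 1))).exists
    rw [← hx, ← hx']
    exact x.compat n⟩
  refine ⟨y, Set.mem_univ y, y.nhds_hasBasis.ge_iff.2 fun n _ => ?_⟩
  change ∀ᶠ x in (U : Filter B.PathSpace), x.takeN n = y.takeN n
  induction n with
  | zero =>
    filter_upwards [he 0] with x hx
    rw [PathSpace.takeN_zero_eq_iff, hx]
  | succ n ih =>
    filter_upwards [ih, he n] with x hx hx'
    exact PathSpace.takeN_succ_eq_iff.2 ⟨hx, hx'⟩⟩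

/-- A clopen set is determined by the initial segments of some length. -/
theorem exists_eq_takeN_preimage {O : Set B.PathSpace} (hO : IsClopen O) :
    ∃ (N : ℕ) (S : Set (B.PathN N)), O = {x | x.takeN N ∈ S} := by
  have h : ∀ x : B.PathSpace, ∃ n, ∀ y, y.takeN n = x.takeN n → (y ∈ O ↔ x ∈ O) := by
    intro x
    by_cases hx : x ∈ O
    · obtain ⟨n, -, hn⟩ := x.nhds_hasBasis.mem_iff.1 (hO.2.mem_nhds hx)
      exact ⟨n, fun y hy => iff_of_true (hn hy) hx⟩
    · obtain ⟨n, -, hn⟩ := x.nhds_hasBasis.mem_iff.1 (hO.compl.2.mem_nhds hx)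
      exact ⟨n, fun y hy => iff_of_false (hn hy) hx⟩
  choose n hn using h
  -- Each point has its own sufficient length; a finite subcover makes their supremum work for all
  -- points.
  obtain ⟨t, ht⟩ := CompactSpace.elim_nhds_subcover
    (fun x : B.PathSpace => {y | y.takeN (n x) = x.takeN (n x)})
    (fun x => x.nhds_hasBasis.mem_of_mem trivial)
  have key : ∀ x y : B.PathSpace, x.takeN (t.sup n) = y.takeN (t.sup n) → x ∈ O → y ∈ O := by
    intro x y hxy hx
    have hx' : x ∈ ⋃ z ∈ t, {y : B.PathSpace | y.takeN (n z) = z.takeN (n z)} := by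
      rw [ht]; trivial
    obtain ⟨z, hz, hxz⟩ := Set.mem_iUnion₂.1 hx'
    have hyz : y.takeN (n z) = z.takeN (n z) :=
      (PathSpace.takeN_eq_mono (Finset.le_sup hz) hxy).symm.trans hxz
    rw [hn z y hyz, ← hn z x hxz]
    exact hx
  refine ⟨t.sup n, (fun x => x.takeN (t.sup n)) '' O, Set.ext fun x => ⟨fun hx => ⟨x, hx, rfl⟩, ?_⟩⟩
  rintro ⟨y, hy, hxy⟩
  exact key y x hxy hy

/-- The set of extensions by `q` edges of the paths in `S`. -/
def liftSet {N : ℕ} (S : Set (B.PathN N)) : ∀ q, Set (B.PathN (N + q))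
  | 0 => S
  | q + 1 => PathN.init ⁻¹' liftSet S q

theorem takeN_mem_liftSet_iff {N : ℕ} (S : Set (B.PathN N)) (q : ℕ) (x : B.PathSpace) :
    x.takeN (N + q) ∈ liftSet S q ↔ x.takeN N ∈ S := by
  induction q with
  | zero => rfl
  | succ q ih => exact ih

/-! ### Extending finite paths; diameters -/

/-- The edge type depends on the level, so the tail is kept as a sequence indexed from `0`; its
entries below `n` are mere filler. The recursion restarts at level `n` with an edge of range `v`. -/
theorem exists_tail [∀ j, Nonempty (B.V j)] (h : ∀ n (v : B.V n), ∃ e : B.E n, B.r e = v)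
    (n : ℕ) (v : B.V n) :
    ∃ f : ∀ j, B.E j, B.r (f n) = v ∧ ∀ j, n ≤ j → B.s (f j) = B.r (f (j + 1)) := by
  classical
  choose e he using h
  let v₀ : ∀ j, B.V j := Function.update (fun j => Classical.arbitrary (B.V j)) n v
  let f : ∀ j, B.E j := fun j => Nat.rec (motive := B.E) (e 0 (v₀ 0))
    (fun j ej => if j + 1 = n then e (j + 1) (v₀ (j + 1)) else e (j + 1) (B.s ej)) j
  refine ⟨f, ?_, fun j hj => ?_⟩
  · have hf : f n = e n (v₀ n) := by
      rcases n with _ | n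
      · rfl
      · exact if_pos rfl
    rw [hf, he]
    exact Function.update_self n v _
  · have hf : f (j + 1) = e (j + 1) (B.s (f j)) := if_neg (by omega)
    rw [hf, he]

/-- A finite path and a sequence of edges that starts at its source form an infinite path. -/
theorem exists_path_append {n : ℕ} (g : B.PathN n) (f : ∀ j, B.E j) (hf : B.r (f n) = g.1)
    (hc : ∀ j, n ≤ j → B.s (f j) = B.r (f (j + 1))) :
    ∃ x : B.PathSpace, x.takeN n = g ∧ ∀ j, n ≤ j → x.edge j = f j := by
  classical
  induction n generalizing f with
  | zero =>
    refine ⟨⟨f, fun j => hc j (Nat.zero_le j)⟩, ?_, fun _ _ => rfl⟩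
    exact pathZeroEquiv.injective hf
  | succ n ih =>
    obtain ⟨g, e, rfl⟩ : ∃ (g' : B.PathN n) (e : _), g = g'.snoc e :=
      ⟨g.init, g.last, ((pathSuccEquiv n).symm_apply_apply g).symm⟩
    have hne : ∀ j, n < j → Function.update f n e.1 j = f j := fun j hj =>
      Function.update_of_ne (by omega) _ _
    obtain ⟨x, hx, hxf⟩ := ih g (Function.update f n e.1)
      (by rw [Function.update_self]; exact e.2) (fun j hj => by
        rw [hne (j + 1) (by omega)]
        rcases eq_or_lt_of_le hj with rfl | hj
        · rw [Function.update_self]; exact hf.symm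
        · rw [hne j hj]; exact hc j hj)
    refine ⟨x, ?_, fun j hj => by rw [hxf j (by omega), hne j (by omega)]⟩
    rw [PathSpace.takeN_succ]
    refine snoc_eq_snoc_iff.2 ⟨hx, ?_⟩
    change x.edge n = e.1
    rw [hxf n le_rfl, Function.update_self]

theorem FinPath.cylinder_nonempty [∀ j, Nonempty (B.V j)]
    (h : ∀ n (v : B.V n), ∃ e : B.E n, B.r e = v) (γ : B.FinPath) : γ.cylinder.Nonempty := by
  obtain ⟨n, g⟩ := γ
  obtain ⟨f, hf, hc⟩ := exists_tail h n g.1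
  obtain ⟨x, hx, -⟩ := exists_path_append g f hf hc
  exact ⟨x, (FinPath.mem_cylinder_iff _ _).2 hx⟩

variable {w : B.FinPath → ℝ}

theorem PathSpace.bddAbove_take_eq {x y : B.PathSpace} (hxy : x ≠ y) :
    BddAbove {n : ℕ | x.take n = y.take n} := by
  obtain ⟨n, hn⟩ : ∃ n, x.takeN n ≠ y.takeN n := by
    by_contra! h
    exact hxy (PathSpace.eq_of_takeN_eq h)
  refine ⟨n, fun m (hm : x.take m = y.take m) => ?_⟩
  by_contra! hlt
  exact hn (PathSpace.takeN_eq_mono hlt.le (PathSpace.take_eq_iff.1 hm))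

theorem weight_take_antitone (hw : ∀ n (g : B.PathN n) e, w ⟨n + 1, g.snoc e⟩ ≤ w ⟨n, g⟩)
    (x : B.PathSpace) : Antitone fun n => w (x.take n) :=
  antitone_nat_of_succ_le fun n => hw n (x.takeN n) ⟨x.edge n, x.r_edge n⟩

/-- The longest common initial segment of two points of `[γ]` extends `γ`, and the weight decreases
along extensions. -/
theorem pathDist_le (h0 : ∀ γ, 0 ≤ w γ)
    (hw : ∀ n (g : B.PathN n) e, w ⟨n + 1, g.snoc e⟩ ≤ w ⟨n, g⟩) {γ : B.FinPath}
    {x y : B.PathSpace} (hx : x ∈ γ.cylinder) (hy : y ∈ γ.cylinder) : pathDist w x y ≤ w γ := by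
  rw [FinPath.mem_cylinder_iff] at hx hy
  unfold pathDist
  split_ifs with h1 h2
  · exact h0 γ
  · exact absurd (PathSpace.takeN_zero_eq_iff.1
      (PathSpace.takeN_eq_mono (Nat.zero_le _) (hx.trans hy.symm))) h2
  · have hmem : γ.1 ∈ {n : ℕ | x.take n = y.take n} := PathSpace.take_eq_iff.2 (hx.trans hy.symm)
    have hle := le_csSup (PathSpace.bddAbove_take_eq h1) hmem
    calc w (x.meet y) ≤ w (x.take γ.1) := weight_take_antitone hw x hle
      _ = w γ := congrArg w (Sigma.ext rfl (heq_of_eq hx))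

/-- Paths that agree up to `γ` and differ at the next edge have `γ` as longest common initial
segment. -/
theorem pathDist_eq_of_edge_ne {γ : B.FinPath} {x y : B.PathSpace} (hx : x ∈ γ.cylinder)
    (hy : y ∈ γ.cylinder) (hne : x.edge γ.1 ≠ y.edge γ.1) : pathDist w x y = w γ := by
  rw [FinPath.mem_cylinder_iff] at hx hy
  have h1 : x ≠ y := fun h => hne (by rw [h])
  have h2 : B.r (x.edge 0) = B.r (y.edge 0) := PathSpace.takeN_zero_eq_iff.1
    (PathSpace.takeN_eq_mono (Nat.zero_le _) (hx.trans hy.symm))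
  have h3 : {n : ℕ | x.take n = y.take n} = Set.Iic γ.1 := by
    ext m
    refine PathSpace.take_eq_iff.trans ⟨fun h => ?_, fun h =>
      PathSpace.takeN_eq_mono h (hx.trans hy.symm)⟩
    by_contra hlt
    exact hne (PathSpace.takeN_succ_eq_iff.1
      (PathSpace.takeN_eq_mono (Nat.succ_le_of_lt (not_le.1 hlt)) h)).2
  rw [pathDist, if_neg h1, if_neg (not_not.2 h2), PathSpace.meet, h3, csSup_Iic]
  exact congrArg w (Sigma.ext rfl (heq_of_eq hx))

/-- If every vertex receives two edges, then every cylinder contains two paths that separate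
right after it. -/
theorem exists_mem_cylinder_edge_ne [∀ j, Nonempty (B.V j)]
    (htwo : ∀ n (v : B.V n), ∃ e e' : B.E n, e ≠ e' ∧ B.r e = v ∧ B.r e' = v) (γ : B.FinPath) :
    ∃ x ∈ γ.cylinder, ∃ y ∈ γ.cylinder, x.edge γ.1 ≠ y.edge γ.1 := by
  obtain ⟨n, g⟩ := γ
  obtain ⟨e, e', hne, he, he'⟩ := htwo n g.1
  have hone : ∀ n (v : B.V n), ∃ e : B.E n, B.r e = v := fun n v =>
    let ⟨e, _, _, he, _⟩ := htwo n v
    ⟨e, he⟩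
  have key : ∀ e : {e : B.E n // B.r e = g.1},
      ∃ x ∈ FinPath.cylinder (⟨n, g⟩ : B.FinPath), x.edge n = e.1 := by
    intro e
    obtain ⟨x, hx⟩ := FinPath.cylinder_nonempty hone ⟨n + 1, PathN.snoc g e⟩
    rw [FinPath.mem_cylinder_iff] at hx
    obtain ⟨h1, h2⟩ := snoc_eq_snoc_iff.1 ((x.takeN_succ n).symm.trans hx)
    exact ⟨x, (FinPath.mem_cylinder_iff _ _).2 h1, h2⟩
  obtain ⟨x, hx, hxe⟩ := key ⟨e, he⟩
  obtain ⟨y, hy, hye⟩ := key ⟨e', he'⟩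
  exact ⟨x, hx, y, hy, by
    change x.edge n ≠ y.edge n
    rw [hxe, hye]
    exact hne⟩

theorem cylDiam_eq [∀ j, Nonempty (B.V j)]
    (htwo : ∀ n (v : B.V n), ∃ e e' : B.E n, e ≠ e' ∧ B.r e = v ∧ B.r e' = v)
    (h0 : ∀ γ, 0 ≤ w γ) (hw : ∀ n (g : B.PathN n) e, w ⟨n + 1, g.snoc e⟩ ≤ w ⟨n, g⟩)
    (γ : B.FinPath) : cylDiam w γ = w γ := by
  obtain ⟨x, hx, y, hy, hne⟩ := exists_mem_cylinder_edge_ne htwo γ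
  refine IsGreatest.csSup_eq ⟨⟨x, hx, y, hy, (pathDist_eq_of_edge_ne hx hy hne).symm⟩, ?_⟩
  rintro _ ⟨x, hx, y, hy, rfl⟩
  exact pathDist_le h0 hw hx hy

theorem nonempty_choiceFunction [∀ j, Nonempty (B.V j)]
    (htwo : ∀ n (v : B.V n), ∃ e e' : B.E n, e ≠ e' ∧ B.r e = v ∧ B.r e' = v)
    (h0 : ∀ γ, 0 ≤ w γ) (hw : ∀ n (g : B.PathN n) e, w ⟨n + 1, g.snoc e⟩ ≤ w ⟨n, g⟩) :
    Nonempty (ChoiceFunction w) := by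
  choose x hx y hy hne using exists_mem_cylinder_edge_ne htwo
  exact ⟨⟨x, y, hx, hy, fun γ => by
    rw [cylDiam_eq htwo h0 hw, pathDist_eq_of_edge_ne (hx γ) (hy γ) (hne γ)]⟩⟩

/-! ### Measures on the path space -/

theorem measure_takeN_preimage (μ : Measure B.PathSpace) {n : ℕ} (S : Set (B.PathN n)) :
    μ {x | x.takeN n ∈ S} =
      ∑ g, S.indicator (fun g => μ (FinPath.cylinder (⟨n, g⟩ : B.FinPath))) g := by
  classical
  have h := sum_measure_preimage_singleton (μ := μ) (Finset.univ.filter (· ∈ S))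
    (f := fun x : B.PathSpace => x.takeN n)
    (fun g _ => (PathSpace.isClopen_takeN_preimage {g}).2.measurableSet)
  rw [Finset.sum_filter] at h
  simp only [Finset.coe_filter, Finset.mem_univ, true_and] at h
  refine h.symm.trans (Finset.sum_congr rfl fun g _ => ?_)
  rw [Set.indicator_apply, FinPath.cylinder_mk]
  rfl

theorem measure_univ_eq_sum (μ : Measure B.PathSpace) :
    μ Set.univ = ∑ g : B.PathN 0, μ (FinPath.cylinder (⟨0, g⟩ : B.FinPath)) := by
  simpa using measure_takeN_preimage μ (n := 0) Set.univ

/-- A finite measure on the path space is determined by its values on cylinder sets. -/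
theorem measure_ext_cylinder {μ ν : Measure B.PathSpace} [IsFiniteMeasure μ]
    (h : ∀ γ : B.FinPath, μ γ.cylinder = ν γ.cylinder) : μ = ν := by
  refine ext_of_generate_finite _ isTopologicalBasis_cylinder.borel_eq_generateFrom ?_ ?_ ?_
  · rintro _ ⟨γ, rfl⟩ _ ⟨γ', rfl⟩ ⟨x, hx, hx'⟩
    rw [FinPath.mem_cylinder_iff] at hx hx'
    rcases le_total γ.1 γ'.1 with hle | hle
    · refine ⟨γ', (Set.inter_eq_right.2 fun y hy => ?_).symm⟩
      rw [FinPath.mem_cylinder_iff] at hy ⊢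
      rw [← hx]
      exact PathSpace.takeN_eq_mono hle (hy.trans hx'.symm)
    · refine ⟨γ, (Set.inter_eq_left.2 fun y hy => ?_).symm⟩
      rw [FinPath.mem_cylinder_iff] at hy ⊢
      rw [← hx']
      exact PathSpace.takeN_eq_mono hle (hy.trans hx.symm)
  · rintro _ ⟨γ, rfl⟩
    exact h γ
  · rw [measure_univ_eq_sum, measure_univ_eq_sum]
    exact Finset.sum_congr rfl fun g _ => h _

theorem sum_indicator_liftSet {α : Type*} [AddCommMonoid α] {p : B.FinPath → α}
    (hp : ∀ n (g : B.PathN n), ∑ e, p ⟨n + 1, g.snoc e⟩ = p ⟨n, g⟩) {n : ℕ}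
    (S : Set (B.PathN n)) (q : ℕ) :
    ∑ g, (liftSet S q).indicator (fun g => p ⟨n + q, g⟩) g =
      ∑ g, S.indicator (fun g => p ⟨n, g⟩) g := by
  induction q with
  | zero => rfl
  | succ q ih =>
    rw [← ih]
    refine (sum_indicator_preimage_init (liftSet S q) fun g => p ⟨n + q + 1, g⟩).trans ?_
    simp_rw [hp]

/-- Consistent masses of the cylinder sets are the values of a probability measure. -/
theorem exists_probabilityMeasure {p : B.FinPath → ℝ≥0∞}
    (hne : ∀ γ : B.FinPath, γ.cylinder.Nonempty) (h1 : ∑ g : B.PathN 0, p ⟨0, g⟩ = 1)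
    (hp : ∀ n (g : B.PathN n), ∑ e, p ⟨n + 1, g.snoc e⟩ = p ⟨n, g⟩) :
    ∃ μ : Measure B.PathSpace, IsProbabilityMeasure μ ∧ ∀ γ : B.FinPath, μ γ.cylinder = p γ := by
  classical
  choose pt hpt using hne
  -- `μ n` puts the mass of each path of length `n` at one point of its cylinder. By consistency it
  -- is already exact on cylinders of length at most `n`.
  let μ : ℕ → Measure B.PathSpace := fun n => ∑ g : B.PathN n, p ⟨n, g⟩ • Measure.dirac (pt ⟨n, g⟩)
  have hμ : ∀ n (S : Set (B.PathN n)),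
      μ n {x | x.takeN n ∈ S} = ∑ g, S.indicator (fun g => p ⟨n, g⟩) g := by
    intro n S
    simp only [μ, Measure.finsetSum_apply, Measure.smul_apply, smul_eq_mul]
    refine Finset.sum_congr rfl fun g _ => ?_
    have hg : (pt ⟨n, g⟩).takeN n = g := (FinPath.mem_cylinder_iff _ _).1 (hpt ⟨n, g⟩)
    rw [Measure.dirac_apply' _ (PathSpace.isClopen_takeN_preimage S).2.measurableSet,
      Set.indicator_apply, Set.indicator_apply]
    simp only [Set.mem_ofPred_eq, hg, Pi.one_apply]
    split_ifs <;> simp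
  have hμq : ∀ n (S : Set (B.PathN n)) q,
      μ (n + q) {x | x.takeN n ∈ S} = ∑ g, S.indicator (fun g => p ⟨n, g⟩) g := by
    intro n S q
    rw [← sum_indicator_liftSet hp S q, ← hμ]
    simp_rw [takeN_mem_liftSet_iff]
  have hprob : ∀ n, IsProbabilityMeasure (μ n) := by
    intro n
    constructor
    have h := hμq 0 Set.univ n
    rw [zero_add] at h
    simpa [h1] using h
  let ν : ℕ → ProbabilityMeasure B.PathSpace := fun n => ⟨μ n, hprob n⟩
  -- Probability measures on a compact space form a compact space, so an ultrafilter limit exists.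
  -- Cylinders are clopen, hence have null frontier, and their masses pass to the limit.
  obtain ⟨M, -, hM⟩ := isCompact_iff_ultrafilter_le_nhds.1
    (isCompact_univ (X := ProbabilityMeasure B.PathSpace)) ((hyperfilter ℕ).map ν) (by simp)
  have hlim : Tendsto ν (hyperfilter ℕ : Filter ℕ) (𝓝 M) := hM
  refine ⟨M, inferInstance, fun γ => ?_⟩
  obtain ⟨n, g⟩ := γ
  let _ : MetricSpace B.PathSpace := TopologicalSpace.metrizableSpaceMetric _
  have hfr : (M : Measure B.PathSpace) (frontier (FinPath.cylinder ⟨n, g⟩)) = 0 := by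
    rw [(FinPath.isClopen_cylinder _).frontier_eq, measure_empty]
  have h2 := ProbabilityMeasure.tendsto_measure_of_null_frontier_of_tendsto' hlim hfr
  refine tendsto_nhds_unique h2 (tendsto_const_nhds.congr' ?_)
  have hev : ∀ᶠ m in atTop, p ⟨n, g⟩ = μ m (FinPath.cylinder ⟨n, g⟩) := by
    filter_upwards [eventually_ge_atTop n] with m hm
    obtain ⟨q, rfl⟩ := Nat.exists_eq_add_of_le hm
    have h3 := hμq n {g} q
    rw [FinPath.cylinder_mk]
    refine Eq.trans ?_ h3.symm
    simp [Set.indicator_apply]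
  exact (Nat.hyperfilter_le_atTop) hev

end BratteliDiagram

/-! ### Higher-rank graphs: factorization and counting -/

namespace KGraph

variable {k : ℕ} {Λ : KGraph.{u} k}

/-- Equal degrees on the left force equal degrees on the right, so the uniqueness part of the
factorization property applies. -/
theorem comp_inj {f g f' g' : Λ.Mor} (h : Λ.s f = Λ.r g) (h' : Λ.s f' = Λ.r g')
    (hd : Λ.d f = Λ.d f') (he : Λ.comp f g = Λ.comp f' g') : f = f' ∧ g = g' := by
  have hdg : Λ.d g = Λ.d g' := by
    have h1 := congrArg Λ.d he
    rw [Λ.d_comp _ _ h, Λ.d_comp _ _ h', hd] at h1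
    exact add_left_cancel h1
  obtain ⟨p, -, hp⟩ := Λ.factorization (Λ.comp f' g') (Λ.d f') (Λ.d g') (Λ.d_comp _ _ h')
  have h1 := hp (f, g) ⟨h, hd, hdg, he⟩
  have h2 := hp (f', g') ⟨h', rfl, rfl, rfl⟩
  exact Prod.mk.inj (h1.trans h2.symm)

theorem comp_left_cancel {f g g' : Λ.Mor} (h : Λ.s f = Λ.r g) (h' : Λ.s f = Λ.r g')
    (he : Λ.comp f g = Λ.comp f g') : g = g' := (comp_inj h h' rfl he).2

theorem exists_comp_of_le (l : Λ.Mor) {m : Fin k → ℕ} (hm : m ≤ Λ.d l) :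
    ∃ f g, Λ.s f = Λ.r g ∧ Λ.d f = m ∧ Λ.comp f g = l := by
  obtain ⟨p, ⟨h1, h2, -, h3⟩, -⟩ :=
    Λ.factorization l m (Λ.d l - m) (add_tsub_cancel_of_le hm).symm
  exact ⟨p.1, p.2, h1, h2, h3⟩

/-- `l` has the two factorizations `one (r l) · l` and `l · one (s l)`, both with left factor of
degree `0`. -/
theorem eq_one_of_d_eq_zero {l : Λ.Mor} (h : Λ.d l = 0) : l = Λ.one (Λ.s l) := by
  have := comp_inj (f := Λ.one (Λ.r l)) (g := l) (f' := l) (g' := Λ.one (Λ.s l))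
    (Λ.s_one _) (Λ.r_one _).symm (by rw [Λ.d_one, h]) (by rw [Λ.one_comp, Λ.comp_one])
  exact this.2

theorem one_injective : Function.Injective Λ.one := fun v w h => by
  rw [← Λ.r_one v, h, Λ.r_one]

variable (Λ) in
/-- The number of morphisms of degree `m` with given range and source. -/
noncomputable def cnt (m : Fin k → ℕ) : Matrix Λ.Vert Λ.Vert ℕ := fun v w =>
  Nat.card {l : Λ.Mor // Λ.d l = m ∧ Λ.r l = v ∧ Λ.s l = w}

theorem cnt_single (i : Fin k) : Λ.cnt (Pi.single i 1) = Λ.adj i := rfl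

theorem cnt_zero : Λ.cnt 0 = 1 := by
  ext v w
  rw [Matrix.one_apply, cnt]
  split_ifs with h
  · subst h
    rw [Nat.card_eq_one_iff_unique]
    refine ⟨⟨?_⟩, ⟨⟨Λ.one v, Λ.d_one v, Λ.r_one v, Λ.s_one v⟩⟩⟩
    rintro ⟨l, h1, -, h2⟩ ⟨l', h1', -, h2'⟩
    exact Subtype.ext ((eq_one_of_d_eq_zero h1).trans
      ((congrArg Λ.one (h2.trans h2'.symm)).trans (eq_one_of_d_eq_zero h1').symm))
  · rw [Nat.card_eq_zero]
    refine Or.inl ⟨?_⟩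
    rintro ⟨l, h1, h2, h3⟩
    apply h
    rw [← h2, ← h3, eq_one_of_d_eq_zero h1, Λ.r_one, Λ.s_one]

section Finite

variable [Λ.IsFinite]

theorem finite_of_deg {m : Fin k → ℕ} (P : Λ.Mor → Prop) (h : ∀ l, P l → Λ.d l = m) :
    Finite {l : Λ.Mor // P l} :=
  ((IsFinite.finite_deg (Λ := Λ) m).subset h).to_subtype

instance (m : Fin k → ℕ) (v w : Λ.Vert) :
    Finite {l : Λ.Mor // Λ.d l = m ∧ Λ.r l = v ∧ Λ.s l = w} := finite_of_deg _ fun _ h => h.1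

instance (m : Fin k → ℕ) (v : Λ.Vert) : Finite {l : Λ.Mor // Λ.d l = m ∧ Λ.r l = v} :=
  finite_of_deg _ fun _ h => h.1

noncomputable instance (m : Fin k → ℕ) (v : Λ.Vert) :
    Fintype {l : Λ.Mor // Λ.d l = m ∧ Λ.r l = v} := Fintype.ofFinite _

/-- The factorization property in matrix form: composition is a bijection from composable pairs.
Commutativity of `ℕ^k` then makes all these matrices commute. -/
theorem cnt_add (m n : Fin k → ℕ) : Λ.cnt (m + n) = Λ.cnt m * Λ.cnt n := by
  ext v w
  rw [Matrix.mul_apply]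
  let φ : (Σ u, {l : Λ.Mor // Λ.d l = m ∧ Λ.r l = v ∧ Λ.s l = u} ×
      {l : Λ.Mor // Λ.d l = n ∧ Λ.r l = u ∧ Λ.s l = w}) →
      {l : Λ.Mor // Λ.d l = m + n ∧ Λ.r l = v ∧ Λ.s l = w} := fun p =>
    have h : Λ.s p.2.1.1 = Λ.r p.2.2.1 := p.2.1.2.2.2.trans p.2.2.2.2.1.symm
    ⟨Λ.comp p.2.1.1 p.2.2.1, by rw [Λ.d_comp _ _ h, p.2.1.2.1, p.2.2.2.1],
      by rw [Λ.r_comp _ _ h, p.2.1.2.2.1], by rw [Λ.s_comp _ _ h, p.2.2.2.2.2]⟩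
  have hφ : Function.Bijective φ := by
    constructor
    · rintro ⟨u, ⟨f, hf1, hf2, hf3⟩, ⟨g, hg1, hg2, hg3⟩⟩
        ⟨u', ⟨f', hf1', hf2', hf3'⟩, ⟨g', hg1', hg2', hg3'⟩⟩ h
      have h1 : Λ.comp f g = Λ.comp f' g' := congrArg Subtype.val h
      obtain ⟨rfl, rfl⟩ := comp_inj (hf3.trans hg2.symm) (hf3'.trans hg2'.symm)
        (hf1.trans hf1'.symm) h1
      obtain rfl : u = u' := hf3.symm.trans hf3'
      rfl
    · rintro ⟨l, h1, h2, h3⟩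
      obtain ⟨f, g, hs, hd, rfl⟩ := exists_comp_of_le l (m := m) (by rw [h1]; exact le_self_add)
      have hd' : Λ.d g = n := by
        rw [Λ.d_comp _ _ hs, hd] at h1
        exact add_left_cancel h1
      rw [Λ.r_comp _ _ hs] at h2
      rw [Λ.s_comp _ _ hs] at h3
      exact ⟨⟨Λ.s f, ⟨f, hd, h2, rfl⟩, ⟨g, hd', hs.symm, h3⟩⟩, rfl⟩
  rw [cnt, ← Nat.card_congr (Equiv.ofBijective φ hφ), Nat.card_sigma]
  exact Finset.sum_congr rfl fun u _ => Nat.card_prod _ _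

theorem cnt_commute (m n : Fin k → ℕ) : Commute (Λ.cnt m) (Λ.cnt n) := by
  rw [Commute, SemiconjBy, ← cnt_add, ← cnt_add, add_comm]

/-- A sum over the morphisms of degree `m` and range `v`. -/
theorem sum_mor_eq (m : Fin k → ℕ) (v : Λ.Vert) (f : Λ.Vert → ℝ) :
    ∑ l : {l : Λ.Mor // Λ.d l = m ∧ Λ.r l = v}, f (Λ.s l.1) =
      ((Λ.cnt m).map (Nat.cast : ℕ → ℝ)).mulVec f v := by
  classical
  rw [← Finset.sum_fiberwise_of_maps_to (s := Finset.univ) (t := Finset.univ)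
    (g := fun l : {l : Λ.Mor // Λ.d l = m ∧ Λ.r l = v} => Λ.s l.1) (fun _ _ => Finset.mem_univ _)]
  simp only [Matrix.mulVec, dotProduct, Matrix.map_apply]
  refine Finset.sum_congr rfl fun w _ => ?_
  rw [Finset.sum_congr rfl (g := fun _ => f w)
    (fun l hl => by rw [(Finset.mem_filter.1 hl).2]), Finset.sum_const, nsmul_eq_mul]
  congr 2
  rw [← Fintype.card_subtype, cnt, ← Nat.card_eq_fintype_card]
  refine Nat.card_congr ((Equiv.subtypeSubtypeEquivSubtypeInter
    (fun l : Λ.Mor => Λ.d l = m ∧ Λ.r l = v) (fun l => Λ.s l = w)).trans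
    (Equiv.subtypeEquivRight fun l => and_assoc))

theorem adjProd_eq : Λ.adjProd = Λ.cnt 1 := by
  have h : ∀ L : List (Fin k), (L.map Λ.adj).prod = Λ.cnt (L.map fun i => Pi.single i 1).sum := by
    intro L
    induction L with
    | nil => exact cnt_zero.symm
    | cons i L ih => rw [List.map_cons, List.prod_cons, List.map_cons, List.sum_cons, cnt_add, ih,
        cnt_single]
  rw [adjProd, List.ofFn_eq_map, h, ← List.ofFn_eq_map, List.sum_ofFn]
  congr 1
  ext j
  simp [Finset.sum_apply, Pi.single_apply]

/-! ### The Perron-Frobenius eigenvector -/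

section PerronFrobenius

/-- At a vertex where `x` is minimal, a row sum of at least `2` gives `ρ_i x_v ≥ 2 x_v`. -/
theorem IsPerronFrobenius.rho_pos [Nonempty Λ.Vert] {x : Λ.Vert → ℝ} (hx : Λ.IsPerronFrobenius x)
    (htwo : ∀ (i : Fin k) (v : Λ.Vert), 2 ≤ ∑ w, Λ.adj i v w) (i : Fin k) : 2 ≤ Λ.rho i := by
  obtain ⟨v, -, hv⟩ := Finset.exists_min_image Finset.univ x Finset.univ_nonempty
  have h1 := congrFun (hx.eigen i) v
  simp only [Matrix.mulVec, dotProduct, Matrix.map_apply, Pi.smul_apply, smul_eq_mul] at h1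
  have h2 : (2 : ℝ) * x v ≤ Λ.rho i * x v := by
    rw [← h1]
    calc (2 : ℝ) * x v ≤ (∑ w, (Λ.adj i v w : ℝ)) * x v := by
          refine mul_le_mul_of_nonneg_right ?_ (hx.pos v).le
          exact_mod_cast htwo i v
      _ ≤ _ := by
          rw [Finset.sum_mul]
          exact Finset.sum_le_sum fun w _ =>
            mul_le_mul_of_nonneg_left (hv w (Finset.mem_univ w)) (Nat.cast_nonneg _)
  exact le_of_mul_le_mul_right h2 (hx.pos v)

theorem rhoPow_add (m n : Fin k → ℕ) : Λ.rhoPow (m + n) = Λ.rhoPow m * Λ.rhoPow n := by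
  simp [rhoPow, pow_add, Finset.prod_mul_distrib]

theorem rhoPow_single (i : Fin k) : Λ.rhoPow (Pi.single i 1) = Λ.rho i := by
  rw [rhoPow, Finset.prod_eq_single i]
  · simp
  · intro j _ hj
    simp [hj]
  · simp

theorem rhoPow_zero : Λ.rhoPow 0 = 1 := by simp [rhoPow]

theorem map_cast_mul {n : Type*} [Fintype n] (A B : Matrix n n ℕ) :
    (A * B).map (Nat.cast : ℕ → ℝ) = A.map (Nat.cast : ℕ → ℝ) * B.map (Nat.cast : ℕ → ℝ) :=
  Matrix.map_mul (f := Nat.castRingHom ℝ)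

theorem IsPerronFrobenius.cnt_mulVec {x : Λ.Vert → ℝ} (hx : Λ.IsPerronFrobenius x)
    (m : Fin k → ℕ) : ((Λ.cnt m).map (Nat.cast : ℕ → ℝ)).mulVec x = Λ.rhoPow m • x := by
  have hadd : ∀ m n : Fin k → ℕ, ((Λ.cnt m).map (Nat.cast : ℕ → ℝ)).mulVec x = Λ.rhoPow m • x →
      ((Λ.cnt n).map (Nat.cast : ℕ → ℝ)).mulVec x = Λ.rhoPow n • x →
      ((Λ.cnt (m + n)).map (Nat.cast : ℕ → ℝ)).mulVec x = Λ.rhoPow (m + n) • x := by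
    intro m n h1 h2
    rw [cnt_add, map_cast_mul, ← Matrix.mulVec_mulVec, h2, Matrix.mulVec_smul, h1, smul_smul,
      rhoPow_add, mul_comm]
  have h0 : ((Λ.cnt 0).map (Nat.cast : ℕ → ℝ)).mulVec x = Λ.rhoPow 0 • x := by
    rw [cnt_zero, rhoPow_zero, Matrix.map_one _ Nat.cast_zero Nat.cast_one, Matrix.one_mulVec,
      one_smul]
  have hsum : m = ∑ i, m i • Pi.single i 1 := by
    ext j
    simp [Finset.sum_apply, Pi.single_apply]
  rw [hsum]
  refine Finset.sum_induction _ (fun m : Fin k → ℕ =>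
    ((Λ.cnt m).map (Nat.cast : ℕ → ℝ)).mulVec x = Λ.rhoPow m • x) hadd h0 fun i _ => ?_
  induction m i with
  | zero => simpa using h0
  | succ n ih =>
    rw [succ_nsmul]
    refine hadd _ _ ih ?_
    rw [cnt_single, rhoPow_single]
    exact hx.eigen i

variable [Nonempty Λ.Vert]

/-- The Perron-Frobenius eigenvector exists and is unique. -/
theorem existsUnique_isPerronFrobenius
    (hirr : (Λ.adjProd.map (Nat.cast : ℕ → ℝ)).IsIrreducible) :
    ∃! x, Λ.IsPerronFrobenius x := by
  obtain ⟨t, x, hx, hx1, hAx⟩ := hirr.exists_pos_eigenvector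
  have hex : Λ.IsPerronFrobenius x := by
    refine ⟨hx, hx1, fun i => ?_⟩
    -- `A_i` commutes with `A`, so `A_i x` lies in the one-dimensional eigenspace of `x`. Hence `x`
    -- is an eigenvector of every `A_i`, and its positivity identifies the eigenvalue with the
    -- spectral radius.
    have hcomm : (Λ.adjProd.map (Nat.cast : ℕ → ℝ)).mulVec
        (((Λ.adj i).map (Nat.cast : ℕ → ℝ)).mulVec x) =
        t • ((Λ.adj i).map (Nat.cast : ℕ → ℝ)).mulVec x := by
      rw [Matrix.mulVec_mulVec, adjProd_eq, ← cnt_single, ← map_cast_mul, (cnt_commute _ _).eq,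
        map_cast_mul, ← Matrix.mulVec_mulVec, ← adjProd_eq, hAx, Matrix.mulVec_smul]
    obtain ⟨c, hc⟩ := hirr.eq_smul_of_eigen hx hAx hcomm
    rw [hc, rho, Matrix.spectralRadius_eq_of_pos_eigenvector hx hc]
  refine ⟨x, hex, fun y hy => ?_⟩
  have h1 := hex.cnt_mulVec 1
  have h2 := hy.cnt_mulVec 1
  rw [← adjProd_eq] at h1 h2
  obtain ⟨c, rfl⟩ := hirr.eq_smul_of_eigen hx h1 h2
  have h3 := hy.sum_eq_one
  simp only [Pi.smul_apply, smul_eq_mul, ← Finset.mul_sum, hx1, mul_one] at h3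
  rw [h3, one_smul]

theorem isPerronFrobenius_pf (hirr : (Λ.adjProd.map (Nat.cast : ℕ → ℝ)).IsIrreducible) :
    Λ.IsPerronFrobenius Λ.pf := by
  have h := (existsUnique_isPerronFrobenius hirr).exists
  rw [pf, dif_pos h]
  exact h.choose_spec

end PerronFrobenius

end Finite

/-! ### Infinite paths -/

/-- The initial segment of degree `n` of an infinite path. -/
def InfPath.pre (x : Λ.InfPath) (n : Fin k → ℕ) : Λ.Mor := x.map 0 n (fun _ => Nat.zero_le _)

@[simp] theorem InfPath.d_pre (x : Λ.InfPath) (n : Fin k → ℕ) : Λ.d (x.pre n) = n := by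
  rw [pre, x.d_map, tsub_zero]

@[simp] theorem InfPath.s_pre (x : Λ.InfPath) (n : Fin k → ℕ) : Λ.s (x.pre n) = x.obj n :=
  x.s_map _ _ _

theorem InfPath.pre_comp (x : Λ.InfPath) {m n : Fin k → ℕ} (h : m ≤ n) :
    x.pre n = Λ.comp (x.pre m) (x.map m n h) := x.map_comp 0 m n _ h

theorem mem_cylinder_iff {l : Λ.Mor} {x : Λ.InfPath} : x ∈ Λ.cylinder l ↔ x.pre (Λ.d l) = l :=
  Iff.rfl

theorem InfPath.pre_eq_of_le {x y : Λ.InfPath} {m n : Fin k → ℕ} (h : m ≤ n)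
    (hn : x.pre n = y.pre n) : x.pre m = y.pre m ∧ x.map m n h = y.map m n h := by
  rw [x.pre_comp h, y.pre_comp h] at hn
  exact comp_inj (by rw [s_pre, x.r_map]) (by rw [s_pre, y.r_map]) (by simp) hn

theorem InfPath.ext_of_cofinal {x y : Λ.InfPath}
    (h : ∀ m, ∃ n, m ≤ n ∧ x.pre n = y.pre n) : x = y := by
  have hpre : ∀ m, x.pre m = y.pre m := fun m =>
    let ⟨_, hmn, hn⟩ := h m
    (pre_eq_of_le hmn hn).1
  refine InfPath.ext (funext fun m => ?_) ?_
  · rw [← s_pre, ← s_pre, hpre]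
  · funext m n hmn
    exact (pre_eq_of_le hmn (hpre n)).2

/-- An increasing sequence of morphisms with cofinal degrees determines an infinite path. -/
theorem exists_infPath {l a : ℕ → Λ.Mor} (hs : ∀ j, Λ.s (l j) = Λ.r (a j))
    (hl : ∀ j, l (j + 1) = Λ.comp (l j) (a j)) (hcof : ∀ n, ∃ j, n ≤ Λ.d (l j)) :
    ∃ x : Λ.InfPath, ∀ j, x.pre (Λ.d (l j)) = l j := by
  have hpre : ∀ i j, i ≤ j → ∃ g, Λ.s (l i) = Λ.r g ∧ Λ.comp (l i) g = l j := by
    intro i j hij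
    induction hij with
    | refl => exact ⟨Λ.one (Λ.s (l i)), (Λ.r_one _).symm, Λ.comp_one _⟩
    | @step j _ ih =>
      obtain ⟨g, hg, hgl⟩ := ih
      have h1 : Λ.s g = Λ.r (a j) := by rw [← hs, ← hgl, Λ.s_comp _ _ hg]
      exact ⟨Λ.comp g (a j), by rw [Λ.r_comp _ _ h1, hg], by rw [← Λ.assoc _ _ _ hg h1, hgl, hl]⟩
  -- `f n` is the initial segment of degree `n` of some `l j` of large enough degree. By unique
  -- factorization it is an initial segment of all later ones too.
  choose J hJ using hcof
  choose f g hfg hdf hfl using fun n => exists_comp_of_le (l (J n)) (hJ n)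
  have hfpre : ∀ n j, J n ≤ j → ∃ b, Λ.s (f n) = Λ.r b ∧ Λ.comp (f n) b = l j := by
    intro n j hj
    obtain ⟨b, hb, hbl⟩ := hpre _ _ hj
    have h1 : Λ.s (g n) = Λ.r b := by rw [← hb, ← hfl, Λ.s_comp _ _ (hfg n)]
    exact ⟨Λ.comp (g n) b, by rw [Λ.r_comp _ _ h1, hfg],
      by rw [← Λ.assoc _ _ _ (hfg n) h1, hfl, hbl]⟩
  have hstep : ∀ m n, m ≤ n → ∃ b, Λ.s (f m) = Λ.r b ∧ Λ.comp (f m) b = f n := by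
    intro m n hmn
    obtain ⟨b, hb, hbl⟩ := hfpre m _ (le_max_left (J m) (J n))
    obtain ⟨c, hc, hcl⟩ := hfpre n _ (le_max_right (J m) (J n))
    obtain ⟨p, q, hpq, hdp, hpf⟩ := exists_comp_of_le (f n) (m := m) (by rw [hdf]; exact hmn)
    have h1 : Λ.s q = Λ.r c := by rw [← hc, ← hpf, Λ.s_comp _ _ hpq]
    have h2 : Λ.comp p (Λ.comp q c) = Λ.comp (f m) b := by
      rw [← Λ.assoc _ _ _ hpq h1, hpf, hcl, hbl]
    obtain ⟨rfl, -⟩ := comp_inj (by rw [Λ.r_comp _ _ h1, hpq]) hb (by rw [hdp, hdf]) h2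
    exact ⟨q, hpq, hpf⟩
  -- The quotient of `f n` by `f m` is the segment from `m` to `n`; left cancellation gives the
  -- functor laws.
  choose b hb hbf using hstep
  have hsb : ∀ m n h, Λ.s (b m n h) = Λ.s (f n) := fun m n h => by
    rw [← hbf m n h, Λ.s_comp _ _ (hb m n h)]
  let x : Λ.InfPath :=
    { obj := fun n => Λ.s (f n)
      map := b
      r_map := fun m n h => (hb m n h).symm
      s_map := hsb
      d_map := fun m n h => by
        have h1 := congrArg Λ.d (hbf m n h)
        rw [Λ.d_comp _ _ (hb m n h), hdf, hdf] at h1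
        exact (tsub_eq_of_eq_add_rev h1.symm).symm
      map_self := fun m => comp_left_cancel (hb m m le_rfl) (Λ.r_one _).symm
        (by rw [hbf, Λ.comp_one])
      map_comp := fun l m n h h' => by
        have h1 : Λ.s (b l m h) = Λ.r (b m n h') := by rw [hsb, hb]
        refine comp_left_cancel (hb l n _) (by rw [Λ.r_comp _ _ h1, hb]) ?_
        rw [hbf, ← Λ.assoc _ _ _ (hb l m h) h1, hbf, hbf] }
  have hx : ∀ n, x.pre n = f n := by
    intro n
    have h1 : f 0 = Λ.one (Λ.r (x.pre n)) := by
      rw [eq_one_of_d_eq_zero (hdf 0)]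
      exact congrArg _ (hb 0 n _)
    have h2 : Λ.comp (f 0) (x.pre n) = f n := hbf 0 n _
    rwa [h1, Λ.one_comp] at h2
  refine ⟨x, fun j => ?_⟩
  rw [hx]
  obtain ⟨c, hc, hcl⟩ := hfpre (Λ.d (l j)) _ (le_max_left (J (Λ.d (l j))) j)
  obtain ⟨c', hc', hcl'⟩ := hpre j _ (le_max_right (J (Λ.d (l j))) j)
  exact (comp_inj hc hc' (hdf _) (hcl.trans hcl'.symm)).1

/-! ### The homeomorphism between the two infinite path spaces -/

section Rainbow

theorem rainbowDeg_zero : rainbowDeg k 0 = 0 := by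
  ext i
  simp [rainbowDeg]

variable [NeZero k]

theorem rainbowDeg_mono : Monotone (rainbowDeg k) :=
  monotone_nat_of_le_succ fun n => by rw [rainbowDeg_succ]; exact le_self_add

theorem rainbowDeg_add_period (n : ℕ) : rainbowDeg k (n + k) = rainbowDeg k n + 1 := by
  ext i
  simp only [rainbowDeg, Pi.add_apply, Pi.one_apply,
    Nat.add_div_right n (Nat.pos_of_ne_zero (NeZero.ne k)), Nat.add_mod_right]
  omega

theorem exists_le_rainbowDeg (m : Fin k → ℕ) : ∃ n, m ≤ rainbowDeg k n := by
  refine ⟨(Finset.univ.sup m) * k, fun i => ?_⟩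
  rw [rainbowDeg, Nat.mul_div_cancel _ (Nat.pos_of_ne_zero (NeZero.ne k))]
  exact (Finset.le_sup (Finset.mem_univ i)).trans le_self_add

/-- Every cylinder set contains an infinite path. -/
theorem cylinder_nonempty (h : ∀ (i : Fin k) (v : Λ.Vert), ∃ e, Λ.d e = Pi.single i 1 ∧ Λ.r e = v)
    (l : Λ.Mor) : (Λ.cylinder l).Nonempty := by
  choose e hde hre using h
  let L : ℕ → Λ.Mor := fun j => Nat.rec l (fun j f => Λ.comp f (e (color k j) (Λ.s f))) j
  have hL : ∀ j, L (j + 1) = Λ.comp (L j) (e (color k j) (Λ.s (L j))) := fun _ => rfl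
  have hd : ∀ j, Λ.d (L j) = Λ.d l + rainbowDeg k j := by
    intro j
    induction j with
    | zero => rw [rainbowDeg_zero, add_zero]; rfl
    | succ j ih => rw [hL, Λ.d_comp _ _ (hre _ _).symm, ih, hde, rainbowDeg_succ, add_assoc]
  obtain ⟨x, hx⟩ := exists_infPath (l := L) (fun j => (hre _ _).symm) hL fun n =>
    let ⟨j, hj⟩ := exists_le_rainbowDeg n
    ⟨j, by rw [hd]; exact hj.trans le_add_self⟩
  exact ⟨x, hx 0⟩

variable [Λ.IsFinite]

theorem vtx_toBratteli (x : Λ.InfPath) (n : ℕ) :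
    (Λ.toBratteli x).vtx n = x.obj (rainbowDeg k n) := by
  rw [← BratteliDiagram.PathSpace.r_edge]
  exact x.r_map _ _ _

/-- The first `n` edges and the initial morphism of degree `rainbowDeg k n` determine each other by
unique factorization. -/
theorem takeN_toBratteli_eq_iff {x y : Λ.InfPath} {n : ℕ} :
    (Λ.toBratteli x).takeN n = (Λ.toBratteli y).takeN n ↔
      x.pre (rainbowDeg k n) = y.pre (rainbowDeg k n) := by
  induction n with
  | zero =>
    have hpre : ∀ x : Λ.InfPath, x.pre (rainbowDeg k 0) = Λ.one (x.obj (rainbowDeg k 0)) := by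
      intro x
      rw [← InfPath.s_pre]
      exact eq_one_of_d_eq_zero (by rw [InfPath.d_pre, rainbowDeg_zero])
    rw [BratteliDiagram.PathSpace.takeN_zero_eq_iff, hpre, hpre, one_injective.eq_iff,
      ← vtx_toBratteli, ← vtx_toBratteli]
    exact Iff.rfl
  | succ n ih =>
    have hle : rainbowDeg k n ≤ rainbowDeg k (n + 1) := rainbowDeg_mono (Nat.le_succ n)
    rw [BratteliDiagram.PathSpace.takeN_succ_eq_iff, ih]
    constructor
    · rintro ⟨h1, h2⟩
      have h3 : x.map _ _ hle = y.map _ _ hle := congrArg Subtype.val h2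
      rw [x.pre_comp hle, y.pre_comp hle, h1, h3]
    · intro h
      obtain ⟨h1, h2⟩ := InfPath.pre_eq_of_le hle h
      exact ⟨h1, Subtype.ext h2⟩

theorem toBratteli_injective : Function.Injective Λ.toBratteli := fun x y h =>
  InfPath.ext_of_cofinal fun m =>
    let ⟨n, hn⟩ := exists_le_rainbowDeg m
    ⟨_, hn, takeN_toBratteli_eq_iff.1 (by rw [h])⟩

/-- The composites of the first `j` edges form an increasing sequence of morphisms whose degrees are
cofinal, so `exists_infPath` supplies the preimage. -/
theorem toBratteli_surjective : Function.Surjective Λ.toBratteli := by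
  intro y
  let a : ℕ → Λ.Mor := fun j => (y.edge j).1
  have ha : ∀ j, Λ.s (a j) = Λ.r (a (j + 1)) := y.compat
  let l : ℕ → Λ.Mor := fun j => Nat.rec (Λ.one (Λ.r (a 0))) (fun j f => Λ.comp f (a j)) j
  have hl : ∀ j, l (j + 1) = Λ.comp (l j) (a j) := fun _ => rfl
  have hs : ∀ j, Λ.s (l j) = Λ.r (a j) := by
    intro j
    induction j with
    | zero => exact Λ.s_one _
    | succ j ih => rw [hl, Λ.s_comp _ _ ih, ha]
  have hd : ∀ j, Λ.d (l j) = rainbowDeg k j := by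
    intro j
    induction j with
    | zero => rw [rainbowDeg_zero]; exact Λ.d_one _
    | succ j ih => rw [hl, Λ.d_comp _ _ (hs j), ih, rainbowDeg_succ]; exact congrArg _ (y.edge j).2
  obtain ⟨x, hx⟩ := exists_infPath hs hl fun n => by
    simp_rw [hd]
    exact exists_le_rainbowDeg n
  simp_rw [hd] at hx
  refine ⟨x, BratteliDiagram.PathSpace.ext (funext fun j => Subtype.ext ?_)⟩
  have hle : rainbowDeg k j ≤ rainbowDeg k (j + 1) := rainbowDeg_mono (Nat.le_succ j)
  change x.map _ _ hle = a j
  have h1 := x.pre_comp hle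
  rw [hx, hx, hl] at h1
  refine (comp_left_cancel (hs j) ?_ h1).symm
  rw [x.r_map, ← InfPath.s_pre, hx]

theorem preimage_cylinder_take (x : Λ.InfPath) (n : ℕ) :
    Λ.toBratteli ⁻¹' ((Λ.toBratteli x).take n).cylinder =
      Λ.cylinder (x.pre (rainbowDeg k n)) := by
  ext y
  rw [Set.mem_preimage, BratteliDiagram.FinPath.mem_cylinder_iff, mem_cylinder_iff,
    InfPath.d_pre]
  exact takeN_toBratteli_eq_iff

theorem isInducing_toBratteli : IsInducing Λ.toBratteli := by
  refine ⟨le_antisymm (continuous_iff_le_induced.1 (continuous_generateFrom_iff.2 ?_))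
    (le_generateFrom ?_)⟩
  · rintro _ ⟨γ, rfl⟩
    by_cases hne : (Λ.toBratteli ⁻¹' γ.cylinder).Nonempty
    · obtain ⟨x, hx⟩ := hne
      have h := (BratteliDiagram.FinPath.mem_cylinder_iff _ _).1 hx
      have h2 : γ = (Λ.toBratteli x).take γ.1 := Sigma.ext rfl (heq_of_eq h.symm)
      rw [h2, preimage_cylinder_take]
      exact TopologicalSpace.isOpen_generateFrom_of_mem ⟨_, rfl⟩
    · rw [Set.not_nonempty_iff_eq_empty.1 hne]
      exact isOpen_empty
  -- A cylinder of arbitrary degree is decided by the first `N` edges once `rainbowDeg k N`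
  -- dominates that degree.
  · rintro _ ⟨l, rfl⟩
    obtain ⟨N, hN⟩ := exists_le_rainbowDeg (Λ.d l)
    refine isOpen_induced_iff.2 ⟨_, (BratteliDiagram.PathSpace.isClopen_takeN_preimage
      ((fun x => (Λ.toBratteli x).takeN N) '' Λ.cylinder l)).2, ?_⟩
    ext x
    refine ⟨?_, fun hx => ⟨x, hx, rfl⟩⟩
    rintro ⟨y, hy, hxy⟩
    rw [mem_cylinder_iff] at hy ⊢
    rw [← (InfPath.pre_eq_of_le hN (takeN_toBratteli_eq_iff.1 hxy)).1, hy]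

variable (Λ) in
/-- The homeomorphism between the infinite path spaces. -/
noncomputable def bratteliHomeomorph : Λ.InfPath ≃ₜ Λ.bratteli.PathSpace :=
  (Equiv.ofBijective Λ.toBratteli ⟨toBratteli_injective, toBratteli_surjective⟩).toHomeomorphOfIsInducing
    isInducing_toBratteli

theorem isHomeomorph_toBratteli : IsHomeomorph Λ.toBratteli := Λ.bratteliHomeomorph.isHomeomorph

end Rainbow

end KGraph

namespace KGraph

variable {k : ℕ} {Λ : KGraph.{u} k}

theorem measurableSet_cylinder (l : Λ.Mor) : MeasurableSet (Λ.cylinder l) :=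
  (TopologicalSpace.isOpen_generateFrom_of_mem ⟨l, rfl⟩ : IsOpen (Λ.cylinder l)).measurableSet

variable [Λ.IsFinite]

/-! ### Normalized adjacency matrices -/

variable (Λ) in
/-- The matrix of the numbers of morphisms of degree `m`, divided by `ρ(Λ)^m`. -/
noncomputable def normCnt (m : Fin k → ℕ) : Matrix Λ.Vert Λ.Vert ℝ :=
  (Λ.rhoPow m)⁻¹ • (Λ.cnt m).map (Nat.cast : ℕ → ℝ)

theorem normCnt_add (m n : Fin k → ℕ) : Λ.normCnt (m + n) = Λ.normCnt m * Λ.normCnt n := by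
  rw [normCnt, cnt_add, rhoPow_add, map_cast_mul, normCnt, normCnt, Matrix.smul_mul,
    Matrix.mul_smul, smul_smul, mul_inv]

/-- The standing assumptions on the eigenvalues and on the eigenvector `x^Λ`. -/
structure IsRegular (Λ : KGraph.{u} k) [Λ.IsFinite] : Prop where
  pf : Λ.IsPerronFrobenius Λ.pf
  two_le_rho : ∀ i, 2 ≤ Λ.rho i
  two_le_adj : ∀ i v, 2 ≤ ∑ w, Λ.adj i v w
  eigenspace : ∀ y : Λ.Vert → ℝ, ((Λ.cnt 1).map (Nat.cast : ℕ → ℝ)).mulVec y = Λ.rhoPow 1 • y →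
    ∃ c : ℝ, y = c • Λ.pf

theorem isRegular [Nonempty Λ.Vert] (htwo : ∀ (i : Fin k) (v : Λ.Vert), 2 ≤ ∑ w, Λ.adj i v w)
    (hirr : (Λ.adjProd.map (Nat.cast : ℕ → ℝ)).IsIrreducible) : Λ.IsRegular where
  pf := isPerronFrobenius_pf hirr
  two_le_rho := (isPerronFrobenius_pf hirr).rho_pos htwo
  two_le_adj := htwo
  eigenspace y hy := by
    have h := (isPerronFrobenius_pf hirr).cnt_mulVec 1
    rw [← adjProd_eq] at hy h
    exact hirr.eq_smul_of_eigen (isPerronFrobenius_pf hirr).pos h hy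

namespace IsRegular

variable (hΛ : Λ.IsRegular)

include hΛ

theorem one_le_rhoPow (m : Fin k → ℕ) : 1 ≤ Λ.rhoPow m :=
  Finset.prod_const_one.symm.le.trans (Finset.prod_le_prod (fun _ _ => zero_le_one) fun i _ =>
    one_le_pow₀ (by linarith [hΛ.two_le_rho i]))

theorem rhoPow_pos (m : Fin k → ℕ) : 0 < Λ.rhoPow m := by linarith [hΛ.one_le_rhoPow m]

theorem one_lt_rhoPow_one [NeZero k] : 1 < Λ.rhoPow 1 := by
  have h : ∏ _i : Fin k, (1 : ℝ) < ∏ i, Λ.rho i ^ (1 : Fin k → ℕ) i := by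
    refine Finset.prod_lt_prod_of_nonempty (fun _ _ => one_pos) (fun i _ => ?_)
      Finset.univ_nonempty
    rw [Pi.one_apply, pow_one]
    linarith [hΛ.two_le_rho i]
  simpa [rhoPow] using h

theorem normCnt_nonneg (m : Fin k → ℕ) (v w : Λ.Vert) : 0 ≤ Λ.normCnt m v w :=
  mul_nonneg (inv_nonneg.2 (hΛ.rhoPow_pos m).le) (Nat.cast_nonneg _)

theorem normCnt_mulVec (m : Fin k → ℕ) : (Λ.normCnt m).mulVec Λ.pf = Λ.pf := by
  rw [normCnt, Matrix.smul_mulVec, hΛ.pf.cnt_mulVec, smul_smul,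
    inv_mul_cancel₀ (hΛ.rhoPow_pos m).ne', one_smul]

/-- The bound is uniform in `m`, which makes the Abel sums converge for every `ε > 0`. -/
theorem normCnt_le (m : Fin k → ℕ) (v w : Λ.Vert) :
    Λ.normCnt m v w ≤ Λ.pf v / Λ.pf w := by
  rw [le_div_iff₀ (hΛ.pf.pos w)]
  have h := congrFun (hΛ.normCnt_mulVec m) v
  rw [← h]
  exact Finset.single_le_sum (f := fun w => Λ.normCnt m v w * Λ.pf w)
    (fun w _ => mul_nonneg (hΛ.normCnt_nonneg m v w) (hΛ.pf.pos w).le) (Finset.mem_univ w)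

theorem pf_le_one (v : Λ.Vert) : Λ.pf v ≤ 1 := by
  rw [← hΛ.pf.sum_eq_one]
  exact Finset.single_le_sum (fun w _ => (hΛ.pf.pos w).le) (Finset.mem_univ v)

theorem exists_pair (i : Fin k) (v : Λ.Vert) :
    ∃ e e' : {l : Λ.Mor // Λ.d l = Pi.single i 1 ∧ Λ.r l = v}, e ≠ e' := by
  rw [← Fintype.one_lt_card_iff]
  have h := sum_mor_eq (Pi.single i 1) v (fun _ => (1 : ℝ))
  simp only [Finset.sum_const, Finset.card_univ, nsmul_eq_mul, mul_one, Matrix.mulVec,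
    dotProduct, Matrix.map_apply, cnt_single] at h
  have h2 := hΛ.two_le_adj i v
  have h3 : Fintype.card {l : Λ.Mor // Λ.d l = Pi.single i 1 ∧ Λ.r l = v} =
    ∑ w, Λ.adj i v w := by exact_mod_cast h
  omega

theorem exists_edge (i : Fin k) (v : Λ.Vert) : ∃ e, Λ.d e = Pi.single i 1 ∧ Λ.r e = v :=
  let ⟨e, _⟩ := hΛ.exists_pair i v
  ⟨e.1, e.2⟩

end IsRegular

section Rainbow

variable [NeZero k]

/-! ### Sums over paths and the weight -/

/-- The source of a finite path, as a vertex of `Λ`. -/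
def src {n : ℕ} (g : Λ.bratteli.PathN n) : Λ.Vert := g.1

theorem sum_edge_eq {n : ℕ} (g : Λ.bratteli.PathN n) (f : Λ.Vert → ℝ) :
    ∑ e, f (src (g.snoc e)) =
      ((Λ.cnt (Pi.single (color k n) 1)).map (Nat.cast : ℕ → ℝ)).mulVec f (src g) := by
  rw [← sum_mor_eq]
  let φ : {e : Λ.bratteli.E n // Λ.bratteli.r e = g.1} ≃
      {l : Λ.Mor // Λ.d l = Pi.single (color k n) 1 ∧ Λ.r l = src g} :=
    { toFun := fun e => ⟨e.1.1, e.1.2, e.2⟩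
      invFun := fun l => ⟨⟨l.1, l.2.1⟩, l.2.2⟩
      left_inv := fun _ => rfl
      right_inv := fun _ => rfl }
  exact Fintype.sum_equiv φ _ _ fun _ => rfl

theorem rainbowDeg_sub_succ (N q : ℕ) :
    rainbowDeg k (N + (q + 1)) - rainbowDeg k N =
      rainbowDeg k (N + q) - rainbowDeg k N + Pi.single (color k (N + q)) 1 := by
  rw [← add_assoc, rainbowDeg_succ, tsub_add_eq_add_tsub (rainbowDeg_mono (Nat.le_add_right N q))]

/-- Extensions of `g` by `q` edges correspond to morphisms of range `src g` whose degree is the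
difference of the rainbow degrees. The induction removes the last edge. -/
theorem sum_liftSet_eq {N : ℕ} (S : Set (Λ.bratteli.PathN N)) (q : ℕ) (f : Λ.Vert → ℝ) :
    ∑ g, (BratteliDiagram.liftSet S q).indicator (fun g => f (src g)) g =
      ∑ g, S.indicator (fun g => ((Λ.cnt (rainbowDeg k (N + q) - rainbowDeg k N)).map
        (Nat.cast : ℕ → ℝ)).mulVec f (src g)) g := by
  induction q generalizing f with
  | zero =>
    have h : rainbowDeg k (N + 0) - rainbowDeg k N = 0 := by simp
    rw [h, cnt_zero, Matrix.map_one _ Nat.cast_zero Nat.cast_one]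
    simp_rw [Matrix.one_mulVec]
    rfl
  | succ q ih =>
    refine (BratteliDiagram.sum_indicator_preimage_init (BratteliDiagram.liftSet S q)
      fun g => f (src g)).trans ?_
    have h : ∀ g : Λ.bratteli.PathN (N + q), ∑ e, f (src (g.snoc e)) =
        ((Λ.cnt (Pi.single (color k (N + q)) 1)).map (Nat.cast : ℕ → ℝ)).mulVec f (src g) :=
      fun g => sum_edge_eq g f
    simp_rw [h]
    rw [ih]
    simp_rw [Matrix.mulVec_mulVec]
    rw [← map_cast_mul, ← cnt_add, rainbowDeg_sub_succ]

namespace IsRegular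

variable (hΛ : Λ.IsRegular)

include hΛ

theorem exists_edge_pair (n : ℕ) (v : Λ.bratteli.V n) :
    ∃ e e' : Λ.bratteli.E n, e ≠ e' ∧ Λ.bratteli.r e = v ∧ Λ.bratteli.r e' = v := by
  obtain ⟨e, e', h⟩ := hΛ.exists_pair (color k n) v
  exact ⟨⟨e.1, e.2.1⟩, ⟨e'.1, e'.2.1⟩, fun h' => h (Subtype.ext (Subtype.mk.inj h')),
    e.2.2, e'.2.2⟩

theorem weight_pos (δ : ℝ) (γ : Λ.bratteli.FinPath) : 0 < Λ.weight δ γ :=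
  mul_pos (Real.rpow_pos_of_pos (hΛ.rhoPow_pos _) _) (hΛ.pf.pos _)

theorem weight_le_one {δ : ℝ} (hδ : 0 < δ) (γ : Λ.bratteli.FinPath) : Λ.weight δ γ ≤ 1 :=
  mul_le_one₀ (Real.rpow_le_one_of_one_le_of_nonpos (hΛ.one_le_rhoPow _)
    (neg_nonpos.2 (one_div_pos.2 hδ).le)) (hΛ.pf.pos _).le (hΛ.pf_le_one _)

/-- An edge of colour `i` raises `x` by at most the factor `ρ_i`, and `ρ_i^{-1/δ} ≤ ρ_i^{-1}`
compensates because `δ < 1`. -/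
theorem weight_snoc_le {δ : ℝ} (hδ : 0 < δ) (hδ1 : δ < 1) (n : ℕ) (g : Λ.bratteli.PathN n)
    (e : {e : Λ.bratteli.E n // Λ.bratteli.r e = g.1}) :
    Λ.weight δ ⟨n + 1, g.snoc e⟩ ≤ Λ.weight δ ⟨n, g⟩ := by
  set i := color k n
  have hρ : 0 < Λ.rho i := by linarith [hΛ.two_le_rho i]
  have h1 : Λ.pf (src (g.snoc e)) ≤ Λ.rho i * Λ.pf (src g) := by
    have h := sum_edge_eq g Λ.pf
    rw [hΛ.pf.cnt_mulVec, rhoPow_single, Pi.smul_apply, smul_eq_mul] at h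
    rw [← h]
    exact Finset.single_le_sum (f := fun e => Λ.pf (src (g.snoc e)))
      (fun _ _ => (hΛ.pf.pos _).le) (Finset.mem_univ e)
  have h2 : Λ.rho i ^ (-(1 / δ)) ≤ (Λ.rho i)⁻¹ := by
    rw [← Real.rpow_neg_one]
    refine Real.rpow_le_rpow_of_exponent_le (by linarith [hΛ.two_le_rho i]) (neg_le_neg ?_)
    rw [le_div_iff₀ hδ]
    linarith
  have h3 : Λ.rho i ^ (-(1 / δ)) * Λ.pf (src (g.snoc e)) ≤ Λ.pf (src g) := by
    calc Λ.rho i ^ (-(1 / δ)) * Λ.pf (src (g.snoc e)) ≤ (Λ.rho i)⁻¹ * (Λ.rho i * Λ.pf (src g)) :=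
          mul_le_mul h2 h1 (hΛ.pf.pos _).le (inv_nonneg.2 hρ.le)
      _ = Λ.pf (src g) := inv_mul_cancel_left₀ hρ.ne' _
  change Λ.rhoPow (rainbowDeg k (n + 1)) ^ (-(1 / δ)) * Λ.pf (src (g.snoc e)) ≤
    Λ.rhoPow (rainbowDeg k n) ^ (-(1 / δ)) * Λ.pf (src g)
  rw [rainbowDeg_succ, rhoPow_add, rhoPow_single,
    Real.mul_rpow (hΛ.rhoPow_pos _).le hρ.le, mul_assoc]
  exact mul_le_mul_of_nonneg_left h3 (Real.rpow_nonneg (hΛ.rhoPow_pos _).le _)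

theorem cylDiam_weight [Nonempty Λ.Vert] {δ : ℝ} (hδ : 0 < δ) (hδ1 : δ < 1)
    (γ : Λ.bratteli.FinPath) :
    BratteliDiagram.cylDiam (Λ.weight δ) γ = Λ.weight δ γ :=
  have : ∀ j, Nonempty (Λ.bratteli.V j) := fun _ => ‹Nonempty Λ.Vert›
  BratteliDiagram.cylDiam_eq hΛ.exists_edge_pair (fun γ => (hΛ.weight_pos δ γ).le)
    (hΛ.weight_snoc_le hδ hδ1) γ

theorem nonempty_choiceFunction [Nonempty Λ.Vert] {δ : ℝ} (hδ : 0 < δ) (hδ1 : δ < 1) :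
    Nonempty (BratteliDiagram.ChoiceFunction (Λ.weight δ)) :=
  have : ∀ j, Nonempty (Λ.bratteli.V j) := fun _ => ‹Nonempty Λ.Vert›
  BratteliDiagram.nonempty_choiceFunction hΛ.exists_edge_pair (fun γ => (hΛ.weight_pos δ γ).le)
    (hΛ.weight_snoc_le hδ hδ1)

/-- The exponent `-1/δ` in the weight is chosen so that `δ` cancels here; it survives only on the
eigenvector, where it affects the total mass and nothing else. -/
theorem weight_rpow {δ : ℝ} (hδ : 0 < δ) (s : ℝ) (γ : Λ.bratteli.FinPath) :
    Λ.weight δ γ ^ (δ * s) = Λ.rhoPow (rainbowDeg k γ.1) ^ (-s) * Λ.pf (src γ.2) ^ (δ * s) := by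
  obtain ⟨n, g⟩ := γ
  change (Λ.rhoPow (rainbowDeg k n) ^ (-(1 / δ)) * Λ.pf (src g)) ^ (δ * s) =
    Λ.rhoPow (rainbowDeg k n) ^ (-s) * Λ.pf (src g) ^ (δ * s)
  rw [Real.mul_rpow (Real.rpow_nonneg (hΛ.rhoPow_pos _).le _) (hΛ.pf.pos _).le,
    ← Real.rpow_mul (hΛ.rhoPow_pos _).le]
  congr 2
  field_simp

/-! ### The an Huef-Laca-Raeburn-Sims measure -/

/-- Consistency is the eigenvector equation for the colour of the added edge, and the total mass is
`∑ x_v = 1`. -/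
theorem exists_path_measure [Nonempty Λ.Vert] :
    ∃ μ : Measure Λ.bratteli.PathSpace, IsProbabilityMeasure μ ∧
      ∀ γ : Λ.bratteli.FinPath, μ γ.cylinder =
        ENNReal.ofReal ((Λ.rhoPow (rainbowDeg k γ.1))⁻¹ * Λ.pf (src γ.2)) := by
  have : ∀ j, Nonempty (Λ.bratteli.V j) := fun _ => ‹Nonempty Λ.Vert›
  have hnn : ∀ (m : Fin k → ℕ) v, 0 ≤ (Λ.rhoPow m)⁻¹ * Λ.pf v := fun m v =>
    mul_nonneg (inv_nonneg.2 (hΛ.rhoPow_pos m).le) (hΛ.pf.pos v).le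
  refine BratteliDiagram.exists_probabilityMeasure
    (p := fun γ => ENNReal.ofReal ((Λ.rhoPow (rainbowDeg k γ.1))⁻¹ * Λ.pf (src γ.2)))
    (BratteliDiagram.FinPath.cylinder_nonempty fun n v =>
      let ⟨e, _, _, he, _⟩ := hΛ.exists_edge_pair n v
      ⟨e, he⟩) ?_ fun n g => ?_
  · rw [← ENNReal.ofReal_sum_of_nonneg fun g _ => hnn _ _, ← ENNReal.ofReal_one,
      ← hΛ.pf.sum_eq_one]
    congr 1
    simp_rw [rainbowDeg_zero, rhoPow_zero, inv_one, one_mul]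
    let φ : Λ.bratteli.PathN 0 ≃ Λ.Vert := BratteliDiagram.pathZeroEquiv
    exact Fintype.sum_equiv φ _ _ fun g => rfl
  · have h : ∑ e, Λ.pf (src (g.snoc e)) = Λ.rho (color k n) * Λ.pf (src g) := by
      rw [sum_edge_eq g Λ.pf, hΛ.pf.cnt_mulVec, rhoPow_single, Pi.smul_apply, smul_eq_mul]
    have hρ : Λ.rho (color k n) ≠ 0 := by linarith [hΛ.two_le_rho (color k n)]
    rw [← ENNReal.ofReal_sum_of_nonneg fun e _ => hnn _ _]
    dsimp only
    rw [← Finset.mul_sum, h, rainbowDeg_succ, rhoPow_add, rhoPow_single, mul_inv, mul_assoc,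
      inv_mul_cancel_left₀ hρ]

/-- A measure on `Λ^∞` is the an Huef-Laca-Raeburn-Sims measure if its image on the path space
has the right values on cylinder sets. -/
theorem isAHLRSMeasure_iff (M : Measure Λ.InfPath) :
    Λ.IsAHLRSMeasure M ↔ ∀ γ : Λ.bratteli.FinPath, M.map Λ.toBratteli γ.cylinder =
        ENNReal.ofReal ((Λ.rhoPow (rainbowDeg k γ.1))⁻¹ * Λ.pf (src γ.2)) := by
  have hmeas : Measurable Λ.toBratteli := isHomeomorph_toBratteli.continuous.measurable
  have hmap : ∀ γ : Λ.bratteli.FinPath, M.map Λ.toBratteli γ.cylinder =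
      M (Λ.toBratteli ⁻¹' γ.cylinder) := fun γ =>
    Measure.map_apply hmeas (BratteliDiagram.FinPath.isClopen_cylinder γ).2.measurableSet
  simp_rw [hmap]
  have hnn : ∀ (m : Fin k → ℕ) v, 0 ≤ (Λ.rhoPow m)⁻¹ * Λ.pf v := fun m v =>
    mul_nonneg (inv_nonneg.2 (hΛ.rhoPow_pos m).le) (hΛ.pf.pos v).le
  constructor
  · intro hM γ
    have hne : (BratteliDiagram.FinPath.cylinder γ).Nonempty := by
      have : ∀ j, Nonempty (Λ.bratteli.V j) := fun j => by
        obtain ⟨n, v, -⟩ := γ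
        exact ⟨(v : Λ.Vert)⟩
      exact BratteliDiagram.FinPath.cylinder_nonempty (fun n v =>
        let ⟨e, _, _, he, _⟩ := hΛ.exists_edge_pair n v
        ⟨e, he⟩) γ
    obtain ⟨y, hy⟩ := hne
    obtain ⟨x, rfl⟩ := toBratteli_surjective y
    obtain ⟨n, g⟩ := γ
    obtain rfl : (Λ.toBratteli x).takeN n = g :=
      (BratteliDiagram.FinPath.mem_cylinder_iff _ _).1 hy
    change M (Λ.toBratteli ⁻¹' ((Λ.toBratteli x).take n).cylinder) = _
    rw [preimage_cylinder_take, hM, InfPath.d_pre, InfPath.s_pre, ← vtx_toBratteli]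
    rfl
  · intro hM l
    have hrb : ∀ (l : Λ.Mor) n, Λ.d l = rainbowDeg k n →
        M (Λ.cylinder l) = ENNReal.ofReal ((Λ.rhoPow (rainbowDeg k n))⁻¹ * Λ.pf (Λ.s l)) := by
      intro l n hl
      obtain ⟨x, hx⟩ := cylinder_nonempty hΛ.exists_edge l
      rw [mem_cylinder_iff, hl] at hx
      have h := hM ((Λ.toBratteli x).take n)
      rw [preimage_cylinder_take, hx] at h
      rw [h, ← hx, InfPath.s_pre, ← vtx_toBratteli]
      rfl
    -- For general `l`, the cylinder is the disjoint union of those of its extensions to a rainbow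
    -- degree, and the eigenvector equation for degree `m` sums their masses.
    obtain ⟨N, hN⟩ := exists_le_rainbowDeg (Λ.d l)
    set m := rainbowDeg k N - Λ.d l with hm
    have hmN : Λ.d l + m = rainbowDeg k N := add_tsub_cancel_of_le hN
    have hunion : Λ.cylinder l = ⋃ b : {b : Λ.Mor // Λ.d b = m ∧ Λ.r b = Λ.s l},
        Λ.cylinder (Λ.comp l b.1) := by
      ext x
      rw [Set.mem_iUnion, mem_cylinder_iff]
      constructor
      · intro hx
        have h1 := x.pre_comp hN
        rw [hx] at h1
        have h2 : Λ.r (x.map _ _ hN) = Λ.s l := by rw [x.r_map, ← InfPath.s_pre, hx]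
        refine ⟨⟨x.map _ _ hN, x.d_map _ _ _, h2⟩, ?_⟩
        rw [mem_cylinder_iff, ← h1, InfPath.d_pre]
      · rintro ⟨⟨b, hb1, hb2⟩, hx⟩
        have hd : Λ.d (Λ.comp l b) = rainbowDeg k N := by rw [Λ.d_comp _ _ hb2.symm, hb1, hmN]
        change x.pre (Λ.d (Λ.comp l b)) = Λ.comp l b at hx
        rw [hd, x.pre_comp hN] at hx
        exact (comp_inj (by rw [InfPath.s_pre, x.r_map]) hb2.symm (by simp) hx).1
    have hdisj : Pairwise (Function.onFun Disjoint
        fun b : {b : Λ.Mor // Λ.d b = m ∧ Λ.r b = Λ.s l} => Λ.cylinder (Λ.comp l b.1)) := by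
      rintro ⟨b, hb1, hb2⟩ ⟨b', hb1', hb2'⟩ hne
      refine Set.disjoint_left.2 fun x hx hx' => hne (Subtype.ext ?_)
      change x.pre (Λ.d (Λ.comp l b)) = Λ.comp l b at hx
      change x.pre (Λ.d (Λ.comp l b')) = Λ.comp l b' at hx'
      have hd : Λ.d (Λ.comp l b) = Λ.d (Λ.comp l b') := by
        rw [Λ.d_comp _ _ hb2.symm, Λ.d_comp _ _ hb2'.symm, hb1, hb1']
      rw [hd] at hx
      exact comp_left_cancel hb2.symm hb2'.symm (hx.symm.trans hx')
    rw [hunion, measure_iUnion hdisj fun b => measurableSet_cylinder _, tsum_fintype]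
    have hval : ∀ b : {b : Λ.Mor // Λ.d b = m ∧ Λ.r b = Λ.s l}, M (Λ.cylinder (Λ.comp l b.1)) =
        ENNReal.ofReal ((Λ.rhoPow (rainbowDeg k N))⁻¹ * Λ.pf (Λ.s b.1)) := by
      intro b
      rw [hrb _ N (by rw [Λ.d_comp _ _ b.2.2.symm, b.2.1, hmN]), Λ.s_comp _ _ b.2.2.symm]
    simp_rw [hval]
    rw [← ENNReal.ofReal_sum_of_nonneg fun b _ => hnn _ _, ← Finset.mul_sum, sum_mor_eq,
      hΛ.pf.cnt_mulVec, ← hmN, rhoPow_add, mul_inv, Pi.smul_apply, smul_eq_mul, mul_assoc,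
      inv_mul_cancel_left₀ (hΛ.rhoPow_pos m).ne']

end IsRegular

end Rainbow

end KGraph

/-! ### The Dixmier trace measure -/

/-- Finitely many bounded terms do not contribute to `lim (s - 1) ∑ₙ hₙ(s)`. -/
theorem tendsto_mul_tsum_of_tail {h : ℝ → ℕ → ℝ≥0∞} {N : ℕ} {K : ℝ≥0∞} (hK : K ≠ ∞)
    (hbd : ∀ s n, 1 < s → n < N → h s n ≤ K) {t : ℝ → ℕ → ℝ} (ht0 : ∀ s q, 1 < s → 0 ≤ t s q)
    (hts : ∀ s, 1 < s → Summable (t s))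
    (hht : ∀ s q, 1 < s → h s (q + N) = ENNReal.ofReal (t s q)) {c : ℝ}
    (hc : Tendsto (fun s => (s - 1) * ∑' q, t s q) (𝓝[>] 1) (𝓝 c)) :
    Tendsto (fun s : ℝ => ENNReal.ofReal (s - 1) * ∑' n, h s n) (𝓝[>] 1)
      (𝓝 (ENNReal.ofReal c)) := by
  have hhead : Tendsto (fun s : ℝ => ENNReal.ofReal (s - 1) * ∑ n ∈ Finset.range N, h s n)
      (𝓝[>] 1) (𝓝 0) := by
    have h1 : Tendsto (fun s : ℝ => ENNReal.ofReal (s - 1)) (𝓝[>] 1) (𝓝 0) := by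
      have : Continuous fun s : ℝ => ENNReal.ofReal (s - 1) :=
        ENNReal.continuous_ofReal.comp (continuous_id.sub continuous_const)
      have := this.tendsto 1
      rw [sub_self, ENNReal.ofReal_zero] at this
      exact this.mono_left nhdsWithin_le_nhds
    have h2 := ENNReal.Tendsto.mul_const (b := (N : ℝ≥0∞) * K) h1
      (Or.inr (ENNReal.mul_ne_top (ENNReal.natCast_ne_top N) hK))
    rw [zero_mul] at h2
    refine tendsto_of_tendsto_of_tendsto_of_le_of_le' tendsto_const_nhds h2
      (Eventually.of_forall fun _ => zero_le) ?_
    filter_upwards [self_mem_nhdsWithin] with s hs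
    refine mul_le_mul_right ?_ _
    calc ∑ n ∈ Finset.range N, h s n ≤ ∑ _n ∈ Finset.range N, K :=
          Finset.sum_le_sum fun n hn => hbd s n hs (Finset.mem_range.1 hn)
      _ = N * K := by simp
  have htail := (ENNReal.continuous_ofReal.tendsto c).comp hc
  have hsum := hhead.add htail
  rw [zero_add] at hsum
  refine hsum.congr' ?_
  filter_upwards [self_mem_nhdsWithin] with s (hs : 1 < s)
  rw [← Summable.sum_add_tsum_nat_add' (k := N) ENNReal.summable, mul_add]
  congr 1
  simp_rw [hht s _ hs]
  rw [← ENNReal.ofReal_tsum_of_nonneg (fun q => ht0 s q hs) (hts s hs),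
    ← ENNReal.ofReal_mul (sub_nonneg.2 hs.le)]
  rfl

namespace KGraph.IsRegular

variable {k : ℕ} [NeZero k] {Λ : KGraph.{u} k} [Λ.IsFinite] (hΛ : Λ.IsRegular)

include hΛ

/-- Abel means of the normalized matrices along the rainbow degrees. -/
theorem exists_tendsto_abel_normCnt [Nonempty Λ.Vert] :
    ∃ c : Λ.Vert → ℝ, (∀ v, 0 ≤ c v) ∧ (∃ v, 0 < c v) ∧ ∀ (N : ℕ) (u v : Λ.Vert),
      Tendsto (fun ε : ℝ => ε * ∑' q, Λ.rhoPow (rainbowDeg k (N + q)) ^ (-ε) *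
        Λ.normCnt (rainbowDeg k (N + q) - rainbowDeg k N) u v) (𝓝[>] 0) (𝓝 (c v * Λ.pf u)) := by
  obtain ⟨c, hc0, hc1, hc⟩ := Matrix.exists_tendsto_abel k hΛ.one_lt_rhoPow_one
    (hΛ.normCnt_nonneg 1) hΛ.pf.pos (hΛ.normCnt_mulVec 1) (fun y hy => hΛ.eigenspace y (by
      rw [normCnt, Matrix.smul_mulVec, inv_smul_eq_iff₀ (hΛ.rhoPow_pos 1).ne'] at hy
      exact hy))
  -- `c` is fixed before the sequences are chosen, so the same `c` serves for every starting level
  -- `N`.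
  refine ⟨c, hc0, hc1, fun N u v => hc _ _ (fun q => hΛ.rhoPow_pos _) (fun q => ?_)
    (fun q => hΛ.normCnt_nonneg _) (fun q => hΛ.normCnt_mulVec _) (fun q => ?_) u v⟩
  · rw [← add_assoc, rainbowDeg_add_period, rhoPow_add, mul_comm]
  · rw [← normCnt_add, ← add_assoc, rainbowDeg_add_period,
      tsub_add_eq_add_tsub (rainbowDeg_mono (Nat.le_add_right N q))]

theorem summable_abel_normCnt (N : ℕ) (u v : Λ.Vert) {ε : ℝ} (hε : 0 < ε) :
    Summable fun q => Λ.rhoPow (rainbowDeg k (N + q)) ^ (-ε) *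
      Λ.normCnt (rainbowDeg k (N + q) - rainbowDeg k N) u v := by
  have hs := (hasSum_rpow_neg (k := k) (a := fun q => Λ.rhoPow (rainbowDeg k (N + q)))
    hΛ.one_lt_rhoPow_one (fun q => hΛ.rhoPow_pos _) (fun q => by
      rw [← add_assoc, rainbowDeg_add_period, rhoPow_add, mul_comm]) hε).summable
  refine Summable.of_nonneg_of_le (fun q => mul_nonneg (Real.rpow_nonneg (hΛ.rhoPow_pos _).le _)
    (hΛ.normCnt_nonneg _ _ _)) (fun q => ?_) (hs.mul_right (Λ.pf u / Λ.pf v))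
  exact mul_le_mul_of_nonneg_left (hΛ.normCnt_le _ _ _) (Real.rpow_nonneg (hΛ.rhoPow_pos _).le _)

/-- The sum of the powers of the weights of the extensions by `q` edges of the paths in `S`. -/
theorem sum_weight_rpow {δ : ℝ} (hδ : 0 < δ) {N : ℕ} (S : Set (Λ.bratteli.PathN N)) (s : ℝ)
    (q : ℕ) :
    ∑ g, (BratteliDiagram.liftSet S q).indicator
        (fun g => Λ.weight δ ⟨N + q, g⟩ ^ (δ * s)) g =
      ∑ g, S.indicator (fun g => (Λ.rhoPow (rainbowDeg k N))⁻¹ * ∑ v, Λ.pf v ^ (δ * s) *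
        (Λ.rhoPow (rainbowDeg k (N + q)) ^ (-(s - 1)) *
          Λ.normCnt (rainbowDeg k (N + q) - rainbowDeg k N) (src g) v)) g := by
  have h := sum_liftSet_eq S q fun v =>
    Λ.rhoPow (rainbowDeg k (N + q)) ^ (-s) * Λ.pf v ^ (δ * s)
  have hw : ∀ g : Λ.bratteli.PathN (N + q), Λ.weight δ ⟨N + q, g⟩ ^ (δ * s) =
      Λ.rhoPow (rainbowDeg k (N + q)) ^ (-s) * Λ.pf (src g) ^ (δ * s) :=
    fun g => hΛ.weight_rpow hδ s ⟨N + q, g⟩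
  simp_rw [hw]
  rw [h]
  refine Finset.sum_congr rfl fun g _ => ?_
  congr 1
  funext g
  simp only [Matrix.mulVec, dotProduct, Finset.mul_sum]
  refine Finset.sum_congr rfl fun v _ => ?_
  set m := rainbowDeg k (N + q) - rainbowDeg k N with hm
  have hmN : rainbowDeg k (N + q) = rainbowDeg k N + m :=
    (add_tsub_cancel_of_le (rainbowDeg_mono (Nat.le_add_right N q))).symm
  have hp := hΛ.rhoPow_pos (rainbowDeg k (N + q))
  -- One factor `ρ⁻¹` is split off: its part of degree `m` normalizes the count and its part up to
  -- `N` is the mass factor of the cylinder. What remains is the Abel weight with `ε = s - 1`.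
  have h1 : Λ.rhoPow (rainbowDeg k (N + q)) ^ (-s) =
      (Λ.rhoPow (rainbowDeg k N))⁻¹ * (Λ.rhoPow m)⁻¹ *
        Λ.rhoPow (rainbowDeg k (N + q)) ^ (-(s - 1)) := by
    rw [← mul_inv, ← rhoPow_add, ← hmN, ← Real.rpow_neg_one, ← Real.rpow_add hp]
    congr 1
    ring
  rw [h1, normCnt, Matrix.smul_apply, Matrix.map_apply, smul_eq_mul]
  ring

/-- The sums over `v` and `g` are finite, so the Abel limits and `x_v^{δs} → x_v^δ` combine
termwise. The factor `∑ x_v^δ c_v` separates because the limits have rank one. -/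
theorem tendsto_sum_weight_rpow {c : Λ.Vert → ℝ}
    (hc : ∀ (N : ℕ) (u v : Λ.Vert), Tendsto (fun ε : ℝ => ε * ∑' q,
      Λ.rhoPow (rainbowDeg k (N + q)) ^ (-ε) *
        Λ.normCnt (rainbowDeg k (N + q) - rainbowDeg k N) u v) (𝓝[>] 0) (𝓝 (c v * Λ.pf u)))
    {δ : ℝ} (hδ : 0 < δ) {N : ℕ} (S : Set (Λ.bratteli.PathN N)) :
    (∀ s, 1 < s → Summable fun q => ∑ g, (BratteliDiagram.liftSet S q).indicator
        (fun g => Λ.weight δ ⟨N + q, g⟩ ^ (δ * s)) g) ∧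
    Tendsto (fun s : ℝ => (s - 1) * ∑' q, ∑ g, (BratteliDiagram.liftSet S q).indicator
        (fun g => Λ.weight δ ⟨N + q, g⟩ ^ (δ * s)) g) (𝓝[>] 1)
      (𝓝 ((∑ v, Λ.pf v ^ δ * c v) * ∑ g, S.indicator
        (fun g => (Λ.rhoPow (rainbowDeg k N))⁻¹ * Λ.pf (src g)) g)) := by
  classical
  simp_rw [hΛ.sum_weight_rpow hδ S]
  have hterm : ∀ s, 1 < s → ∀ u, HasSum (fun q => (Λ.rhoPow (rainbowDeg k N))⁻¹ *
      ∑ v, Λ.pf v ^ (δ * s) * (Λ.rhoPow (rainbowDeg k (N + q)) ^ (-(s - 1)) *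
          Λ.normCnt (rainbowDeg k (N + q) - rainbowDeg k N) u v))
      ((Λ.rhoPow (rainbowDeg k N))⁻¹ * ∑ v, Λ.pf v ^ (δ * s) *
        ∑' q, Λ.rhoPow (rainbowDeg k (N + q)) ^ (-(s - 1)) *
          Λ.normCnt (rainbowDeg k (N + q) - rainbowDeg k N) u v) := fun s hs u =>
    (hasSum_sum fun v _ =>
      (hΛ.summable_abel_normCnt N u v (sub_pos.2 hs)).hasSum.mul_left _).mul_left _
  have hsum : ∀ s, 1 < s → HasSum (fun q => ∑ g, S.indicator
      (fun g => (Λ.rhoPow (rainbowDeg k N))⁻¹ * ∑ v, Λ.pf v ^ (δ * s) *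
        (Λ.rhoPow (rainbowDeg k (N + q)) ^ (-(s - 1)) *
          Λ.normCnt (rainbowDeg k (N + q) - rainbowDeg k N) (src g) v)) g)
      (∑ g, S.indicator (fun g => (Λ.rhoPow (rainbowDeg k N))⁻¹ * ∑ v, Λ.pf v ^ (δ * s) *
        ∑' q, Λ.rhoPow (rainbowDeg k (N + q)) ^ (-(s - 1)) *
          Λ.normCnt (rainbowDeg k (N + q) - rainbowDeg k N) (src g) v) g) := by
    intro s hs
    refine hasSum_sum fun g _ => ?_
    by_cases hg : g ∈ S
    · simp only [Set.indicator_of_mem hg]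
      exact hterm s hs (src g)
    · simp only [Set.indicator_of_notMem hg]
      exact hasSum_zero
  refine ⟨fun s hs => (hsum s hs).summable, ?_⟩
  have hsub : Tendsto (fun s : ℝ => s - 1) (𝓝[>] 1) (𝓝[>] 0) := by
    refine tendsto_nhdsWithin_iff.2 ⟨?_, ?_⟩
    · have hcont : Continuous fun s : ℝ => s - 1 := by fun_prop
      have h := hcont.tendsto 1
      simp only [sub_self] at h
      exact h.mono_left nhdsWithin_le_nhds
    · filter_upwards [self_mem_nhdsWithin] with s (hs : 1 < s)
      exact sub_pos.2 hs
  have hpf : ∀ v, Tendsto (fun s : ℝ => Λ.pf v ^ (δ * s)) (𝓝[>] 1) (𝓝 (Λ.pf v ^ δ)) := by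
    intro v
    have : Continuous fun s : ℝ => Λ.pf v ^ (δ * s) :=
      continuous_const.rpow (continuous_const.mul continuous_id) fun _ => Or.inl (hΛ.pf.pos v).ne'
    have := this.tendsto 1
    rw [mul_one] at this
    exact this.mono_left nhdsWithin_le_nhds
  have hlim : Tendsto (fun s : ℝ => ∑ g, S.indicator (fun g => (Λ.rhoPow (rainbowDeg k N))⁻¹ *
      ∑ v, Λ.pf v ^ (δ * s) * ((s - 1) *
        ∑' q, Λ.rhoPow (rainbowDeg k (N + q)) ^ (-(s - 1)) *
          Λ.normCnt (rainbowDeg k (N + q) - rainbowDeg k N) (src g) v)) g) (𝓝[>] 1)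
      (𝓝 (∑ g, S.indicator (fun g => (Λ.rhoPow (rainbowDeg k N))⁻¹ *
        ∑ v, Λ.pf v ^ δ * (c v * Λ.pf (src g))) g)) := by
    refine tendsto_finsetSum _ fun g _ => ?_
    by_cases hg : g ∈ S
    · simp only [Set.indicator_of_mem hg]
      exact (tendsto_finsetSum _ fun v _ =>
        (hpf v).mul ((hc N (src g) v).comp hsub)).const_mul _
    · simp only [Set.indicator_of_notMem hg]
      exact tendsto_const_nhds
  have heq : (∑ v, Λ.pf v ^ δ * c v) * ∑ g, S.indicator
        (fun g => (Λ.rhoPow (rainbowDeg k N))⁻¹ * Λ.pf (src g)) g =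
      ∑ g, S.indicator (fun g => (Λ.rhoPow (rainbowDeg k N))⁻¹ *
        ∑ v, Λ.pf v ^ δ * (c v * Λ.pf (src g))) g := by
    rw [Finset.mul_sum]
    refine Finset.sum_congr rfl fun g _ => ?_
    by_cases hg : g ∈ S
    · simp only [Set.indicator_of_mem hg, ← mul_assoc, ← Finset.sum_mul]
      ring
    · simp only [Set.indicator_of_notMem hg, mul_zero]
  rw [heq]
  refine hlim.congr' ?_
  filter_upwards [self_mem_nhdsWithin] with s (hs : 1 < s)
  rw [(hsum s hs).tsum_eq, Finset.mul_sum]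
  refine Finset.sum_congr rfl fun g _ => ?_
  by_cases hg : g ∈ S
  · simp only [Set.indicator_of_mem hg, Finset.mul_sum]
    exact Finset.sum_congr rfl fun v _ => by ring
  · simp only [Set.indicator_of_notMem hg, mul_zero]

/-- The Dixmier traces of the clopen sets. -/
theorem hasDixmierTrace_takeN [Nonempty Λ.Vert] {c : Λ.Vert → ℝ}
    (hc : ∀ (N : ℕ) (u v : Λ.Vert), Tendsto (fun ε : ℝ => ε * ∑' q,
      Λ.rhoPow (rainbowDeg k (N + q)) ^ (-ε) *
        Λ.normCnt (rainbowDeg k (N + q) - rainbowDeg k N) u v) (𝓝[>] 0) (𝓝 (c v * Λ.pf u)))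
    {δ : ℝ} (hδ : 0 < δ) (hδ1 : δ < 1) (τ : BratteliDiagram.ChoiceFunction (Λ.weight δ))
    {N : ℕ} (S : Set (Λ.bratteli.PathN N)) :
    HasDixmierTrace (τ.rep (BratteliDiagram.chi {x | x.takeN N ∈ S}) *
      BratteliDiagram.absDiracPow (Λ.weight δ) δ)
      (ENNReal.ofReal (2 * ((∑ v, Λ.pf v ^ δ * c v) * ∑ g, S.indicator
        (fun g => (Λ.rhoPow (rainbowDeg k N))⁻¹ * Λ.pf (src g)) g))) := by
  classical
  set O : Set Λ.bratteli.PathSpace := {x | x.takeN N ∈ S}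
  have h0 : ∀ γ, 0 ≤ BratteliDiagram.cylDiam (Λ.weight δ) γ := fun γ => by
    rw [hΛ.cylDiam_weight hδ hδ1]; exact (hΛ.weight_pos δ γ).le
  have h1 : ∀ γ, BratteliDiagram.cylDiam (Λ.weight δ) γ ≤ 1 := fun γ => by
    rw [hΛ.cylDiam_weight hδ hδ1]; exact hΛ.weight_le_one hδ γ
  refine ⟨BratteliDiagram.rep_mul_absDiracPow_nonneg h0 h1 τ O hδ, ?_⟩
  let H : ℝ → Λ.bratteli.FinPath → ℝ≥0∞ := fun s γ =>
    (if τ.pos γ ∈ O then ENNReal.ofReal (Λ.weight δ γ ^ (δ * s)) else 0) +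
      if τ.neg γ ∈ O then ENNReal.ofReal (Λ.weight δ γ ^ (δ * s)) else 0
  have htrace : ∀ s, 1 < s → posTrace ((τ.rep (BratteliDiagram.chi O) *
      BratteliDiagram.absDiracPow (Λ.weight δ) δ) ^ s) = ∑' n, ∑ g, H s ⟨n, g⟩ := by
    intro s hs
    rw [BratteliDiagram.posTrace_rep_mul_absDiracPow h0 h1 τ O hδ (by linarith)]
    simp_rw [hΛ.cylDiam_weight hδ hδ1]
    exact (ENNReal.tsum_sigma' (H s)).trans (tsum_congr fun n => tsum_fintype _)
  have hwle : ∀ s, 1 < s → ∀ γ : Λ.bratteli.FinPath,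
      ENNReal.ofReal (Λ.weight δ γ ^ (δ * s)) ≤ 1 := fun s hs γ =>
    ENNReal.ofReal_le_one.2 (Real.rpow_le_one (hΛ.weight_pos δ γ).le (hΛ.weight_le_one hδ γ)
      (mul_nonneg hδ.le (by linarith)))
  have hHle : ∀ s, 1 < s → ∀ γ, H s γ ≤ 2 := by
    intro s hs γ
    rw [← one_add_one_eq_two]
    refine add_le_add ?_ ?_ <;> split_ifs
    exacts [hwle s hs γ, zero_le, hwle s hs γ, zero_le]
  have htail := (hΛ.tendsto_sum_weight_rpow hc hδ S)
  have hnn : ∀ s q (g : Λ.bratteli.PathN (N + q)), 0 ≤ (BratteliDiagram.liftSet S q).indicator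
      (fun g => Λ.weight δ ⟨N + q, g⟩ ^ (δ * s)) g := fun s q g =>
    Set.indicator_nonneg (fun g _ => Real.rpow_nonneg (hΛ.weight_pos δ _).le _) g
  -- Once a path has length at least `N`, its cylinder lies in `O` or misses it, so both chosen
  -- points agree; this yields the factor `2`.
  have hmem : ∀ q (g : Λ.bratteli.PathN (N + q)) (x : Λ.bratteli.PathSpace),
      x ∈ BratteliDiagram.FinPath.cylinder (⟨N + q, g⟩ : Λ.bratteli.FinPath) →
      (x ∈ O ↔ g ∈ BratteliDiagram.liftSet S q) := by
    intro q g x hx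
    have h : x.takeN (N + q) = g := (BratteliDiagram.FinPath.mem_cylinder_iff _ _).1 hx
    rw [← h, BratteliDiagram.takeN_mem_liftSet_iff]
    rfl
  have hH : ∀ s q (g : Λ.bratteli.PathN (N + q)), H s ⟨N + q, g⟩ =
      ENNReal.ofReal (2 * (BratteliDiagram.liftSet S q).indicator
        (fun g => Λ.weight δ ⟨N + q, g⟩ ^ (δ * s)) g) := by
    intro s q g
    simp only [H, hmem q g _ (τ.pos_mem _), hmem q g _ (τ.neg_mem _)]
    by_cases hg : g ∈ BratteliDiagram.liftSet S q
    · rw [if_pos hg, Set.indicator_of_mem hg, two_mul, ENNReal.ofReal_add]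
      all_goals exact Real.rpow_nonneg (hΛ.weight_pos δ _).le _
    · rw [if_neg hg, Set.indicator_of_notMem hg, mul_zero, ENNReal.ofReal_zero, add_zero]
  have hlim := htail.2.const_mul 2
  refine (tendsto_mul_tsum_of_tail (h := fun s n => ∑ g, H s ⟨n, g⟩) (N := N)
    (K := ∑ n ∈ Finset.range N, ∑ _g : Λ.bratteli.PathN n, 2)
    (t := fun s q => 2 * ∑ g, (BratteliDiagram.liftSet S q).indicator
        (fun g => Λ.weight δ ⟨N + q, g⟩ ^ (δ * s)) g) ?_ ?_ ?_ ?_ ?_ ?_).congr' ?_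
  · exact ENNReal.sum_ne_top.2 fun n _ => ENNReal.sum_ne_top.2 fun g _ => ENNReal.ofNat_ne_top
  · intro s n hs hn
    exact (Finset.sum_le_sum fun g _ => hHle s hs _).trans
      (Finset.single_le_sum (f := fun n => ∑ _g : Λ.bratteli.PathN n, (2 : ℝ≥0∞))
        (fun _ _ => zero_le) (Finset.mem_range.2 hn))
  · exact fun s q _ => mul_nonneg zero_le_two (Finset.sum_nonneg fun g _ => hnn s q g)
  · exact fun s hs => (htail.1 s hs).mul_left 2
  · intro s q _
    -- Paths of lengths `q + N` and `N + q` have different types, so the lengths are generalized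
    -- before they are identified.
    have h : ∀ m n : ℕ, m = n → ∑ g : Λ.bratteli.PathN m, H s ⟨m, g⟩ = ∑ g, H s ⟨n, g⟩ := by
      rintro m _ rfl
      rfl
    refine (h _ _ (add_comm q N)).trans ?_
    simp_rw [hH]
    rw [← ENNReal.ofReal_sum_of_nonneg fun g _ => mul_nonneg zero_le_two (hnn s q g),
      ← Finset.mul_sum]
  · refine hlim.congr fun s => ?_
    rw [tsum_mul_left]
    ring
  · filter_upwards [self_mem_nhdsWithin] with s (hs : 1 < s)
    rw [htrace s hs]

end KGraph.IsRegular

/-- The Dixmier trace of an operator is unique. -/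
theorem HasDixmierTrace.unique {ι : Type u} {T : L2C2 ι →L[ℂ] L2C2 ι} {a b : ℝ≥0∞}
    (ha : HasDixmierTrace T a) (hb : HasDixmierTrace T b) : a = b :=
  tendsto_nhds_unique ha.2 hb.2

/-! ### Comparison of the two measures and conclusion -/

namespace KGraph.IsRegular

variable {k : ℕ} [NeZero k] {Λ : KGraph.{u} k} [Λ.IsFinite] (hΛ : Λ.IsRegular)

include hΛ

/-- There is a unique measure with the values of the an Huef-Laca-Raeburn-Sims measure. -/
theorem exists_isAHLRSMeasure [Nonempty Λ.Vert] :
    ∃ M : Measure Λ.InfPath, IsProbabilityMeasure M ∧ Λ.IsAHLRSMeasure M ∧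
      ∀ M' : Measure Λ.InfPath, Λ.IsAHLRSMeasure M' → M' = M := by
  obtain ⟨MX, hMX, hcyl⟩ := hΛ.exists_path_measure
  have hm : Measurable Λ.toBratteli := Λ.bratteliHomeomorph.continuous.measurable
  have hm' : Measurable Λ.bratteliHomeomorph.symm := Λ.bratteliHomeomorph.symm.continuous.measurable
  have hback : ∀ M : Measure Λ.InfPath,
      (M.map Λ.toBratteli).map Λ.bratteliHomeomorph.symm = M := by
    intro M
    rw [Measure.map_map hm' hm,
      show Λ.bratteliHomeomorph.symm ∘ Λ.toBratteli = id from
        funext Λ.bratteliHomeomorph.symm_apply_apply, Measure.map_id]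
  have hforth : (MX.map Λ.bratteliHomeomorph.symm).map Λ.toBratteli = MX := by
    rw [Measure.map_map hm hm',
      show Λ.toBratteli ∘ Λ.bratteliHomeomorph.symm = id from
        funext Λ.bratteliHomeomorph.apply_symm_apply, Measure.map_id]
  refine ⟨MX.map Λ.bratteliHomeomorph.symm, Measure.isProbabilityMeasure_map hm'.aemeasurable,
    (hΛ.isAHLRSMeasure_iff _).2 fun γ => ?_, fun M' hM' => ?_⟩
  · rw [hforth, hcyl]
  · have h : MX = M'.map Λ.toBratteli := BratteliDiagram.measure_ext_cylinder fun γ => by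
      rw [hcyl, (hΛ.isAHLRSMeasure_iff _).1 hM']
    rw [h, hback]

/-- The Dixmier traces of the clopen sets are proportional to their measures. -/
theorem exists_hasDixmierTrace [Nonempty Λ.Vert] {M : Measure Λ.InfPath} (hM : Λ.IsAHLRSMeasure M)
    {δ : ℝ} (hδ : 0 < δ) (hδ1 : δ < 1) :
    ∃ C : ℝ, 0 < C ∧ ∀ (τ : BratteliDiagram.ChoiceFunction (Λ.weight δ))
      (O : Set Λ.bratteli.PathSpace), IsClopen O →
      HasDixmierTrace (τ.rep (BratteliDiagram.chi O) *
        BratteliDiagram.absDiracPow (Λ.weight δ) δ)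
        (ENNReal.ofReal C * M.map Λ.toBratteli O) := by
  classical
  obtain ⟨c, hc0, ⟨v, hv⟩, hc⟩ := hΛ.exists_tendsto_abel_normCnt
  have hC : 0 < ∑ v, Λ.pf v ^ δ * c v :=
    Finset.sum_pos' (fun v _ => mul_nonneg (Real.rpow_nonneg (hΛ.pf.pos v).le _) (hc0 v))
      ⟨v, Finset.mem_univ v, mul_pos (Real.rpow_pos_of_pos (hΛ.pf.pos v) _) hv⟩
  refine ⟨2 * ∑ v, Λ.pf v ^ δ * c v, mul_pos two_pos hC, fun τ O hO => ?_⟩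
  obtain ⟨N, S, rfl⟩ := BratteliDiagram.exists_eq_takeN_preimage hO
  have hnn : ∀ g : Λ.bratteli.PathN N, 0 ≤ S.indicator
      (fun g => (Λ.rhoPow (rainbowDeg k N))⁻¹ * Λ.pf (src g)) g := fun g =>
    Set.indicator_nonneg (fun g _ =>
      mul_nonneg (inv_nonneg.2 (hΛ.rhoPow_pos _).le) (hΛ.pf.pos _).le) g
  have h : M.map Λ.toBratteli {x | x.takeN N ∈ S} = ENNReal.ofReal (∑ g, S.indicator
      (fun g => (Λ.rhoPow (rainbowDeg k N))⁻¹ * Λ.pf (src g)) g) := by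
    rw [BratteliDiagram.measure_takeN_preimage,
      ENNReal.ofReal_sum_of_nonneg fun g _ => hnn g]
    refine Finset.sum_congr rfl fun g _ => ?_
    by_cases hg : g ∈ S
    · rw [Set.indicator_of_mem hg, Set.indicator_of_mem hg, (hΛ.isAHLRSMeasure_iff M).1 hM]
    · rw [Set.indicator_of_notMem hg, Set.indicator_of_notMem hg, ENNReal.ofReal_zero]
  rw [h, ← ENNReal.ofReal_mul (mul_pos two_pos hC).le, mul_assoc]
  exact hΛ.hasDixmierTrace_takeN hc hδ hδ1 τ S

end KGraph.IsRegular

theorem theorem3p19 {k : ℕ} [NeZero k] (Λ : KGraph.{u} k) [Nonempty Λ.Vert] [Λ.IsFinite]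
    (hconn : Λ.StronglyConnected)
    (htwo : ∀ (i : Fin k) (v : Λ.Vert), 2 ≤ ∑ w, Λ.adj i v w)
    (hirr : (Λ.adjProd.map (Nat.cast : ℕ → ℝ)).IsIrreducible) :
    (∃! x, Λ.IsPerronFrobenius x) ∧
    IsHomeomorph Λ.toBratteli ∧
    ∃ M : Measure Λ.InfPath,
      IsProbabilityMeasure M ∧
      Λ.IsAHLRSMeasure M ∧
      (∀ M' : Measure Λ.InfPath, Λ.IsAHLRSMeasure M' → M' = M) ∧
      ∀ δ : ℝ, 0 < δ → δ < 1 →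
        Nonempty (BratteliDiagram.ChoiceFunction (Λ.weight δ)) ∧
        ∃ μ : Measure Λ.bratteli.PathSpace,
          (∀ τ : BratteliDiagram.ChoiceFunction (Λ.weight δ),
            Λ.IsDixmierMeasure δ τ μ ∧
            (∀ μ' : Measure Λ.bratteli.PathSpace, Λ.IsDixmierMeasure δ τ μ' → μ' = μ) ∧
            (∀ O : Set Λ.bratteli.PathSpace, IsClopen O → HasDixmierTrace
              (τ.rep (BratteliDiagram.chi O) * BratteliDiagram.absDiracPow (Λ.weight δ) δ)
              (μ O)) ∧
            HasDixmierTrace (BratteliDiagram.absDiracPow (Λ.weight δ) δ) (μ Set.univ)) ∧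
          0 < μ Set.univ ∧ μ Set.univ < ∞ ∧
          IsProbabilityMeasure ((μ Set.univ)⁻¹ • μ) ∧
          ∀ O : Set Λ.bratteli.PathSpace, MeasurableSet O →
            ((μ Set.univ)⁻¹ • μ) O = M (Λ.toBratteli ⁻¹' O) := by
  have hΛ := KGraph.isRegular htwo hirr
  obtain ⟨M, hMp, hM, huniq⟩ := hΛ.exists_isAHLRSMeasure
  refine ⟨KGraph.existsUnique_isPerronFrobenius hirr, KGraph.isHomeomorph_toBratteli, M, hMp, hM,
    huniq, fun δ hδ hδ1 => ⟨hΛ.nonempty_choiceFunction hδ hδ1, ?_⟩⟩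
  obtain ⟨C, hC, htr⟩ := hΛ.exists_hasDixmierTrace hM hδ hδ1
  have hm : Measurable Λ.toBratteli := Λ.bratteliHomeomorph.continuous.measurable
  have hp : IsProbabilityMeasure (M.map Λ.toBratteli) :=
    Measure.isProbabilityMeasure_map hm.aemeasurable
  -- Taking `μ` to be a multiple of the image of `M` makes countable additivity automatic; only its
  -- values on clopen sets need comparing with traces.
  set μ : Measure Λ.bratteli.PathSpace := ENNReal.ofReal C • M.map Λ.toBratteli with hμ
  have hμu : μ Set.univ = ENNReal.ofReal C := by
    rw [hμ, Measure.smul_apply, measure_univ, smul_eq_mul, mul_one]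
  have hC0 : ENNReal.ofReal C ≠ 0 := (ENNReal.ofReal_pos.2 hC).ne'
  have hfin : IsFiniteMeasure μ := ⟨by rw [hμu]; exact ENNReal.ofReal_lt_top⟩
  have hnorm : (μ Set.univ)⁻¹ • μ = M.map Λ.toBratteli := by
    rw [hμu, hμ, smul_smul, ENNReal.inv_mul_cancel hC0 ENNReal.ofReal_ne_top, one_smul]
  have htrace : ∀ (τ : BratteliDiagram.ChoiceFunction (Λ.weight δ))
      (O : Set Λ.bratteli.PathSpace), IsClopen O → HasDixmierTrace
        (τ.rep (BratteliDiagram.chi O) * BratteliDiagram.absDiracPow (Λ.weight δ) δ) (μ O) :=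
    fun τ O hO => htr τ O hO
  refine ⟨μ, fun τ => ⟨⟨hfin, fun γ => htrace τ _ γ.isClopen_cylinder⟩, fun μ' hμ' => ?_,
    htrace τ, ?_⟩, ?_, ?_, ?_, fun O hO => ?_⟩
  · have := hμ'.finite
    exact BratteliDiagram.measure_ext_cylinder fun γ =>
      (hμ'.cylinder γ).unique (htrace τ _ γ.isClopen_cylinder)
  · have h := htrace τ Set.univ isClopen_univ
    rwa [BratteliDiagram.rep_chi_univ, one_mul] at h
  · rw [hμu]
    exact ENNReal.ofReal_pos.2 hC
  · exact measure_lt_top μ _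
  · rw [hnorm]
    exact hp
  · rw [hnorm, Measure.map_apply hm hO]
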